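/- Let $\omega_1,\omega_2,\mu$ be real, $\omega=\omega_1+i\omega_2$. The $\sigma$-form of Painlevé VI with parameters $\mathbf b=(b_1,\dots,b_4)$ is $$(\mathrm{VI})\qquad h'\big(t(1-t)h''\big)^2+\big(h'[2h-(2t-1)h']+b_1b_2b_3b_4\big)^2=\prod_{k=1}^4(h'+b_k^2),$$ and the $\sigma$-form of Painlevé V with parameters $\mathbf v$, $v_1+v_2+v_3+v_4=0$, is $$(\mathrm{V})\qquad (th'')^2-\big(h-th'+2(h')^2\big)^2+4\prod_{k=1}^4(h'+v_k)=0 .$$ For $N\ge1$ put $$\mathbf b=\Big(\tfrac12(N+\omega-\mu),\ \bar\omega+\tfrac12(N+\omega+\mu),\ \tfrac12(N-\omega+\mu),\ -\mu-\tfrac12(N+\omega+\mu)\Big),$$ $C_1=b_1b_3+b_1b_4+b_3b_4+\mu N$ and $C_2=\tfrac12\sum_{j<k}b_jb_k+\mu N$. Let $\mathbf v$ be given by $v_j=\tilde v_j-\tfrac{i\omega_2}{2}$ with $\tilde{\mathbf v}=(\mu,-\mu,\omega,-\bar\omega)$; then $v_1+v_2+v_3+v_4=0$. (1) Let $J\subseteq(0,\infty)$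 be open and $u:J\to\mathbb C$ twice differentiable. Substitute $h(t)=u(X)+C_1t-C_2$, $t=e^{iX/N}$, in (VI), with $X\in J$ fixed and $N\to\infty$. Then $h'/N^2\to-\tfrac14$, and the difference of the left and right hand sides of (VI), divided by $h'$, has leading term of order $N^2$: divided further by $N^2$ it converges to the left hand side of (V), with the parameters $\mathbf v$, for the function $$h(t)=u(it)+\tfrac{i\omega_2}{2}t+2\omega_1\mu+\tfrac{\omega_2^2}{2}$$ at $t=-iX$. (So the vanishing of the leading coefficient is exactly (V) for this function.) (2) Assume $\omega_1>-\tfrac12$, $\mu>-\tfrac12$, let $\xi\in\mathbb C$ and $\xi^*=1-(1-\xi)e^{-2\pi i\mu}$. Let $$A_N(X)=\Big\langle\prod_{l=1}^N\big(1-\xi^*\chi_{(\pi-X/N,\pi)}(\theta_l)\big)e^{\omega_2\theta_l}|1+z_l|^{2\omega_1}\big|e^{i(\pi-X/N)}-z_l\big|^{2\mu}\Big\rangle_{\mathrm{CUE}_N},\qquad z_l=e^{i\theta_l},\ -\pi<\theta_l\le\pi,$$ where the average is over the probability density proportional to $\prod_{j<k}|z_k-z_j|^2$, and let $$u(X;(\omega_1,\omega_2),\mu;\xi)=\lim_{N\to\infty}X\frac{d}{dX}\log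 A_N(X).$$ Let $J\subseteq(0,\infty)$ be an open set on which this limit exists locally uniformly, with $A_N(X)\neq0$ for each $X\in J$ and all sufficiently large $N$. Then $$h(t)=u(it;(\omega_1,\omega_2),\mu;\xi)+\tfrac{i\omega_2}{2}t+2\omega_1\mu+\tfrac{\omega_2^2}{2},\qquad it\in J,$$ is twice differentiable and satisfies (V) with the parameters $\mathbf v$. -/

import Mathlib

noncomputable section

namespace CircularJacobi

/-- The difference of the two sides of the Jimbo-Miwa-Okamoto `σ`-form of Painlevé VI
with parameters `b`, in terms of the values of `t`, `h`, `h'`, `h''`. -/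
def sigmaPVI (b : Fin 4 → ℂ) (t h h₁ h₂ : ℂ) : ℂ :=
  h₁ * (t * (1 - t) * h₂) ^ 2
    + (h₁ * (2 * h - (2 * t - 1) * h₁) + b 0 * b 1 * b 2 * b 3) ^ 2
    - ∏ k, (h₁ + b k ^ 2)

/-- The left hand side of the `σ`-form of Painlevé V with parameters `v`,
in terms of the values of `t`, `h`, `h'`, `h''`. -/
def sigmaPV (v : Fin 4 → ℂ) (t h h₁ h₂ : ℂ) : ℂ :=
  (t * h₂) ^ 2 - (h - t * h₁ + 2 * h₁ ^ 2) ^ 2 + 4 * ∏ k, (h₁ + v k)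

/-- `sigmaPVI` evaluated on a function `h` at the point `t` of a curve `S ⊆ ℂ`; derivatives are
complex derivatives along the curve. -/
def sigmaPVIAt (b : Fin 4 → ℂ) (S : Set ℂ) (h : ℂ → ℂ) (t : ℂ) : ℂ :=
  sigmaPVI b t (h t) (derivWithin h S t) (derivWithin (derivWithin h S) S t)

/-- `sigmaPV` evaluated on a function `h` at the point `t` of a curve `S ⊆ ℂ`. -/
def sigmaPVAt (v : Fin 4 → ℂ) (S : Set ℂ) (h : ℂ → ℂ) (t : ℂ) : ℂ :=
  sigmaPV v t (h t) (derivWithin h S t) (derivWithin (derivWithin h S) S t)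

/-- `h` is a (twice differentiable) solution, on the curve `S ⊆ ℂ`, of the `σ`-form of
Painlevé V with parameters `v`, where `v₁ + v₂ + v₃ + v₄ = 0`. -/
def SolvesSigmaPV (v : Fin 4 → ℂ) (S : Set ℂ) (h : ℂ → ℂ) : Prop :=
  ∑ k, v k = 0 ∧ DifferentiableOn ℂ h S ∧ DifferentiableOn ℂ (derivWithin h S) S ∧
    ∀ t ∈ S, sigmaPVAt v S h t = 0

/-- `ω = ω₁ + i ω₂`. -/
def omega (ω₁ ω₂ : ℝ) : ℂ := ω₁ + Complex.I * ω₂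

/-- The parameters `b` of the `σ`-form of Painlevé VI for the `N`-dimensional average. -/
def bVI (N : ℕ) (ω₁ ω₂ μ : ℝ) : Fin 4 → ℂ :=
  ![(N + omega ω₁ ω₂ - μ) / 2,
    (starRingEnd ℂ) (omega ω₁ ω₂) + (N + omega ω₁ ω₂ + μ) / 2,
    (N - omega ω₁ ω₂ + μ) / 2,
    -μ - (N + omega ω₁ ω₂ + μ) / 2]

/-- The second elementary symmetric function of `b₁, b₃, b₄`. -/
def e₂' (b : Fin 4 → ℂ) : ℂ := b 0 * b 2 + b 0 * b 3 + b 2 * b 3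

/-- The second elementary symmetric function of `b₁, b₂, b₃, b₄`. -/
def e₂ (b : Fin 4 → ℂ) : ℂ := ∑ j, ∑ k ∈ Finset.Ioi j, b j * b k

/-- `C₁ = e₂'[b] + μ N`. -/
def C₁ (N : ℕ) (ω₁ ω₂ μ : ℝ) : ℂ := e₂' (bVI N ω₁ ω₂ μ) + μ * N

/-- `C₂ = e₂[b] / 2 + μ N`. -/
def C₂ (N : ℕ) (ω₁ ω₂ μ : ℝ) : ℂ := e₂ (bVI N ω₁ ω₂ μ) / 2 + μ * N

/-- The function `u + C₁ t - C₂` of `t`, on the unit circle, where `u` is a function of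
`X` and `t = e^{iX/N}`, i.e. `X = N arg t`. -/
def hVI (N : ℕ) (ω₁ ω₂ μ : ℝ) (u : ℝ → ℂ) (t : ℂ) : ℂ :=
  u (N * t.arg) + C₁ N ω₁ ω₂ μ * t - C₂ N ω₁ ω₂ μ

/-- The unit circle in `ℂ`. -/
def unitCircle : Set ℂ := Metric.sphere 0 1

/-- The part `-i J` of the imaginary axis, i.e. the set of all `t` with `i t = X ∈ J`. -/
def rotated (J : Set ℝ) : Set ℂ := {t | ∃ X ∈ J, Complex.I * t = (X : ℂ)}

/-- The function `h(t) = u(it) + (i ω₂ / 2) t + 2 ω₁ μ + ω₂² / 2`, for `it` real. -/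
def hV (ω₁ ω₂ μ : ℝ) (u : ℝ → ℂ) (t : ℂ) : ℂ :=
  u (Complex.I * t).re + Complex.I * ω₂ / 2 * t + 2 * ω₁ * μ + (ω₂ : ℂ) ^ 2 / 2

/-- The parameters `v_j = ṽ_j - i ω₂ / 2`, where `ṽ = (μ, -μ, ω, -ω̄)`. -/
def vV (ω₁ ω₂ μ : ℝ) (j : Fin 4) : ℂ :=
  ![(μ : ℂ), -μ, omega ω₁ ω₂, -(starRingEnd ℂ) (omega ω₁ ω₂)] j - Complex.I * ω₂ / 2

/-- The point `e^{iθ}`. -/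
def cis (θ : ℝ) : ℂ := Complex.exp (Complex.I * θ)

/-- The unnormalised integral of `f` against the eigenvalue density
`∏_{j<k} |e^{iθ_k} - e^{iθ_j}|²` of the circular unitary ensemble, `-π < θ_l ≤ π`. -/
def cueIntegral (N : ℕ) (f : (Fin N → ℝ) → ℂ) : ℂ :=
  ∫ θ in Set.univ.pi (fun _ : Fin N => Set.Ioc (-Real.pi) Real.pi),
    f θ * ((∏ j, ∏ k ∈ Finset.Ioi j, ‖cis (θ k) - cis (θ j)‖ ^ 2 : ℝ) : ℂ)

/-- The average of `f` over the eigenvalues of the circular unitary ensemble. -/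
def cueAverage (N : ℕ) (f : (Fin N → ℝ) → ℂ) : ℂ :=
  cueIntegral N f / cueIntegral N (fun _ => 1)

/-- `ξ* = 1 - (1 - ξ) e^{-2πiμ}` (the exponent of the factor it goes with is `2μ`). -/
def xiStar (μ : ℝ) (ξ : ℂ) : ℂ :=
  1 - (1 - ξ) * Complex.exp (-(2 * Real.pi * Complex.I * μ))

/-- The circular Jacobi average with angle `φ`:
the CUE average of the product over `l` of
`(1 - ξ* χ_{(π - φ, π)}(θ_l)) e^{ω₂ θ_l} |1 + z_l|^{2ω₁} |e^{i(π - φ)} - z_l|^{2μ}`,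
`z_l = e^{iθ_l}`. -/
def cJacobiAverage (N : ℕ) (ω₁ ω₂ μ : ℝ) (ξ : ℂ) (φ : ℝ) : ℂ :=
  cueAverage N fun θ => ∏ l,
    (1 - xiStar μ ξ * (Set.Ioo (Real.pi - φ) Real.pi).indicator (fun _ => (1 : ℂ)) (θ l))
      * ((Real.exp (ω₂ * θ l) * ‖1 + cis (θ l)‖ ^ (2 * ω₁)
          * ‖cis (Real.pi - φ) - cis (θ l)‖ ^ (2 * μ) : ℝ) : ℂ)

/-- The average with `φ = X / N`, as a function of `X`. -/
def scaledAverage (N : ℕ) (ω₁ ω₂ μ : ℝ) (ξ : ℂ) (X : ℝ) : ℂ :=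
  cJacobiAverage N ω₁ ω₂ μ ξ (X / N)

/-- `X d/dX log` of the average with `φ = X / N`. -/
def scaledLogDeriv (N : ℕ) (ω₁ ω₂ μ : ℝ) (ξ : ℂ) (X : ℝ) : ℂ :=
  X * logDeriv (scaledAverage N ω₁ ω₂ μ ξ) X

/-- The scaled average `u(X; (ω₁, ω₂), μ; ξ)`, the limit `N → ∞` of `scaledLogDeriv`. -/
def scaledU (ω₁ ω₂ μ : ℝ) (ξ : ℂ) (X : ℝ) : ℂ :=
  Filter.limUnder Filter.atTop fun N : ℕ => scaledLogDeriv N ω₁ ω₂ μ ξ X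

end CircularJacobi

end

/-! ### Orthogonal polynomials of a linear functional with nonvanishing Hankel determinant. -/

noncomputable section

namespace CircularJacobi

open Polynomial

/-! Write N = n + 1 and t = e^{iφ}. By Andréief's identity the average is a constant times a phase
times the Hankel determinant of a weight on the circle (`exists_cJacobiAverage_eq`). The logarithmic
derivative of this weight in z is rational with simple poles at 0, 1, t and residues c_i. Let P be
the monic orthogonal polynomial of degree N, Q the dual polynomial of degree at most N - 1, and `l
i` the insertion of a pole, formally f ↦ c_i ∫ f w / (x - x_i). Put a_i = l_i(PP), b_i = l_i(PQ),
d_i = l_i(QQ). These are the entries of the residues of a 2×2 Fuchsian system: a_i d_i = b_i (b_i -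
c_i), ∑ a_i = ∑ d_i = 0, ∑ b_i = -N.

Moments evolve by insertion of the moving pole (`hasEvolution_momentFunctional`). Hence the
logarithmic derivative of the determinant is governed by an affine function of the subleading
coefficient of P, whose derivative is a multiple of b = b_2. The derivative of b is a multiple of s
= d_0 a_2 - a_0 d_2, and s² is a polynomial in b_0 and b. Together with the expression of the
logarithmic derivative by b_0 and b (`exists_relation`), this is a second order equation for every
finite N, valid wherever the determinant does not vanish.

For the scaling put ε = 1/N and t = 1 + iετ. In terms of b and g, where b_0 = c_0 + εg, the
difference of the sides of (VI) is exactly h' N² times `scaledSigma` (`sigmaPVI_eq_scaledSigma`).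
This expression is regular at ε = 0, where it is the left hand side of (V) (`scaledSigma_zero`).
Part (1) is then continuity in ε, together with C₁ / N² → -1/4.

For part (2), the function `scaledV`, which is τ/X times X d/dX log A_N, satisfies `scaledSigma = 0`
exactly and converges to u. Convergence of its derivatives comes from the equation itself. The
square of the second derivative is at most cubic in the first, a growth exponent 3/2 < 2, so a bound
on the function bounds the first derivative (`norm_deriv_le_of_norm_sq_le`), and then the second.
The first derivatives therefore converge, and by the equation so do the squares of the second
derivatives. Since derivatives have the intermediate value property, a sign of the square root can
be chosen near each point (`exists_hasDerivAt_of_tendsto_sq`), and the limit satisfies the equation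
at ε = 0. -/

/-- The Hankel matrix of size `n + 1` of the moments of `L`. -/
def hankel (n : ℕ) (L : ℂ[X] →ₗ[ℂ] ℂ) : Matrix (Fin (n + 1)) (Fin (n + 1)) ℂ :=
  Matrix.of fun j k => L (X ^ ((j : ℕ) + k))

/-- The basis of polynomials of degree at most `n` dual to the monomials. -/
def dualPoly (n : ℕ) (L : ℂ[X] →ₗ[ℂ] ℂ) (j : Fin (n + 1)) : ℂ[X] :=
  ∑ k : Fin (n + 1), C ((hankel n L)⁻¹ j k) * X ^ (k : ℕ)

/-- The last dual polynomial, proportional to the orthogonal polynomial of degree `n`. -/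
def subPoly (n : ℕ) (L : ℂ[X] →ₗ[ℂ] ℂ) : ℂ[X] := dualPoly n L (Fin.last n)

/-- The monic orthogonal polynomial of degree `n + 1`. -/
def orthPoly (n : ℕ) (L : ℂ[X] →ₗ[ℂ] ℂ) : ℂ[X] :=
  X ^ (n + 1) - ∑ j : Fin (n + 1), C (L (X ^ (n + 1 + (j : ℕ)))) * dualPoly n L j

/-- The reproducing kernel of polynomials of degree at most `n`, at the point `z`. -/
def kernelPoly (n : ℕ) (L : ℂ[X] →ₗ[ℂ] ℂ) (z : ℂ) : ℂ[X] :=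
  ∑ j : Fin (n + 1), C (z ^ (j : ℕ)) * dualPoly n L j

/-- The reproducing kernel on the diagonal. -/
def diagPoly (n : ℕ) (L : ℂ[X] →ₗ[ℂ] ℂ) : ℂ[X] :=
  ∑ j : Fin (n + 1), X ^ (j : ℕ) * dualPoly n L j

section Orthogonality

variable {n : ℕ} {L : ℂ[X] →ₗ[ℂ] ℂ}

lemma map_C_mul (L : ℂ[X] →ₗ[ℂ] ℂ) (a : ℂ) (f : ℂ[X]) : L (C a * f) = a * L f := by
  rw [← smul_eq_C_mul, map_smul, smul_eq_mul]

lemma natDegree_sum_C_mul_le {ι : Type*} (s : Finset ι) (a : ι → ℂ) (f : ι → ℂ[X]) (m : ℕ)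
    (h : ∀ i ∈ s, (f i).natDegree ≤ m) : (∑ i ∈ s, C (a i) * f i).natDegree ≤ m :=
  natDegree_sum_le_of_forall_le _ _ fun i hi => (natDegree_C_mul_le _ _).trans (h i hi)

lemma natDegree_dualPoly_le (n : ℕ) (L : ℂ[X] →ₗ[ℂ] ℂ) (j : Fin (n + 1)) :
    (dualPoly n L j).natDegree ≤ n :=
  natDegree_sum_C_mul_le _ _ _ _ fun k _ => (natDegree_X_pow_le _).trans (by omega)

lemma natDegree_subPoly_le (n : ℕ) (L : ℂ[X] →ₗ[ℂ] ℂ) : (subPoly n L).natDegree ≤ n :=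
  natDegree_dualPoly_le _ _ _

lemma natDegree_kernelPoly_le (n : ℕ) (L : ℂ[X] →ₗ[ℂ] ℂ) (z : ℂ) :
    (kernelPoly n L z).natDegree ≤ n :=
  natDegree_sum_C_mul_le _ _ _ _ fun _ _ => natDegree_dualPoly_le _ _ _

lemma natDegree_orthPoly_sub_le (n : ℕ) (L : ℂ[X] →ₗ[ℂ] ℂ) :
    (orthPoly n L - X ^ (n + 1)).natDegree ≤ n := by
  rw [orthPoly, sub_sub_cancel_left, natDegree_neg]
  exact natDegree_sum_C_mul_le _ _ _ _ fun _ _ => natDegree_dualPoly_le _ _ _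

lemma natDegree_orthPoly_le (n : ℕ) (L : ℂ[X] →ₗ[ℂ] ℂ) : (orthPoly n L).natDegree ≤ n + 1 := by
  rw [← sub_add_cancel (orthPoly n L) (X ^ (n + 1))]
  refine (natDegree_add_le _ _).trans (max_le ?_ (natDegree_X_pow_le _))
  exact (natDegree_orthPoly_sub_le n L).trans n.le_succ

lemma coeff_orthPoly_succ (n : ℕ) (L : ℂ[X] →ₗ[ℂ] ℂ) : (orthPoly n L).coeff (n + 1) = 1 := by
  have h := coeff_eq_zero_of_natDegree_lt
    (Nat.lt_succ_of_le (natDegree_orthPoly_sub_le n L))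
  rw [coeff_sub, coeff_X_pow_self, sub_eq_zero] at h
  exact h

lemma eq_sum_of_natDegree_le {g : ℂ[X]} (hg : g.natDegree ≤ n) :
    g = ∑ k : Fin (n + 1), C (g.coeff k) * X ^ (k : ℕ) := by
  rw [Fin.sum_univ_eq_sum_range (fun k => C (g.coeff k) * X ^ k)]
  exact g.as_sum_range_C_mul_X_pow' (Nat.lt_succ_of_le hg)

variable (hL : (hankel n L).det ≠ 0)
include hL

lemma map_dualPoly_mul_X_pow (j k : Fin (n + 1)) :
    L (dualPoly n L j * X ^ (k : ℕ)) = if j = k then 1 else 0 := by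
  have h := congrFun (congrFun (Matrix.nonsing_inv_mul (hankel n L) hL.isUnit) j) k
  rw [Matrix.mul_apply, Matrix.one_apply] at h
  rw [← h, dualPoly, Finset.sum_mul, map_sum]
  refine Finset.sum_congr rfl fun i _ => ?_
  rw [mul_assoc, map_C_mul, ← pow_add, hankel, Matrix.of_apply]

lemma map_dualPoly_mul (j : Fin (n + 1)) {g : ℂ[X]} (hg : g.natDegree ≤ n) :
    L (dualPoly n L j * g) = g.coeff j := by
  conv_lhs => rw [eq_sum_of_natDegree_le hg, Finset.mul_sum, map_sum]
  rw [Finset.sum_eq_single j]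
  · rw [mul_left_comm, map_C_mul, map_dualPoly_mul_X_pow hL, if_pos rfl, mul_one]
  · intro k _ hk
    rw [mul_left_comm, map_C_mul, map_dualPoly_mul_X_pow hL, if_neg hk.symm, mul_zero]
  · simp

lemma map_subPoly_mul {g : ℂ[X]} (hg : g.natDegree ≤ n) : L (subPoly n L * g) = g.coeff n := by
  rw [subPoly, map_dualPoly_mul hL _ hg, Fin.val_last]

lemma map_kernelPoly_mul (z : ℂ) {g : ℂ[X]} (hg : g.natDegree ≤ n) :
    L (kernelPoly n L z * g) = g.eval z := by
  rw [kernelPoly, Finset.sum_mul, map_sum]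
  conv_rhs => rw [eq_sum_of_natDegree_le hg, eval_finsetSum]
  refine Finset.sum_congr rfl fun j _ => ?_
  rw [mul_assoc, map_C_mul, map_dualPoly_mul hL _ hg, eval_C_mul, eval_pow, eval_X, mul_comm]

lemma map_orthPoly_mul {g : ℂ[X]} (hg : g.natDegree ≤ n) : L (orthPoly n L * g) = 0 := by
  rw [orthPoly, sub_mul, map_sub, Finset.sum_mul, map_sum, sub_eq_zero]
  conv_lhs => rw [eq_sum_of_natDegree_le hg, Finset.mul_sum, map_sum]
  refine Finset.sum_congr rfl fun j _ => ?_
  rw [mul_left_comm, map_C_mul, ← pow_add, mul_assoc, map_C_mul, map_dualPoly_mul hL _ hg,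
    mul_comm]

/-- The pairing on polynomials of degree at most n is nondegenerate. All differential identities for
the orthogonal polynomials are proved by comparing moments in this way. -/
lemma eq_of_map_mul_X_pow_eq {f g : ℂ[X]} (hf : f.natDegree ≤ n) (hg : g.natDegree ≤ n)
    (h : ∀ k ≤ n, L (f * X ^ k) = L (g * X ^ k)) : f = g := by
  have key : ∀ (j : Fin (n + 1)), f.coeff j = g.coeff j := by
    intro j
    rw [← map_dualPoly_mul hL j hf, ← map_dualPoly_mul hL j hg, dualPoly, Finset.sum_mul,
      Finset.sum_mul, map_sum, map_sum]
    refine Finset.sum_congr rfl fun k _ => ?_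
    rw [mul_assoc, mul_assoc, map_C_mul, map_C_mul, mul_comm _ f, mul_comm _ g, h k (by omega)]
  ext k
  by_cases hk : k ≤ n
  · exact key ⟨k, by omega⟩
  · rw [coeff_eq_zero_of_natDegree_lt (by omega), coeff_eq_zero_of_natDegree_lt (by omega)]

/-- Pair the kernel with `subPoly` in two ways: by duality of `subPoly`, and by the reproducing
property. -/
lemma coeff_kernelPoly (z : ℂ) : (kernelPoly n L z).coeff n = (subPoly n L).eval z := by
  rw [← map_subPoly_mul hL (natDegree_kernelPoly_le n L z), mul_comm,
    map_kernelPoly_mul hL z (natDegree_subPoly_le n L)]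

omit hL in
lemma natDegree_le_of_coeff_succ {f : ℂ[X]} (hf : f.natDegree ≤ n + 1) (h : f.coeff (n + 1) = 0) :
    f.natDegree ≤ n := by
  rw [natDegree_le_iff_coeff_eq_zero]
  intro k hk
  rcases (Nat.succ_le_of_lt hk).eq_or_lt with rfl | h'
  · exact h
  · exact coeff_eq_zero_of_natDegree_lt (hf.trans_lt h')

omit hL in
lemma natDegree_X_sub_C_mul_le (z : ℂ) {m : ℕ} {f : ℂ[X]} (hf : f.natDegree ≤ m) :
    ((X - C z) * f).natDegree ≤ m + 1 := by
  refine natDegree_mul_le.trans ?_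
  rw [natDegree_X_sub_C]
  omega

omit hL in
lemma coeff_X_sub_C_mul_succ (z : ℂ) {f : ℂ[X]} (hf : f.natDegree ≤ n) :
    ((X - C z) * f).coeff (n + 1) = f.coeff n := by
  rw [sub_mul, coeff_sub, coeff_X_mul, coeff_C_mul,
    coeff_eq_zero_of_natDegree_lt (Nat.lt_succ_of_le hf), mul_zero, sub_zero]

/-- The Christoffel-Darboux formula. -/
lemma X_sub_C_mul_kernelPoly (z : ℂ) :
    (X - C z) * kernelPoly n L z
      = C ((subPoly n L).eval z) * orthPoly n L - C ((orthPoly n L).eval z) * subPoly n L := by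
  have hK := natDegree_kernelPoly_le n L z
  have hQ := natDegree_subPoly_le n L
  have hP := natDegree_orthPoly_le n L
  have hd : ((X - C z) * kernelPoly n L z - C ((subPoly n L).eval z) * orthPoly n L).natDegree
      ≤ n := by
    apply natDegree_le_of_coeff_succ
    · refine (natDegree_sub_le _ _).trans (max_le (natDegree_X_sub_C_mul_le _ hK) ?_)
      exact (natDegree_C_mul_le _ _).trans hP
    · rw [coeff_sub, coeff_X_sub_C_mul_succ _ hK, coeff_C_mul, coeff_orthPoly_succ, mul_one,
        coeff_kernelPoly hL, sub_self]
  have hd' : (- (C ((orthPoly n L).eval z) * subPoly n L)).natDegree ≤ n := by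
    rw [natDegree_neg]; exact (natDegree_C_mul_le _ _).trans hQ
  have := eq_of_map_mul_X_pow_eq hL hd hd' fun k hk => by
    have hXk : (X ^ k : ℂ[X]).natDegree ≤ n := (natDegree_X_pow_le k).trans hk
    -- For k = n the product (X - z) X^k has degree n + 1, beyond the reproducing property. The
    -- subtracted multiple of `orthPoly` is orthogonal to the kernel and lowers the degree.
    set r : ℂ[X] := (X - C z) * X ^ k - C ((X ^ k : ℂ[X]).coeff n) * orthPoly n L with hr
    have hrd : r.natDegree ≤ n := by
      apply natDegree_le_of_coeff_succ
      · refine (natDegree_sub_le _ _).trans (max_le (natDegree_X_sub_C_mul_le _ hXk) ?_)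
        exact (natDegree_C_mul_le _ _).trans hP
      · rw [hr, coeff_sub, coeff_X_sub_C_mul_succ _ hXk, coeff_C_mul, coeff_orthPoly_succ, mul_one,
          sub_self]
    have e1 : (X - C z) * kernelPoly n L z * X ^ k
        = kernelPoly n L z * r + C ((X ^ k : ℂ[X]).coeff n) * (orthPoly n L * kernelPoly n L z) := by
      rw [hr]; ring
    rw [sub_mul, map_sub, e1, map_add, map_kernelPoly_mul hL z hrd, map_C_mul,
      map_orthPoly_mul hL hK, mul_assoc, map_C_mul, map_orthPoly_mul hL hXk, neg_mul, mul_assoc,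
      map_neg, map_C_mul, map_subPoly_mul hL hXk, hr]
    simp only [eval_sub, eval_mul, eval_X, eval_C, sub_self, zero_mul]
    ring
  rw [sub_eq_iff_eq_add] at this
  rw [this]
  ring

omit hL in
lemma eval_kernelPoly_self (z : ℂ) : (kernelPoly n L z).eval z = (diagPoly n L).eval z := by
  simp [kernelPoly, diagPoly, eval_finsetSum]

/-- The confluent Christoffel-Darboux formula: differentiate the formula and set x = z. -/
lemma diagPoly_eq : diagPoly n L
    = subPoly n L * derivative (orthPoly n L) - orthPoly n L * derivative (subPoly n L) := by
  apply Polynomial.funext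
  intro z
  have h := congrArg (fun f => (derivative f).eval z) (X_sub_C_mul_kernelPoly hL z)
  simp only [derivative_mul, derivative_sub, derivative_X, derivative_C, eval_add, eval_mul,
    eval_sub, eval_X, eval_C, sub_self, zero_mul, add_zero, sub_zero, one_mul,
    zero_add] at h
  rw [← eval_kernelPoly_self, h]
  simp

end Orthogonality

end CircularJacobi

end

/-! ### Insertion of poles and the algebraic relations between the residues. -/

noncomputable section

namespace CircularJacobi

open Polynomial

section Insertion

variable {n : ℕ} {L : ℂ[X] →ₗ[ℂ] ℂ} (hL : (hankel n L).det ≠ 0)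
  {l : ℂ[X] →ₗ[ℂ] ℂ} {x c : ℂ} (hl : ∀ f, l ((X - C x) * f) = c * L f)

lemma exists_eq_C_add_X_sub_C_mul (x : ℂ) {m : ℕ} {g : ℂ[X]} (hg : g.natDegree ≤ m + 1) :
    ∃ g₁ : ℂ[X], g₁.natDegree ≤ m ∧ g = C (g.eval x) + (X - C x) * g₁ := by
  refine ⟨g /ₘ (X - C x), ?_, ?_⟩
  · rw [natDegree_divByMonic _ (monic_X_sub_C x), natDegree_X_sub_C]
    omega
  · have := modByMonic_add_div g (X - C x)
    rwa [modByMonic_X_sub_C_eq_C_eval, eq_comm] at this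

include hL hl

/-- Since g - g(x) is divisible by X - x, the insertion turns it into `L` of P times the quotient,
which vanishes by orthogonality. Degree n + 1 is allowed, so g = P is covered. -/
lemma insertion_orthPoly_mul {g : ℂ[X]} (hg : g.natDegree ≤ n + 1) :
    l (orthPoly n L * g) = l (orthPoly n L) * g.eval x := by
  obtain ⟨g₁, hg₁, h⟩ := exists_eq_C_add_X_sub_C_mul x hg
  have e : orthPoly n L * g = C (g.eval x) * orthPoly n L + (X - C x) * (orthPoly n L * g₁) := by
    conv_lhs => rw [h]
    ring
  rw [e, map_add, map_C_mul, hl, map_orthPoly_mul hL hg₁]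
  ring

lemma insertion_subPoly_mul {g : ℂ[X]} (hg : g.natDegree ≤ n) :
    l (subPoly n L * g) = l (subPoly n L) * g.eval x := by
  -- The quotient must have degree below n to be orthogonal to `subPoly`; for n = 0 there is no such
  -- degree, and g is constant.
  rcases n with _ | n
  · rw [eq_C_of_natDegree_le_zero hg, mul_comm, map_C_mul, eval_C, mul_comm]
  obtain ⟨g₁, hg₁, h⟩ := exists_eq_C_add_X_sub_C_mul x hg
  have e : subPoly (n + 1) L * g
      = C (g.eval x) * subPoly (n + 1) L + (X - C x) * (subPoly (n + 1) L * g₁) := by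
    conv_lhs => rw [h]
    ring
  rw [e, map_add, map_C_mul, hl, map_subPoly_mul hL (hg₁.trans n.le_succ),
    coeff_eq_zero_of_natDegree_lt (Nat.lt_succ_of_le hg₁)]
  ring

/-- Apply the insertion to the Christoffel-Darboux formula at z = x; the kernel reproduces the
constant 1. -/
lemma insertion_wronskian :
    (subPoly n L).eval x * l (orthPoly n L) - (orthPoly n L).eval x * l (subPoly n L) = c := by
  have h := hl (kernelPoly n L x)
  rw [X_sub_C_mul_kernelPoly hL, map_sub, map_C_mul, map_C_mul] at h
  rw [h]
  have := map_kernelPoly_mul hL x (g := 1) (by simp)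
  rw [mul_one, eval_one] at this
  rw [this, mul_one]

end Insertion

/-- A linear functional with a logarithmic derivative with simple poles `0, 1, t` of residues
`c 0, c 1, c 2`; the insertions of the simple poles are given by the functionals `l`. -/
structure IsSemiclassical (t : ℂ) (c : Fin 3 → ℂ) (L : ℂ[X] →ₗ[ℂ] ℂ)
    (l : Fin 3 → ℂ[X] →ₗ[ℂ] ℂ) : Prop where
  insert_mul : ∀ i f, l i ((X - C (![0, 1, t] i)) * f) = c i * L f
  map_derivative : ∀ f, L (derivative f) = - ∑ i, l i f

namespace IsSemiclassical

variable {n : ℕ} {t : ℂ} {c : Fin 3 → ℂ} {L : ℂ[X] →ₗ[ℂ] ℂ} {l : Fin 3 → ℂ[X] →ₗ[ℂ] ℂ}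
  (S : IsSemiclassical t c L l) (hL : (hankel n L).det ≠ 0)

lemma natDegree_derivative_le_pred {m : ℕ} {f : ℂ[X]} (hf : f.natDegree ≤ m + 1) :
    (derivative f).natDegree ≤ m :=
  (Polynomial.natDegree_derivative_le f).trans (by omega)

lemma natDegree_derivative_le' {m : ℕ} {f : ℂ[X]} (hf : f.natDegree ≤ m) :
    (derivative f).natDegree ≤ m :=
  (Polynomial.natDegree_derivative_le f).trans (by omega)

lemma coeff_derivative_eq_zero {m : ℕ} {f : ℂ[X]} (hf : f.natDegree ≤ m) :
    (derivative f).coeff m = 0 := by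
  rw [coeff_derivative, coeff_eq_zero_of_natDegree_lt (by omega), zero_mul]

include S hL

/-- Integration by parts gives L(P' X^k) = -∑ l_i(P X^k). Each insertion evaluates X^k at its pole,
which the reproducing kernel does as well. -/
lemma derivative_orthPoly :
    derivative (orthPoly n L)
      = - ∑ i, C (l i (orthPoly n L)) * kernelPoly n L (![0, 1, t] i) := by
  have hP := natDegree_orthPoly_le n L
  apply eq_of_map_mul_X_pow_eq hL
  · exact (Polynomial.natDegree_derivative_le _).trans (by omega)
  · rw [natDegree_neg]
    exact natDegree_sum_C_mul_le _ _ _ _ fun _ _ => natDegree_kernelPoly_le _ _ _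
  · intro k hk
    have hXk : (X ^ k : ℂ[X]).natDegree ≤ n := (natDegree_X_pow_le k).trans hk
    have h := S.map_derivative (orthPoly n L * X ^ k)
    rw [derivative_mul, map_add, map_orthPoly_mul hL (natDegree_derivative_le' hXk), add_zero] at h
    rw [h, neg_mul, map_neg, Finset.sum_mul, map_sum]
    congr 1
    refine Finset.sum_congr rfl fun i _ => ?_
    rw [mul_assoc, map_C_mul, map_kernelPoly_mul hL _ hXk,
      insertion_orthPoly_mul hL (S.insert_mul i) (hXk.trans n.le_succ)]

lemma derivative_subPoly :
    derivative (subPoly n L)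
      = - ∑ i, C (l i (subPoly n L)) * kernelPoly n L (![0, 1, t] i) := by
  have hQ := natDegree_subPoly_le n L
  apply eq_of_map_mul_X_pow_eq hL
  · exact natDegree_derivative_le' hQ
  · rw [natDegree_neg]
    exact natDegree_sum_C_mul_le _ _ _ _ fun _ _ => natDegree_kernelPoly_le _ _ _
  · intro k hk
    have hXk : (X ^ k : ℂ[X]).natDegree ≤ n := (natDegree_X_pow_le k).trans hk
    have h := S.map_derivative (subPoly n L * X ^ k)
    rw [derivative_mul, map_add, map_subPoly_mul hL (natDegree_derivative_le' hXk),
      coeff_derivative_eq_zero hXk, add_zero] at h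
    rw [h, neg_mul, map_neg, Finset.sum_mul, map_sum]
    congr 1
    refine Finset.sum_congr rfl fun i _ => ?_
    rw [mul_assoc, map_C_mul, map_kernelPoly_mul hL _ hXk,
      insertion_subPoly_mul hL (S.insert_mul i) hXk]

lemma insert_orth_orth (i : Fin 3) :
    l i (orthPoly n L * orthPoly n L) = l i (orthPoly n L) * (orthPoly n L).eval (![0, 1, t] i) :=
  insertion_orthPoly_mul hL (S.insert_mul i) (natDegree_orthPoly_le n L)

lemma insert_orth_sub (i : Fin 3) :
    l i (orthPoly n L * subPoly n L) = l i (orthPoly n L) * (subPoly n L).eval (![0, 1, t] i) :=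
  insertion_orthPoly_mul hL (S.insert_mul i) ((natDegree_subPoly_le n L).trans n.le_succ)

lemma insert_sub_sub (i : Fin 3) :
    l i (subPoly n L * subPoly n L) = l i (subPoly n L) * (subPoly n L).eval (![0, 1, t] i) :=
  insertion_subPoly_mul hL (S.insert_mul i) (natDegree_subPoly_le n L)

lemma insert_orth_sub' (i : Fin 3) :
    l i (orthPoly n L * subPoly n L) - c i
      = l i (subPoly n L) * (orthPoly n L).eval (![0, 1, t] i) := by
  rw [S.insert_orth_sub hL, ← insertion_wronskian hL (S.insert_mul i)]
  ring

/-- Both sides are l(P) P(x) · l(Q) Q(x), because l(PQ) = l(P) Q(x) and, by the Wronskian, l(PQ) - c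
= l(Q) P(x). In other words, the residue matrix at each pole has rank one. -/
lemma quadratic_relation (i : Fin 3) :
    l i (orthPoly n L * orthPoly n L) * l i (subPoly n L * subPoly n L)
      = l i (orthPoly n L * subPoly n L) * (l i (orthPoly n L * subPoly n L) - c i) := by
  rw [S.insert_orth_sub' hL, S.insert_orth_sub hL, S.insert_orth_orth hL, S.insert_sub_sub hL]
  ring

/-- Integration by parts on P², with P' orthogonal to P. The corresponding sums for Q² and PQ
complete the residue at infinity; the value -(n + 1) arises from the leading coefficient of P'. -/
lemma sum_insert_orth_orth : ∑ i, l i (orthPoly n L * orthPoly n L) = 0 := by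
  have h := S.map_derivative (orthPoly n L * orthPoly n L)
  have hd : (derivative (orthPoly n L)).natDegree ≤ n :=
    natDegree_derivative_le_pred (natDegree_orthPoly_le n L)
  rw [derivative_mul, map_add, mul_comm, map_orthPoly_mul hL hd, add_zero] at h
  linear_combination h

lemma sum_insert_sub_sub : ∑ i, l i (subPoly n L * subPoly n L) = 0 := by
  have h := S.map_derivative (subPoly n L * subPoly n L)
  have hQ := natDegree_subPoly_le n L
  rw [derivative_mul, map_add, mul_comm, map_subPoly_mul hL (natDegree_derivative_le' hQ),
    coeff_derivative_eq_zero hQ, add_zero] at h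
  linear_combination h

lemma sum_insert_orth_sub : ∑ i, l i (orthPoly n L * subPoly n L) = -(n + 1 : ℂ) := by
  have h := S.map_derivative (orthPoly n L * subPoly n L)
  have hQ := natDegree_subPoly_le n L
  have hd : (derivative (orthPoly n L)).natDegree ≤ n :=
    natDegree_derivative_le_pred (natDegree_orthPoly_le n L)
  rw [derivative_mul, map_add, mul_comm, map_subPoly_mul hL hd,
    map_orthPoly_mul hL (natDegree_derivative_le' hQ), coeff_derivative, coeff_orthPoly_succ] at h
  linear_combination h

omit S in
lemma sub_mul_eval_kernelPoly (x y : ℂ) :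
    (x - y) * (kernelPoly n L y).eval x
      = (subPoly n L).eval y * (orthPoly n L).eval x
        - (orthPoly n L).eval y * (subPoly n L).eval x := by
  have := congrArg (eval x) (X_sub_C_mul_kernelPoly hL y)
  simpa only [eval_mul, eval_sub, eval_X, eval_C] using this

lemma insert_orth_kernel (i : Fin 3) (y : ℂ) :
    l i (orthPoly n L * kernelPoly n L y)
      = l i (orthPoly n L) * (kernelPoly n L y).eval (![0, 1, t] i) :=
  insertion_orthPoly_mul hL (S.insert_mul i) ((natDegree_kernelPoly_le n L y).trans n.le_succ)

lemma insert_sub_kernel (i : Fin 3) (y : ℂ) :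
    l i (subPoly n L * kernelPoly n L y)
      = l i (subPoly n L) * (kernelPoly n L y).eval (![0, 1, t] i) :=
  insertion_subPoly_mul hL (S.insert_mul i) (natDegree_kernelPoly_le n L y)

/-- Christoffel-Darboux turns the kernel between two poles into values of P and Q there, which
combine with l(P), l(Q) into the residue entries. The difference occurs in the derivative of the
determinant, the sum below in the derivative of b. -/
lemma pair_sub_mul_eval_kernelPoly (i : Fin 3) :
    (t - ![0, 1, t] i) * ((l i (subPoly n L) * l 2 (orthPoly n L)
        - l i (orthPoly n L) * l 2 (subPoly n L)) * (kernelPoly n L (![0, 1, t] i)).eval t)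
      = l i (subPoly n L * subPoly n L) * l 2 (orthPoly n L * orthPoly n L)
        + l i (orthPoly n L * orthPoly n L) * l 2 (subPoly n L * subPoly n L)
        - (l i (orthPoly n L * subPoly n L) - c i) * l 2 (orthPoly n L * subPoly n L)
        - l i (orthPoly n L * subPoly n L) * (l 2 (orthPoly n L * subPoly n L) - c 2) := by
  rw [S.insert_orth_sub' hL, S.insert_orth_sub' hL, S.insert_orth_sub hL, S.insert_orth_sub hL,
    S.insert_orth_orth hL, S.insert_orth_orth hL, S.insert_sub_sub hL, S.insert_sub_sub hL]
  have h := sub_mul_eval_kernelPoly hL t (![0, 1, t] i)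
  have h2 : (![0, 1, t] : Fin 3 → ℂ) 2 = t := rfl
  rw [h2]
  linear_combination (l i (subPoly n L) * l 2 (orthPoly n L)
        - l i (orthPoly n L) * l 2 (subPoly n L)) * h

lemma pair_add_mul_eval_kernelPoly (i : Fin 3) :
    (t - ![0, 1, t] i) * ((l i (subPoly n L) * l 2 (orthPoly n L)
        + l i (orthPoly n L) * l 2 (subPoly n L)) * (kernelPoly n L (![0, 1, t] i)).eval t)
      = l i (subPoly n L * subPoly n L) * l 2 (orthPoly n L * orthPoly n L)
        - l i (orthPoly n L * orthPoly n L) * l 2 (subPoly n L * subPoly n L)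
        + l i (orthPoly n L * subPoly n L) * (l 2 (orthPoly n L * subPoly n L) - c 2)
        - (l i (orthPoly n L * subPoly n L) - c i) * l 2 (orthPoly n L * subPoly n L) := by
  rw [S.insert_orth_sub' hL, S.insert_orth_sub' hL, S.insert_orth_sub hL, S.insert_orth_sub hL,
    S.insert_orth_orth hL, S.insert_orth_orth hL, S.insert_sub_sub hL, S.insert_sub_sub hL]
  have h := sub_mul_eval_kernelPoly hL t (![0, 1, t] i)
  have h2 : (![0, 1, t] : Fin 3 → ℂ) 2 = t := rfl
  rw [h2]
  linear_combination (l i (subPoly n L) * l 2 (orthPoly n L)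
        + l i (orthPoly n L) * l 2 (subPoly n L)) * h

/-- The contribution of the pole `t` and the pole `x_i` to the logarithmic derivative of the
Hankel determinant. -/
lemma insert_diagPoly :
    l 2 (diagPoly n L)
      = ∑ i ∈ {0, 1}, (l i (subPoly n L) * l 2 (orthPoly n L)
        - l i (orthPoly n L) * l 2 (subPoly n L)) * (kernelPoly n L (![0, 1, t] i)).eval t := by
  have e : diagPoly n L
      = ∑ i, (C (l i (subPoly n L)) * (orthPoly n L * kernelPoly n L (![0, 1, t] i))
        - C (l i (orthPoly n L)) * (subPoly n L * kernelPoly n L (![0, 1, t] i))) := by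
    rw [diagPoly_eq hL, S.derivative_orthPoly hL, S.derivative_subPoly hL]
    generalize orthPoly n L = P, subPoly n L = Q, kernelPoly n L = K
    simp only [Fin.sum_univ_three]
    ring
  -- The term at the pole t cancels by antisymmetry, so the diagonal value of the kernel at t never
  -- enters.
  rw [e, map_sum, Fin.sum_univ_three, Finset.sum_pair (by decide)]
  simp only [map_sub, map_C_mul, S.insert_orth_kernel hL, S.insert_sub_kernel hL]
  have h2 : (![0, 1, t] : Fin 3 → ℂ) 2 = t := rfl
  rw [h2]
  ring

end IsSemiclassical

end CircularJacobi

end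

/-! ### Traces of the kernel and the subleading coefficient of the orthogonal polynomial. -/

noncomputable section

namespace CircularJacobi

open Polynomial

lemma coeff_X_mul_derivative {R : Type*} [CommRing R] (f : R[X]) (k : ℕ) :
    (X * derivative f).coeff k = k * f.coeff k := by
  cases k with
  | zero => simp
  | succ k => rw [coeff_X_mul, coeff_derivative, mul_comm]; push_cast; ring

lemma X_sub_one_mul_X_mul_derivative_coeff {R : Type*} [CommRing R] (f : R[X]) (k : ℕ) :
    (X * (X - 1) * derivative (derivative f)).coeff k
      = k * (k - 1) * f.coeff k - k * ((k + 1) * f.coeff (k + 1)) := by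
  have e : X * (X - 1) * derivative (derivative f)
      = X * derivative (X * derivative f) - X * derivative f - X * derivative (derivative f) := by
    rw [derivative_mul, derivative_X]; ring
  rw [e, coeff_sub, coeff_sub, coeff_X_mul_derivative, coeff_X_mul_derivative,
    coeff_X_mul_derivative, coeff_derivative]
  ring

section Diagonal

variable {n : ℕ} {L : ℂ[X] →ₗ[ℂ] ℂ} (hL : (hankel n L).det ≠ 0)
include hL

/-- One degree more than duality allows: remove the top term by a multiple of `orthPoly`, which is
orthogonal to `subPoly`. -/
lemma map_subPoly_mul_succ {g : ℂ[X]} (hg : g.natDegree ≤ n + 1) :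
    L (subPoly n L * g) = g.coeff n - (orthPoly n L).coeff n * g.coeff (n + 1) := by
  have hd : (g - C (g.coeff (n + 1)) * orthPoly n L).natDegree ≤ n := by
    apply natDegree_le_of_coeff_succ
    · refine (natDegree_sub_le _ _).trans (max_le hg ?_)
      exact (natDegree_C_mul_le _ _).trans (natDegree_orthPoly_le n L)
    · rw [coeff_sub, coeff_C_mul, coeff_orthPoly_succ, mul_one, sub_self]
  have e : subPoly n L * g = subPoly n L * (g - C (g.coeff (n + 1)) * orthPoly n L)
      + C (g.coeff (n + 1)) * (orthPoly n L * subPoly n L) := by ring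
  rw [e, map_add, map_C_mul, map_orthPoly_mul hL (natDegree_subPoly_le n L),
    map_subPoly_mul hL hd, coeff_sub, coeff_C_mul]
  ring

lemma map_diagPoly : L (diagPoly n L) = n + 1 := by
  have hd : (derivative (orthPoly n L)).natDegree ≤ n :=
    IsSemiclassical.natDegree_derivative_le_pred (natDegree_orthPoly_le n L)
  rw [diagPoly_eq hL, map_sub, map_subPoly_mul hL hd, map_orthPoly_mul hL
    (IsSemiclassical.natDegree_derivative_le' (natDegree_subPoly_le n L)), coeff_derivative,
    coeff_orthPoly_succ]
  ring

omit hL in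
lemma natDegree_X_mul_derivative_le {m : ℕ} {f : ℂ[X]} (hf : f.natDegree ≤ m) :
    (X * derivative f).natDegree ≤ m := by
  rw [natDegree_le_iff_coeff_eq_zero]
  intro k hk
  rw [coeff_X_mul_derivative, coeff_eq_zero_of_natDegree_lt (hf.trans_lt hk), mul_zero]

omit hL in
lemma natDegree_X_sub_one_mul_X_mul_derivative_le {m : ℕ} {f : ℂ[X]} (hf : f.natDegree ≤ m) :
    (X * (X - 1) * derivative (derivative f)).natDegree ≤ m := by
  rw [natDegree_le_iff_coeff_eq_zero]
  intro k hk
  rw [X_sub_one_mul_X_mul_derivative_coeff, coeff_eq_zero_of_natDegree_lt (hf.trans_lt hk),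
    coeff_eq_zero_of_natDegree_lt (hf.trans_lt (hk.trans k.lt_succ_self))]
  ring

/-- This is the trace of multiplication by X compressed to degree at most n, that is, the sum of the
zeros of P. -/
lemma map_X_mul_diagPoly : L (X * diagPoly n L) = -(orthPoly n L).coeff n := by
  have hP := natDegree_orthPoly_le n L
  have hQ := natDegree_subPoly_le n L
  have e : X * diagPoly n L = subPoly n L * (X * derivative (orthPoly n L))
      - orthPoly n L * (X * derivative (subPoly n L)) := by
    rw [diagPoly_eq hL]; ring
  rw [e, map_sub, map_subPoly_mul_succ hL (natDegree_X_mul_derivative_le hP),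
    map_orthPoly_mul hL (natDegree_X_mul_derivative_le hQ), coeff_X_mul_derivative,
    coeff_X_mul_derivative, coeff_orthPoly_succ]
  push_cast
  ring

lemma map_derivative_mul_diagPoly :
    L (derivative (X * (X - 1) * diagPoly n L))
      = -2 * (n + 1) * (orthPoly n L).coeff n - (n + 1) ^ 2 := by
  have hP := natDegree_orthPoly_le n L
  have hQ := natDegree_subPoly_le n L
  have e : derivative (X * (X - 1) * diagPoly n L)
      = 2 * (X * diagPoly n L) - diagPoly n L
        + subPoly n L * (X * (X - 1) * derivative (derivative (orthPoly n L)))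
        - orthPoly n L * (X * (X - 1) * derivative (derivative (subPoly n L))) := by
    -- The products P' Q' cancel, leaving only second derivatives; multiplied by X(X - 1) these do
    -- not raise the degree.
    have hκ : derivative (diagPoly n L) = subPoly n L * derivative (derivative (orthPoly n L))
        - orthPoly n L * derivative (derivative (subPoly n L)) := by
      rw [diagPoly_eq hL]
      simp only [derivative_sub, derivative_mul]
      ring
    rw [derivative_mul, hκ]
    simp only [derivative_sub, derivative_mul, derivative_X, derivative_one]
    ring
  have h2 : (2 : ℂ[X]) = C 2 := rfl
  rw [e, h2, map_sub, map_add, map_sub, map_C_mul, map_X_mul_diagPoly hL, map_diagPoly hL,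
    map_subPoly_mul_succ hL (natDegree_X_sub_one_mul_X_mul_derivative_le hP),
    map_orthPoly_mul hL (natDegree_X_sub_one_mul_X_mul_derivative_le hQ),
    X_sub_one_mul_X_mul_derivative_coeff, X_sub_one_mul_X_mul_derivative_coeff,
    coeff_orthPoly_succ, coeff_eq_zero_of_natDegree_lt (Nat.lt_succ_of_le hP)]
  push_cast
  ring

end Diagonal

namespace IsSemiclassical

variable {n : ℕ} {t : ℂ} {c : Fin 3 → ℂ} {L : ℂ[X] →ₗ[ℂ] ℂ} {l : Fin 3 → ℂ[X] →ₗ[ℂ] ℂ}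
  (S : IsSemiclassical t c L l)
include S

lemma insert_zero (f : ℂ[X]) : l 0 (X * f) = c 0 * L f := by
  simpa using S.insert_mul 0 f

lemma insert_one (f : ℂ[X]) : l 1 ((X - 1) * f) = c 1 * L f := by
  simpa using S.insert_mul 1 f

lemma insert_two (f : ℂ[X]) : l 2 ((X - C t) * f) = c 2 * L f := S.insert_mul 2 f

/-- Division by X - t: X(X - 1) = t(t - 1) + (X - t)(X + t - 1). -/
lemma insert_two_mul (f : ℂ[X]) :
    l 2 (X * (X - 1) * f) = t * (t - 1) * l 2 f + c 2 * L ((X + C (t - 1)) * f) := by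
  have e : X * (X - 1) * f = C (t * (t - 1)) * f + (X - C t) * ((X + C (t - 1)) * f) := by
    simp only [C_mul, C_sub, C_1]; ring
  rw [e, map_add, map_C_mul, S.insert_two]

/-- The logarithmic derivative of the Hankel determinant in terms of the subleading coefficient
of the orthogonal polynomial. -/
lemma insert_diagPoly_eq (hL : (hankel n L).det ≠ 0) :
    -(t * (t - 1) * l 2 (diagPoly n L))
      = -(2 * (n + 1) + ∑ i, c i) * (orthPoly n L).coeff n - (n + 1) ^ 2
        + (n + 1) * (c 2 * (t - 1) - c 0) := by
  have h := S.map_derivative (X * (X - 1) * diagPoly n L)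
  have e0 : X * (X - 1) * diagPoly n L = X * ((X - 1) * diagPoly n L) := by ring
  have e1 : X * (X - 1) * diagPoly n L = (X - 1) * (X * diagPoly n L) := by ring
  rw [Fin.sum_univ_three, S.insert_two_mul, e0, S.insert_zero, ← e0, e1, S.insert_one, ← e1,
    map_derivative_mul_diagPoly hL, map_X_mul_diagPoly hL, sub_mul, map_sub, one_mul,
    add_mul, map_add, map_C_mul, map_X_mul_diagPoly hL, map_diagPoly hL] at h
  rw [Fin.sum_univ_three]
  linear_combination -h

end IsSemiclassical

end CircularJacobi

end

/-! ### Derivatives in the angle of determinants and orthogonal polynomials. -/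

noncomputable section

namespace CircularJacobi

open Polynomial

/-- Jacobi's formula for the derivative of a determinant. -/
lemma hasDerivAt_det {ι : Type*} [Fintype ι] [DecidableEq ι] {M : ℝ → Matrix ι ι ℂ}
    {M' : Matrix ι ι ℂ} {φ : ℝ} (h : ∀ j k, HasDerivAt (fun s => M s j k) (M' j k) φ) :
    HasDerivAt (fun s => (M s).det) (∑ i : ι, ∑ k : ι, (M φ).adjugate i k * M' k i) φ := by
  have h1 : HasDerivAt (fun s => (M s).det)
      (∑ σ : Equiv.Perm ι, ((Equiv.Perm.sign σ : ℤ) : ℂ)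
        * ∑ i : ι, (∏ j ∈ Finset.univ.erase i, M φ (σ j) j) • M' (σ i) i) φ := by
    simp only [Matrix.det_apply']
    exact HasDerivAt.fun_sum fun σ _ => (HasDerivAt.fun_finsetProd fun i _ => h (σ i) i).const_mul _
  refine h1.congr_deriv ?_
  simp only [Finset.mul_sum]
  rw [Finset.sum_comm]
  refine Finset.sum_congr rfl fun i _ => ?_
  -- Cramer's rule: pairing a row of the adjugate with a vector replaces a column of the matrix by
  -- that vector.
  have h2 : ∑ k : ι, (M φ).adjugate i k * M' k i = ((M φ).updateCol i fun k => M' k i).det := by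
    rw [← Matrix.cramer_apply, Matrix.cramer_eq_adjugate_mulVec]
    rfl
  rw [h2, Matrix.det_apply']
  refine Finset.sum_congr rfl fun σ _ => ?_
  rw [← Finset.mul_prod_erase _ _ (Finset.mem_univ i), Matrix.updateCol_self, smul_eq_mul,
    mul_comm (∏ j ∈ _, _)]
  congr 2
  exact Finset.prod_congr rfl fun j hj => (Matrix.updateCol_ne (Finset.ne_of_mem_erase hj)).symm

lemma differentiableAt_det {ι : Type*} [Fintype ι] [DecidableEq ι] {M : ℝ → Matrix ι ι ℂ}
    {φ : ℝ} (h : ∀ j k, DifferentiableAt ℝ (fun s => M s j k) φ) :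
    DifferentiableAt ℝ (fun s => (M s).det) φ :=
  (hasDerivAt_det (M' := Matrix.of fun j k => deriv (fun s => M s j k) φ)
    fun j k => (h j k).hasDerivAt).differentiableAt

lemma differentiableAt_inv {ι : Type*} [Fintype ι] [DecidableEq ι] {M : ℝ → Matrix ι ι ℂ}
    {φ : ℝ} (h : ∀ j k, DifferentiableAt ℝ (fun s => M s j k) φ) (hM : (M φ).det ≠ 0) (j k : ι) :
    DifferentiableAt ℝ (fun s => (M s)⁻¹ j k) φ := by
  simp only [Matrix.inv_def, Ring.inverse_eq_inv', Matrix.smul_apply, smul_eq_mul,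
    Matrix.adjugate_apply]
  refine ((differentiableAt_det h).inv hM).mul (differentiableAt_det fun a b => ?_)
  by_cases hak : a = k
  · subst hak
    simp only [Matrix.updateRow_self]
    exact differentiableAt_const _
  · simp only [Matrix.updateRow_ne hak]
    exact h a b

/-- A curve of polynomials of degree at most `m`, with derivative `P'` at `φ`. -/
structure HasPolyDerivAt (m : ℕ) (P : ℝ → ℂ[X]) (P' : ℂ[X]) (φ : ℝ) : Prop where
  natDegree_le : ∀ s, (P s).natDegree ≤ m
  natDegree_le' : P'.natDegree ≤ m
  hasDerivAt_coeff : ∀ k, HasDerivAt (fun s => (P s).coeff k) (P'.coeff k) φ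

namespace HasPolyDerivAt

variable {m m₂ : ℕ} {P Q : ℝ → ℂ[X]} {P' Q' : ℂ[X]} {φ : ℝ}

lemma mul (hP : HasPolyDerivAt m P P' φ) (hQ : HasPolyDerivAt m₂ Q Q' φ) :
    HasPolyDerivAt (m + m₂) (fun s => P s * Q s) (P' * Q φ + P φ * Q') φ where
  natDegree_le s := natDegree_mul_le_of_le (hP.natDegree_le s) (hQ.natDegree_le s)
  natDegree_le' := (natDegree_add_le _ _).trans (max_le
    (natDegree_mul_le_of_le hP.natDegree_le' (hQ.natDegree_le φ))
    (natDegree_mul_le_of_le (hP.natDegree_le φ) hQ.natDegree_le'))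
  hasDerivAt_coeff k := by
    simp only [coeff_add, coeff_mul, ← Finset.sum_add_distrib]
    exact HasDerivAt.fun_sum fun p _ => (hP.hasDerivAt_coeff p.1).mul (hQ.hasDerivAt_coeff p.2)

lemma const (f : ℂ[X]) (φ : ℝ) : HasPolyDerivAt f.natDegree (fun _ => f) 0 φ where
  natDegree_le _ := le_rfl
  natDegree_le' := by simp
  hasDerivAt_coeff k := by rw [coeff_zero]; exact hasDerivAt_const _ _

lemma map_eq_sum (Λ : ℂ[X] →ₗ[ℂ] ℂ) {f : ℂ[X]} (hf : f.natDegree ≤ m) :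
    Λ f = ∑ k ∈ Finset.range (m + 1), f.coeff k * Λ (X ^ k) := by
  conv_lhs => rw [f.as_sum_range_C_mul_X_pow' (Nat.lt_succ_of_le hf), map_sum]
  exact Finset.sum_congr rfl fun k _ => map_C_mul _ _ _

/-- The product rule for a moving functional on a moving polynomial. The uniform degree bound makes
it a finite sum over monomials. -/
lemma hasDerivAt_map (hP : HasPolyDerivAt m P P' φ) {Λ : ℝ → ℂ[X] →ₗ[ℂ] ℂ} {Λ' : ℂ[X] →ₗ[ℂ] ℂ}
    (hΛ : ∀ f, HasDerivAt (fun s => Λ s f) (Λ' f) φ) :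
    HasDerivAt (fun s => Λ s (P s)) (Λ' (P φ) + Λ φ P') φ := by
  have e : (fun s => Λ s (P s)) = fun s => ∑ k ∈ Finset.range (m + 1), (P s).coeff k * Λ s (X ^ k) :=
    funext fun s => map_eq_sum _ (hP.natDegree_le s)
  rw [e, map_eq_sum Λ' (hP.natDegree_le φ), map_eq_sum (Λ φ) hP.natDegree_le',
    ← Finset.sum_add_distrib]
  refine HasDerivAt.fun_sum fun k _ => ?_
  rw [add_comm]
  exact (hP.hasDerivAt_coeff k).mul (hΛ _)

lemma of_differentiableAt (hP : ∀ s, (P s).natDegree ≤ m)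
    (h : ∀ k, DifferentiableAt ℝ (fun s => (P s).coeff k) φ) :
    ∃ P', HasPolyDerivAt m P P' φ := by
  refine ⟨∑ k ∈ Finset.range (m + 1), C (deriv (fun s => (P s).coeff k) φ) * X ^ k, hP, ?_, ?_⟩
  · refine natDegree_sum_C_mul_le _ _ _ _ fun k hk => (natDegree_X_pow_le _).trans ?_
    rw [Finset.mem_range] at hk
    omega
  · intro k
    simp only [finsetSum_coeff, coeff_C_mul, coeff_X_pow, mul_ite, mul_one, mul_zero,
      Finset.sum_ite_eq, Finset.mem_range]
    split_ifs with hk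
    · exact (h k).hasDerivAt
    · have : (fun s => (P s).coeff k) = fun _ => 0 :=
        funext fun s => coeff_eq_zero_of_natDegree_lt ((hP s).trans_lt (by omega))
      rw [this]
      exact hasDerivAt_const _ _

end HasPolyDerivAt

section Differentiability

variable {n : ℕ} {L : ℝ → ℂ[X] →ₗ[ℂ] ℂ} {φ : ℝ}
  (hd : ∀ f, DifferentiableAt ℝ (fun s => L s f) φ) (hL : (hankel n (L φ)).det ≠ 0)
include hd hL

lemma differentiableAt_coeff_dualPoly (j : Fin (n + 1)) (k : ℕ) :
    DifferentiableAt ℝ (fun s => (dualPoly n (L s) j).coeff k) φ := by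
  simp only [dualPoly, finsetSum_coeff, coeff_C_mul]
  exact DifferentiableAt.fun_sum fun i _ =>
    (differentiableAt_inv (M := fun s => hankel n (L s)) (fun a b => hd _) hL j i).mul_const _

lemma exists_hasPolyDerivAt_subPoly :
    ∃ Q', HasPolyDerivAt n (fun s => subPoly n (L s)) Q' φ :=
  HasPolyDerivAt.of_differentiableAt (fun s => natDegree_subPoly_le n (L s))
    fun k => differentiableAt_coeff_dualPoly hd hL _ k

lemma exists_hasPolyDerivAt_orthPoly :
    ∃ P', HasPolyDerivAt (n + 1) (fun s => orthPoly n (L s)) P' φ := by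
  refine HasPolyDerivAt.of_differentiableAt (fun s => natDegree_orthPoly_le n (L s)) fun k => ?_
  simp only [orthPoly, coeff_sub, finsetSum_coeff, coeff_C_mul]
  exact (differentiableAt_const _).sub (DifferentiableAt.fun_sum fun i _ =>
    (hd _).mul (differentiableAt_coeff_dualPoly hd hL _ k))

end Differentiability

section Evolution

variable {n : ℕ} {L : ℝ → ℂ[X] →ₗ[ℂ] ℂ} {l : ℂ[X] →ₗ[ℂ] ℂ} {φ : ℝ} {x c κ : ℂ}
  (hd : ∀ f, HasDerivAt (fun s => L s f) (-κ * l f) φ) (hL : (hankel n (L φ)).det ≠ 0)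

include hd in
-- In Jacobi's formula the adjugate is the determinant times the inverse. The rows of the inverse
-- are the coefficients of the dual polynomials, so the sum collects into `diagPoly`.
lemma hasDerivAt_det_hankel (hL : (hankel n (L φ)).det ≠ 0) :
    HasDerivAt (fun s => (hankel n (L s)).det)
      (-κ * (hankel n (L φ)).det * l (diagPoly n (L φ))) φ := by
  have h := hasDerivAt_det (M := fun s => hankel n (L s))
    (M' := Matrix.of fun j k => -κ * l (X ^ ((j : ℕ) + k))) (φ := φ) fun j k => hd _
  convert! h using 1
  have hadj : (hankel n (L φ)).adjugate = (hankel n (L φ)).det • (hankel n (L φ))⁻¹ := by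
    rw [Matrix.inv_def, Ring.inverse_eq_inv', smul_smul, mul_inv_cancel₀ hL, one_smul]
  rw [hadj, diagPoly, map_sum, Finset.mul_sum]
  refine Finset.sum_congr rfl fun i _ => ?_
  rw [dualPoly, Finset.mul_sum, map_sum, Finset.mul_sum]
  refine Finset.sum_congr rfl fun k _ => ?_
  rw [mul_left_comm, map_C_mul, ← pow_add, Matrix.smul_apply, smul_eq_mul, Matrix.of_apply,
    add_comm (i : ℕ)]
  ring

include hd hL

lemma eventually_det_hankel_ne_zero : ∀ᶠ s in nhds φ, (hankel n (L s)).det ≠ 0 :=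
  (hasDerivAt_det_hankel hd hL).continuousAt.eventually_ne hL

/-- Differentiates an orthogonality relation whose right hand side is constant. The relation is only
required where the Hankel determinant is nonzero, which holds near φ. -/
lemma map_polyDeriv_mul_X_pow {m : ℕ} {P : ℝ → ℂ[X]} {P' : ℂ[X]} (hP : HasPolyDerivAt m P P' φ)
    {k : ℕ} {a : ℂ} (h : ∀ s, (hankel n (L s)).det ≠ 0 → L s (P s * X ^ k) = a) :
    L φ (P' * X ^ k) = κ * l (P φ * X ^ k) := by
  have h1 := (hP.mul (HasPolyDerivAt.const (X ^ k) φ)).hasDerivAt_map (Λ' := -κ • l) hd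
  have h2 : HasDerivAt (fun s => L s (P s * X ^ k)) 0 φ := by
    refine (hasDerivAt_const φ a).congr_of_eventuallyEq ?_
    filter_upwards [eventually_det_hankel_ne_zero hd hL] with s hs using h s hs
  have h3 := h1.unique h2
  rw [mul_zero, add_zero, LinearMap.smul_apply, smul_eq_mul] at h3
  linear_combination h3

variable (hl : ∀ f, l ((X - C x) * f) = c * L φ f)
include hl

/-- A derivative exists by differentiability of the inverse matrix and has degree at most n because
P is monic. Its moments are κ l(P X^k) = κ l(P) x^k, which are those of a multiple of the kernel at
x. -/
lemma hasPolyDerivAt_orthPoly :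
    HasPolyDerivAt (n + 1) (fun s => orthPoly n (L s))
      (C (κ * l (orthPoly n (L φ))) * kernelPoly n (L φ) x) φ := by
  obtain ⟨P', hP'⟩ := exists_hasPolyDerivAt_orthPoly (fun f => (hd f).differentiableAt) hL
  have hdeg : P'.natDegree ≤ n := by
    apply natDegree_le_of_coeff_succ hP'.natDegree_le'
    have h := hP'.hasDerivAt_coeff (n + 1)
    simp only [coeff_orthPoly_succ] at h
    exact h.unique (hasDerivAt_const _ _)
  convert! hP'
  apply eq_of_map_mul_X_pow_eq hL _ hdeg
  · intro k hk
    have hXk : (X ^ k : ℂ[X]).natDegree ≤ n := (natDegree_X_pow_le k).trans hk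
    rw [map_polyDeriv_mul_X_pow hd hL hP' (k := k) (a := 0) fun s hs => map_orthPoly_mul hs hXk,
      insertion_orthPoly_mul hL hl (hXk.trans n.le_succ), mul_assoc, map_C_mul,
      map_kernelPoly_mul hL _ hXk]
    ring
  · exact (natDegree_C_mul_le _ _).trans (natDegree_kernelPoly_le _ _ _)

lemma hasPolyDerivAt_subPoly :
    HasPolyDerivAt n (fun s => subPoly n (L s))
      (C (κ * l (subPoly n (L φ))) * kernelPoly n (L φ) x) φ := by
  obtain ⟨Q', hQ'⟩ := exists_hasPolyDerivAt_subPoly (fun f => (hd f).differentiableAt) hL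
  convert! hQ'
  apply eq_of_map_mul_X_pow_eq hL _ hQ'.natDegree_le'
  · intro k hk
    have hXk : (X ^ k : ℂ[X]).natDegree ≤ n := (natDegree_X_pow_le k).trans hk
    rw [map_polyDeriv_mul_X_pow hd hL hQ' (k := k) fun s hs => map_subPoly_mul hs hXk,
      insertion_subPoly_mul hL hl hXk, mul_assoc, map_C_mul, map_kernelPoly_mul hL _ hXk]
    ring
  · exact (natDegree_C_mul_le _ _).trans (natDegree_kernelPoly_le _ _ _)

end Evolution

end CircularJacobi

end

/-! ### Evolution of the residues when the pole t moves on the circle. -/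

noncomputable section

namespace CircularJacobi

open Polynomial

/-- The insertion of the pole `t` expressed by moments. -/
def poleInsertion (t : ℂ) (c : Fin 3 → ℂ) (L : ℂ[X] →ₗ[ℂ] ℂ) (f : ℂ[X]) : ℂ :=
  -(t * (t - 1))⁻¹ * L (derivative (X * (X - 1) * f)
    + (C (c 0) * (X - 1) + C (c 1) * X + C (c 2) * (X + C (t - 1))) * f)

/-- Integrate by parts against X(X - 1) f: the factor cancels the poles 0 and 1. The remaining
insertion becomes a combination of moments, hence differentiable in the angle. -/
lemma IsSemiclassical.insert_two_eq {t : ℂ} {c : Fin 3 → ℂ} {L : ℂ[X] →ₗ[ℂ] ℂ}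
    {l : Fin 3 → ℂ[X] →ₗ[ℂ] ℂ} (S : IsSemiclassical t c L l) (h0 : t ≠ 0) (h1 : t ≠ 1)
    (f : ℂ[X]) : l 2 f = poleInsertion t c L f := by
  have h := S.map_derivative (X * (X - 1) * f)
  have e0 : X * (X - 1) * f = X * ((X - 1) * f) := by ring
  have e1 : X * (X - 1) * f = (X - 1) * (X * f) := by ring
  rw [Fin.sum_univ_three, S.insert_two_mul, e0, S.insert_zero, ← e0, e1, S.insert_one, ← e1] at h
  have h1' : t - 1 ≠ 0 := sub_ne_zero.2 h1
  have e2 : (C (c 0) * (X - 1) + C (c 1) * X + C (c 2) * (X + C (t - 1))) * f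
      = C (c 0) * ((X - 1) * f) + C (c 1) * (X * f) + C (c 2) * ((X + C (t - 1)) * f) := by ring
  rw [poleInsertion, map_add, h, e2, map_add, map_add, map_C_mul, map_C_mul, map_C_mul]
  field_simp
  ring

/-- The standing assumptions on the evolution of the moments at `φ`. -/
structure HasEvolution (c : Fin 3 → ℂ) (L : ℝ → ℂ[X] →ₗ[ℂ] ℂ)
    (l : ℝ → Fin 3 → ℂ[X] →ₗ[ℂ] ℂ) (φ : ℝ) : Prop where
  ne_one : ∀ᶠ s in nhds φ, cis s ≠ 1
  semiclassical : ∀ᶠ s in nhds φ, IsSemiclassical (cis s) c (L s) (l s)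
  hasDerivAt : ∀ f, HasDerivAt (fun s => L s f) (-(Complex.I * cis φ) * l φ 2 f) φ

lemma cis_ne_zero (φ : ℝ) : cis φ ≠ 0 := Complex.exp_ne_zero _

lemma hasDerivAt_cis (φ : ℝ) : HasDerivAt cis (Complex.I * cis φ) φ := by
  have h : HasDerivAt (fun s : ℝ => Complex.I * (s : ℂ)) Complex.I φ := by
    simpa using (Complex.ofRealCLM.hasDerivAt (x := φ)).const_mul Complex.I
  exact h.cexp.congr_deriv (mul_comm _ _)

namespace HasEvolution

variable {n : ℕ} {c : Fin 3 → ℂ} {L : ℝ → ℂ[X] →ₗ[ℂ] ℂ} {l : ℝ → Fin 3 → ℂ[X] →ₗ[ℂ] ℂ} {φ : ℝ}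
  (E : HasEvolution c L l φ)
include E

lemma semiclassical_self : IsSemiclassical (cis φ) c (L φ) (l φ) := E.semiclassical.self_of_nhds

lemma ne_one_self : cis φ ≠ 1 := E.ne_one.self_of_nhds

/-- The evolution of the insertion of the moving pole. -/
lemma hasDerivAt_insert_two (f : ℂ[X]) :
    HasDerivAt (fun s => l s 2 f)
      (Complex.I * cis φ * ((c 2 * l φ 0 f - c 0 * l φ 2 f) / (0 - cis φ)
        + (c 2 * l φ 1 f - c 1 * l φ 2 f) / (1 - cis φ) + l φ 2 (derivative f))) φ := by
  have ht := hasDerivAt_cis φ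
  have h0 := cis_ne_zero φ
  have h1 := sub_ne_zero.2 E.ne_one_self
  have S := E.semiclassical_self
  -- Differentiate the expression by moments; the remaining steps translate the result back into
  -- insertions.
  have key : HasDerivAt (fun s => poleInsertion (cis s) c (L s) f)
      (Complex.I * cis φ * (2 * cis φ - 1) * ((cis φ * (cis φ - 1)) ^ 2)⁻¹
        * L φ (derivative (X * (X - 1) * f)
            + (C (c 0) * (X - 1) + C (c 1) * X + C (c 2) * (X + C (cis φ - 1))) * f)
        - (cis φ * (cis φ - 1))⁻¹ * (-(Complex.I * cis φ) * l φ 2 (derivative (X * (X - 1) * f)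
            + (C (c 0) * (X - 1) + C (c 1) * X + C (c 2) * (X + C (cis φ - 1))) * f)
          + Complex.I * cis φ * c 2 * L φ f)) φ := by
    have hL : HasDerivAt (fun s => L s (derivative (X * (X - 1) * f)
            + (C (c 0) * (X - 1) + C (c 1) * X + C (c 2) * (X + C (cis s - 1))) * f))
        (-(Complex.I * cis φ) * l φ 2 (derivative (X * (X - 1) * f)
            + (C (c 0) * (X - 1) + C (c 1) * X + C (c 2) * (X + C (cis φ - 1))) * f)
          + Complex.I * cis φ * c 2 * L φ f) φ := by
      have e : ∀ s (Λ : ℂ[X] →ₗ[ℂ] ℂ), Λ (derivative (X * (X - 1) * f)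
            + (C (c 0) * (X - 1) + C (c 1) * X + C (c 2) * (X + C (cis s - 1))) * f)
          = Λ (derivative (X * (X - 1) * f)
            + (C (c 0) * (X - 1) + C (c 1) * X + C (c 2) * (X - 1)) * f)
            + c 2 * (cis s * Λ f) := by
        intro s Λ
        rw [← map_C_mul, ← map_C_mul, ← map_add]
        congr 1
        rw [C_sub, C_1]
        ring
      simp only [e]
      refine ((E.hasDerivAt _).add ((ht.mul (E.hasDerivAt f)).const_mul (c 2))).congr_deriv ?_
      ring
    have hg : HasDerivAt (fun s => -(cis s * (cis s - 1))⁻¹)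
        (Complex.I * cis φ * (2 * cis φ - 1) * ((cis φ * (cis φ - 1)) ^ 2)⁻¹) φ := by
      refine (((ht.mul (ht.sub_const 1)).inv (mul_ne_zero h0 h1)).neg).congr_deriv ?_
      simp only [Pi.mul_apply]
      field_simp
      ring
    refine (hg.mul hL).congr_deriv ?_
    ring
  have hev : (fun s => l s 2 f) =ᶠ[nhds φ] fun s => poleInsertion (cis s) c (L s) f := by
    filter_upwards [E.semiclassical, E.ne_one] with s hs hs1
    exact hs.insert_two_eq (cis_ne_zero s) hs1 f
  refine (key.congr_of_eventuallyEq hev).congr_deriv ?_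
  have p := S.insert_two_eq h0 E.ne_one_self f
  rw [poleInsertion] at p
  have p' : L φ (derivative (X * (X - 1) * f)
      + (C (c 0) * (X - 1) + C (c 1) * X + C (c 2) * (X + C (cis φ - 1))) * f)
      = -(cis φ * (cis φ - 1)) * l φ 2 f := by
    rw [p]; field_simp
  have q1 : l φ 2 (derivative (X * (X - 1) * f)
      + (C (c 0) * (X - 1) + C (c 1) * X + C (c 2) * (X + C (cis φ - 1))) * f)
      = l φ 2 (X * (X - 1) * derivative f)
        + (2 * cis φ - 1 + c 0 * (cis φ - 1) + c 1 * cis φ + c 2 * (2 * cis φ - 1)) * l φ 2 f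
        + (2 + c 0 + c 1 + c 2) * l φ 2 ((X - C (cis φ)) * f) := by
    rw [← map_C_mul, ← map_C_mul, ← map_add, ← map_add]
    congr 1
    simp only [derivative_mul, derivative_X, derivative_sub, derivative_one, C_add, C_sub, C_mul,
      C_1, map_ofNat]
    ring
  -- This integration by parts eliminates the moment containing the derivative of f.
  have q2 := S.map_derivative ((X + C (cis φ - 1)) * f)
  have q3 : l φ 0 ((X + C (cis φ - 1)) * f) = c 0 * L φ f + (cis φ - 1) * l φ 0 f := by
    rw [add_mul, map_add, S.insert_zero, map_C_mul]
  have q4 : l φ 1 ((X + C (cis φ - 1)) * f) = c 1 * L φ f + cis φ * l φ 1 f := by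
    have : (X + C (cis φ - 1)) * f = (X - 1) * f + C (cis φ) * f := by
      rw [C_sub, C_1]; ring
    rw [this, map_add, S.insert_one, map_C_mul]
  have q5 : l φ 2 ((X + C (cis φ - 1)) * f) = c 2 * L φ f + (2 * cis φ - 1) * l φ 2 f := by
    have : (X + C (cis φ - 1)) * f = (X - C (cis φ)) * f + C (2 * cis φ - 1) * f := by
      simp only [C_sub, C_mul, C_1, map_ofNat]; ring
    rw [this, map_add, S.insert_two, map_C_mul]
  rw [derivative_mul, derivative_add, derivative_X, derivative_C, add_zero, one_mul, map_add,
    Fin.sum_univ_three, q3, q4, q5] at q2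
  rw [p', q1, S.insert_two_mul, S.insert_two]
  have q6 : L φ ((X + C (cis φ - 1)) * derivative f) = -L φ f - (c 0 + c 1 + c 2) * L φ f
      - (cis φ - 1) * l φ 0 f - cis φ * l φ 1 f - (2 * cis φ - 1) * l φ 2 f := by
    linear_combination q2
  rw [q6]
  have h1' : 1 - cis φ ≠ 0 := by rwa [← neg_sub, neg_ne_zero]
  rw [zero_sub]
  generalize cis φ = t at *
  field_simp
  ring

variable (hL : (hankel n (L φ)).det ≠ 0)
include hL

/-- P evolves by a multiple of the kernel at t, whose leading coefficient is Q(t); and l_2(P) Q(t) =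
l_2(PQ). -/
lemma hasDerivAt_coeff_orthPoly :
    HasDerivAt (fun s => (orthPoly n (L s)).coeff n)
      (Complex.I * cis φ * l φ 2 (orthPoly n (L φ) * subPoly n (L φ))) φ := by
  have S := E.semiclassical_self
  have h := (hasPolyDerivAt_orthPoly E.hasDerivAt hL S.insert_two).hasDerivAt_coeff n
  rw [coeff_C_mul, coeff_kernelPoly hL] at h
  refine h.congr_deriv ?_
  rw [S.insert_orth_sub hL]
  simp only [Matrix.cons_val]
  ring

/-- One component of the Schlesinger equations of the associated Fuchsian system. -/
lemma hasDerivAt_insert_orth_sub :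
    HasDerivAt (fun s => l s 2 (orthPoly n (L s) * subPoly n (L s)))
      (Complex.I * cis φ * (cis φ * (cis φ - 1))⁻¹
        * (l φ 0 (subPoly n (L φ) * subPoly n (L φ)) * l φ 2 (orthPoly n (L φ) * orthPoly n (L φ))
        - l φ 0 (orthPoly n (L φ) * orthPoly n (L φ))
          * l φ 2 (subPoly n (L φ) * subPoly n (L φ)))) φ := by
  have S := E.semiclassical_self
  have hP := hasPolyDerivAt_orthPoly E.hasDerivAt hL S.insert_two
  have hQ := hasPolyDerivAt_subPoly E.hasDerivAt hL S.insert_two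
  set t := cis φ with ht
  set P := orthPoly n (L φ) with hPdef
  set Q := subPoly n (L φ) with hQdef
  set K := kernelPoly n (L φ) with hK
  have h0 : t ≠ 0 := cis_ne_zero φ
  have h1 : t - 1 ≠ 0 := sub_ne_zero.2 E.ne_one_self
  set Λ' : ℂ[X] →ₗ[ℂ] ℂ := (Complex.I * t) • (((c 2 / (0 - t)) • l φ 0 - (c 0 / (0 - t)) • l φ 2)
      + ((c 2 / (1 - t)) • l φ 1 - (c 1 / (1 - t)) • l φ 2) + l φ 2 ∘ₗ derivative) with hΛ'
  have hΛ : ∀ f, HasDerivAt (fun s => l s 2 f) (Λ' f) φ := by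
    intro f
    refine (E.hasDerivAt_insert_two f).congr_deriv ?_
    simp only [hΛ', LinearMap.smul_apply, LinearMap.add_apply, LinearMap.sub_apply,
      LinearMap.comp_apply, smul_eq_mul]
    ring
  refine ((hP.mul hQ).hasDerivAt_map (Λ := fun s => l s 2) hΛ).congr_deriv ?_
  -- The derivative of PQ in x and its evolution in t carry opposite kernel terms at the pole t, so
  -- only the kernels at 0 and 1 survive.
  have e : derivative (P * Q)
      + (C (l φ 2 P) * K t * Q + P * (C (l φ 2 Q) * K t))
      = - (C (l φ 0 P) * (Q * K 0) + C (l φ 0 Q) * (P * K 0)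
        + (C (l φ 1 P) * (Q * K 1) + C (l φ 1 Q) * (P * K 1))) := by
    rw [derivative_mul, S.derivative_orthPoly hL, S.derivative_subPoly hL, Fin.sum_univ_three,
      Fin.sum_univ_three]
    simp only [Matrix.cons_val]
    rw [← hPdef, ← hQdef, ← hK]
    ring
  have e1 : (C (Complex.I * t * l φ 2 P) * K t * Q + P * (C (Complex.I * t * l φ 2 Q) * K t))
      = C (Complex.I * t) * (C (l φ 2 P) * K t * Q + P * (C (l φ 2 Q) * K t)) := by
    rw [C_mul, C_mul (b := l φ 2 Q)]; ring
  have e2 := congrArg (l φ 2) e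
  rw [map_add] at e2
  have r0 := S.pair_add_mul_eval_kernelPoly hL 0
  have r1 := S.pair_add_mul_eval_kernelPoly hL 1
  have s0 := S.sum_insert_orth_orth hL
  have s1 := S.sum_insert_sub_sub hL
  rw [Fin.sum_univ_three] at s0 s1
  simp only [Matrix.cons_val] at r0 r1
  have k0 := S.insert_sub_kernel hL 2 0
  have k1 := S.insert_sub_kernel hL 2 1
  have k2 := S.insert_orth_kernel hL 2 0
  have k3 := S.insert_orth_kernel hL 2 1
  simp only [Matrix.cons_val] at k0 k1 k2 k3
  rw [← hPdef, ← hQdef, ← hK] at *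
  rw [e1, map_C_mul]
  have e3 : l φ 2 (C (l φ 2 P) * K t * Q + P * (C (l φ 2 Q) * K t))
      = - ((l φ 0 Q * l φ 2 P + l φ 0 P * l φ 2 Q) * (K 0).eval t
        + (l φ 1 Q * l φ 2 P + l φ 1 P * l φ 2 Q) * (K 1).eval t) - l φ 2 (derivative (P * Q)) := by
    rw [← add_right_inj, e2, map_neg, map_add, map_add, map_add, map_C_mul, map_C_mul, map_C_mul,
      map_C_mul, k0, k1, k2, k3]
    ring
  rw [e3]
  simp only [hΛ', LinearMap.smul_apply, LinearMap.add_apply, LinearMap.sub_apply,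
      LinearMap.comp_apply, smul_eq_mul]
  have r0' : (l φ 0 Q * l φ 2 P + l φ 0 P * l φ 2 Q) * (K 0).eval t
      = t⁻¹ * (l φ 0 (Q * Q) * l φ 2 (P * P) - l φ 0 (P * P) * l φ 2 (Q * Q)
        + l φ 0 (P * Q) * (l φ 2 (P * Q) - c 2) - (l φ 0 (P * Q) - c 0) * l φ 2 (P * Q)) := by
    rw [← r0, sub_zero]; field_simp
  have r1' : (l φ 1 Q * l φ 2 P + l φ 1 P * l φ 2 Q) * (K 1).eval t
      = (t - 1)⁻¹ * (l φ 1 (Q * Q) * l φ 2 (P * P) - l φ 1 (P * P) * l φ 2 (Q * Q)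
        + l φ 1 (P * Q) * (l φ 2 (P * Q) - c 2) - (l φ 1 (P * Q) - c 1) * l φ 2 (P * Q)) := by
    rw [← r1]; field_simp
  rw [r0', r1']
  -- Eliminating the residues at 1 merges the factors 1/t and 1/(t - 1) into 1/(t(t - 1)).
  have s0' : l φ 1 (P * P) = - l φ 0 (P * P) - l φ 2 (P * P) := by linear_combination s0
  have s1' : l φ 1 (Q * Q) = - l φ 0 (Q * Q) - l φ 2 (Q * Q) := by linear_combination s1
  rw [s0', s1', zero_sub, ← neg_sub t 1]
  field_simp
  ring

end HasEvolution

end CircularJacobi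

end

/-! ### The closed system for the logarithmic derivative of the determinant. -/

noncomputable section

namespace CircularJacobi

open Polynomial

/-- `t (t - 1)` times the logarithmic derivative in `t` of the Hankel determinant, as a function
of the subleading coefficient `p` of the orthogonal polynomial of degree `N`. -/
def logDerivForm (N : ℂ) (c : Fin 3 → ℂ) (t p : ℂ) : ℂ :=
  -(2 * N + ∑ i, c i) * p - N ^ 2 + N * (c 2 * (t - 1) - c 0)

namespace HasEvolution

variable {n : ℕ} {c : Fin 3 → ℂ} {L : ℝ → ℂ[X] →ₗ[ℂ] ℂ} {l : ℝ → Fin 3 → ℂ[X] →ₗ[ℂ] ℂ} {φ : ℝ}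
  (E : HasEvolution c L l φ) (hL : (hankel n (L φ)).det ≠ 0)
include E hL

lemma hasDerivAt_det_hankel :
    HasDerivAt (fun s => (hankel n (L s)).det)
      ((hankel n (L φ)).det * (Complex.I * (cis φ - 1)⁻¹
        * logDerivForm (n + 1) c (cis φ) ((orthPoly n (L φ)).coeff n))) φ := by
  refine (CircularJacobi.hasDerivAt_det_hankel E.hasDerivAt hL).congr_deriv ?_
  have h0 : cis φ ≠ 0 := cis_ne_zero φ
  have h1 : cis φ - 1 ≠ 0 := sub_ne_zero.2 E.ne_one_self
  rw [logDerivForm, ← E.semiclassical_self.insert_diagPoly_eq hL]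
  field_simp

/-- The closed system of relations satisfied by the insertion `b` of the moving pole in the
product of the two orthogonal polynomials. -/
lemma exists_relation :
    ∃ s b₀ x : ℂ,
      HasDerivAt (fun s => l s 2 (orthPoly n (L s) * subPoly n (L s)))
        (Complex.I * (cis φ - 1)⁻¹ * s) φ ∧
      ∀ b, b = l φ 2 (orthPoly n (L φ) * subPoly n (L φ)) →
        s ^ 2 = x ^ 2 - 4 * (b₀ * (b₀ - c 0)) * (b * (b - c 2)) ∧
        x = (n + 1 + b₀ + b) * (n + 1 + b₀ + b + c 1) - b₀ * (b₀ - c 0) - b * (b - c 2) ∧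
        logDerivForm (n + 1) c (cis φ) ((orthPoly n (L φ)).coeff n)
          = (cis φ - 1) * (2 * b₀ * b - c 0 * b - c 2 * b₀ - x)
            + cis φ * (-2 * (n + 1 + b₀ + b) * b - c 1 * b + c 2 * (n + 1 + b₀ + b)
              + x + 2 * (b * (b - c 2))) := by
  have S := E.semiclassical_self
  have h0 : cis φ ≠ 0 := cis_ne_zero φ
  have h1 : cis φ - 1 ≠ 0 := sub_ne_zero.2 E.ne_one_self
  have q0 := S.quadratic_relation hL 0
  have q1 := S.quadratic_relation hL 1
  have q2 := S.quadratic_relation hL 2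
  have s0 := S.sum_insert_orth_orth hL
  have s1 := S.sum_insert_sub_sub hL
  have s2 := S.sum_insert_orth_sub hL
  have r0 := S.pair_sub_mul_eval_kernelPoly hL 0
  have r1 := S.pair_sub_mul_eval_kernelPoly hL 1
  have d := S.insert_diagPoly hL
  have d' := S.insert_diagPoly_eq hL
  have hd := E.hasDerivAt_insert_orth_sub hL
  rw [Finset.sum_pair (by decide)] at d
  rw [Fin.sum_univ_three] at s0 s1 s2
  rw [d] at d'
  simp only [Matrix.cons_val] at r0 r1 d'
  rw [logDerivForm]
  generalize orthPoly n (L φ) = P at *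
  generalize subPoly n (L φ) = Q at *
  generalize kernelPoly n (L φ) = K at *
  -- The witnesses are s = d_0 a_2 - a_0 d_2, then b_0, then x = d_0 a_2 + a_0 d_2. Thus s² - x² =
  -- -4 (a_0 d_0)(a_2 d_2), to which the quadratic relations at 0 and t apply.
  refine ⟨l φ 0 (Q * Q) * l φ 2 (P * P) - l φ 0 (P * P) * l φ 2 (Q * Q), l φ 0 (P * Q),
    l φ 0 (Q * Q) * l φ 2 (P * P) + l φ 0 (P * P) * l φ 2 (Q * Q), ?_, ?_⟩
  · refine hd.congr_deriv ?_
    field_simp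
  · rintro b rfl
    -- With the residue at 1 eliminated, the quadratic relation at 1 becomes the formula for x.
    have a1 : l φ 1 (P * P) = - l φ 0 (P * P) - l φ 2 (P * P) := by linear_combination s0
    have d1 : l φ 1 (Q * Q) = - l φ 0 (Q * Q) - l φ 2 (Q * Q) := by linear_combination s1
    have b1 : l φ 1 (P * Q) = - (n + 1) - l φ 0 (P * Q) - l φ 2 (P * Q) := by
      linear_combination s2
    rw [a1, d1, b1] at q1 r1
    refine ⟨?_, ?_, ?_⟩
    · linear_combination (-4) * (l φ 0 (P * Q) * (l φ 0 (P * Q) - c 0)) * q2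
        - 4 * (l φ 2 (P * P) * l φ 2 (Q * Q)) * q0
    · linear_combination q1 - q0 - q2
    · rw [← d']
      linear_combination (-(cis φ - 1)) * r0 - cis φ * r1 + 2 * cis φ * q2

end HasEvolution

end CircularJacobi

end

/-! ### Chord lengths and integrability of their powers. -/

noncomputable section

namespace CircularJacobi

open Polynomial

/-- The chord length `|e^{ia} - e^{iα}|`. -/
def chord (a α : ℝ) : ℝ := ‖cis a - cis α‖

lemma norm_cis (α : ℝ) : ‖cis α‖ = 1 := by
  rw [cis, mul_comm]; exact Complex.norm_exp_ofReal_mul_I α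

lemma cis_add (α β : ℝ) : cis (α + β) = cis α * cis β := by
  rw [cis, cis, cis, ← Complex.exp_add]; push_cast; ring_nf

lemma cis_zero : cis 0 = 1 := by simp [cis]

lemma cis_two_pi : cis (2 * Real.pi) = 1 := by
  rw [cis]; push_cast; rw [mul_comm, Complex.exp_two_pi_mul_I]

lemma cis_eq_cos_add_sin (α : ℝ) : cis α = Real.cos α + Real.sin α * Complex.I := by
  rw [cis, mul_comm, Complex.exp_mul_I, Complex.ofReal_cos, Complex.ofReal_sin]

lemma continuous_cis : Continuous cis :=
  continuous_iff_continuousAt.2 fun φ => (hasDerivAt_cis φ).continuousAt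

lemma chord_nonneg (a α : ℝ) : 0 ≤ chord a α := norm_nonneg _

lemma chord_comm (a α : ℝ) : chord a α = chord α a := norm_sub_rev _ _

lemma chord_le_two (a α : ℝ) : chord a α ≤ 2 :=
  (norm_sub_le _ _).trans (by rw [norm_cis, norm_cis]; norm_num)

lemma continuous_chord (a : ℝ) : Continuous (chord a) :=
  (continuous_const.sub continuous_cis).norm

lemma chord_sq (a α : ℝ) : chord a α ^ 2 = 2 - 2 * Real.cos (α - a) := by
  rw [chord, cis_eq_cos_add_sin, cis_eq_cos_add_sin, ← Complex.normSq_eq_norm_sq,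
    Complex.normSq_apply, Real.cos_sub]
  simp only [Complex.add_re, Complex.sub_re, Complex.ofReal_re, Complex.mul_re, Complex.I_re,
    Complex.ofReal_im, Complex.I_im, Complex.add_im, Complex.sub_im, Complex.mul_im]
  nlinarith [Real.sin_sq_add_cos_sq α, Real.sin_sq_add_cos_sq a]

lemma chord_eq_abs_sin (a α : ℝ) : chord a α = 2 * |Real.sin ((α - a) / 2)| := by
  rw [← Real.sqrt_sq (chord_nonneg a α), chord_sq, ← Real.sqrt_sq (by positivity :
    0 ≤ 2 * |Real.sin ((α - a) / 2)|)]
  congr 1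
  rw [mul_pow, sq_abs, Real.sin_sq_eq_half_sub, mul_div_cancel₀ _ (two_ne_zero)]
  ring

/-- Isolates the zero |α - a| of the chord; the other factor does not vanish for |α - a| < 2π. -/
lemma chord_eq_abs_mul_sinc (a α : ℝ) : chord a α = |α - a| * |Real.sinc ((α - a) / 2)| := by
  rw [chord_eq_abs_sin]
  rcases eq_or_ne α a with rfl | h
  · simp
  · have h' : α - a ≠ 0 := sub_ne_zero.2 h
    rw [Real.sinc_of_ne_zero (div_ne_zero h' two_ne_zero), abs_div, abs_div]
    have : |α - a| ≠ 0 := abs_ne_zero.2 h'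
    field_simp
    rw [abs_two]
    ring

lemma chord_le_abs (a α : ℝ) : chord a α ≤ |α - a| := by
  rw [chord_eq_abs_mul_sinc]
  exact mul_le_of_le_one_right (abs_nonneg _) (Real.abs_sinc_le_one _)

lemma sinc_half_ne_zero {x : ℝ} (h : |x| < 2 * Real.pi) : Real.sinc (x / 2) ≠ 0 := by
  rcases eq_or_ne x 0 with rfl | h0
  · simp
  · rw [Real.sinc_of_ne_zero (div_ne_zero h0 two_ne_zero)]
    refine div_ne_zero ?_ (div_ne_zero h0 two_ne_zero)
    rw [Ne, Real.sin_eq_zero_iff_of_lt_of_lt]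
    · exact div_ne_zero h0 two_ne_zero
    · linarith [(abs_lt.1 h).1]
    · linarith [(abs_lt.1 h).2]

lemma chord_ne_zero {a α : ℝ} (h0 : α ≠ a) (h : |α - a| < 2 * Real.pi) : chord a α ≠ 0 := by
  rw [chord_eq_abs_mul_sinc]
  exact mul_ne_zero (abs_ne_zero.2 (sub_ne_zero.2 h0)) (abs_ne_zero.2 (sinc_half_ne_zero h))

lemma chord_ne_zero_iff {a α : ℝ} : chord a α ≠ 0 ↔ cis α ≠ cis a := by
  rw [chord, norm_ne_zero_iff, sub_ne_zero, ne_comm]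

/-- The logarithmic derivative of a power of the chord length. -/
lemma hasDerivAt_chord_rpow {a α : ℝ} (p : ℝ) (h : chord a α ≠ 0) :
    HasDerivAt (fun β => ((chord a β ^ p : ℝ) : ℂ))
      (((chord a α ^ p : ℝ) : ℂ) * (p * Complex.I / 2 * (cis α + cis a) / (cis α - cis a))) α := by
  have hpos : 0 < chord a α := lt_of_le_of_ne (chord_nonneg _ _) h.symm
  -- The squared chord is smooth in the angle, so the derivative is taken of its power p/2.
  have e : ∀ β, chord a β ^ p = (2 - 2 * Real.cos (β - a)) ^ (p / 2) := by
    intro β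
    rw [← chord_sq, ← Real.rpow_natCast, ← Real.rpow_mul (chord_nonneg _ _)]
    congr 1
    push_cast
    ring
  have h1 : HasDerivAt (fun β => (2 - 2 * Real.cos (β - a)) ^ (p / 2))
      ((2 * Real.sin (α - a)) * (p / 2) * (2 - 2 * Real.cos (α - a)) ^ (p / 2 - 1)) α := by
    have h2 : HasDerivAt (fun β => 2 - 2 * Real.cos (β - a)) (2 * Real.sin (α - a)) α := by
      have := (((Real.hasDerivAt_cos (α - a)).comp_sub_const α a).const_mul 2).const_sub 2
      convert! this using 1
      ring
    exact h2.rpow_const (Or.inl (by rw [← chord_sq]; positivity))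
  simp only [e]
  refine h1.ofReal_comp.congr_deriv ?_
  have hD : 2 - 2 * Real.cos (α - a) ≠ 0 := by rw [← chord_sq]; positivity
  rw [Real.rpow_sub_one hD]
  push_cast
  have hsub : cis α - cis a ≠ 0 := sub_ne_zero.2 (chord_ne_zero_iff.1 h)
  have hD' : (2 : ℂ) - 2 * Complex.cos (α - a) ≠ 0 := by exact_mod_cast hD
  have key : 2 * Complex.sin (α - a) * (cis α - cis a)
      = Complex.I * (cis α + cis a) * (2 - 2 * Complex.cos (α - a)) := by
    have e1 : cis α = cis a * (Complex.cos (α - a) + Complex.sin (α - a) * Complex.I) := by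
      have := cis_eq_cos_add_sin (α - a)
      push_cast at this
      rw [← this, ← cis_add, add_sub_cancel]
    rw [e1]
    linear_combination (2 * Complex.I * cis a) * Complex.sin_sq_add_cos_sq (α - a : ℂ)
      + (2 * cis a * Complex.sin (α - a) * (-1 + Complex.cos (α - a))
        ) * Complex.I_sq
  have key' : 2 * Complex.sin (α - a) * (p / 2) / (2 - 2 * Complex.cos (α - a))
      = p * Complex.I / 2 * (cis α + cis a) / (cis α - cis a) := by
    rw [div_eq_div_iff hD' hsub]
    linear_combination (p / 2 : ℂ) * key
  rw [← key']
  ring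

lemma intervalIntegrable_abs_sub_rpow (a b : ℝ) {p : ℝ} (hp : -1 < p) :
    IntervalIntegrable (fun α => |α - a| ^ p) MeasureTheory.volume a b := by
  rcases le_total a b with h | h
  · have h1 := ((intervalIntegral.intervalIntegrable_rpow' (a := 0) (b := b - a) hp).comp_sub_right
      a)
    rw [zero_add, sub_add_cancel] at h1
    refine h1.congr fun α hα => ?_
    rw [Set.uIoc_of_le h] at hα
    rw [abs_of_nonneg (by linarith [hα.1])]
  · have h1 := ((intervalIntegral.intervalIntegrable_rpow' (a := 0) (b := a - b) hp).comp_sub_left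
      a)
    rw [sub_zero, sub_sub_cancel] at h1
    refine h1.congr fun α hα => ?_
    rw [Set.uIoc_of_ge h] at hα
    rw [abs_sub_comm, abs_of_nonneg (by linarith [hα.2])]

lemma intervalIntegrable_chord_rpow {a b : ℝ} {p : ℝ} (hp : -1 < p)
    (hab : |b - a| < 2 * Real.pi) :
    IntervalIntegrable (fun α => chord a α ^ p) MeasureTheory.volume a b := by
  have e : (fun α => chord a α ^ p)
      = fun α => |α - a| ^ p * |Real.sinc ((α - a) / 2)| ^ p := by
    funext α
    rw [chord_eq_abs_mul_sinc, Real.mul_rpow (abs_nonneg _) (abs_nonneg _)]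
  rw [e]
  refine (intervalIntegrable_abs_sub_rpow a b hp).mul_continuousOn ?_
  refine ContinuousOn.rpow_const ?_ fun α hα => Or.inl ?_
  · exact ((Real.continuous_sinc.comp (by fun_prop)).abs).continuousOn
  · refine abs_ne_zero.2 (sinc_half_ne_zero (lt_of_le_of_lt ?_ hab))
    exact Set.abs_sub_left_of_mem_uIcc hα

/-- Integrability of the modulus of a weight with two singular points on the circle. -/
lemma intervalIntegrable_chord_mul_chord {φ p q : ℝ} (hφ : φ ∈ Set.Ioo 0 (2 * Real.pi))
    (hp : -1 < p) (hq : -1 < q) :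
    IntervalIntegrable (fun α => chord 0 α ^ p * chord φ α ^ q) MeasureTheory.volume
      0 (2 * Real.pi) := by
  obtain ⟨h0, h1⟩ := hφ
  have hper : ∀ α, chord (2 * Real.pi) α = chord 0 α := fun α => by
    rw [chord, chord, cis_two_pi, cis_zero]
  have hc : ∀ (a r : ℝ) (s : Set ℝ), (∀ α ∈ s, α ≠ a ∧ |α - a| < 2 * Real.pi) →
      ContinuousOn (fun α => chord a α ^ r) s := fun a r s hs =>
    (continuous_chord a).continuousOn.rpow_const fun α hα =>
      Or.inl (chord_ne_zero (hs α hα).1 (hs α hα).2)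
  -- The circle is cut into four arcs, each with a single singular point, at an end. On the last arc
  -- it is 2π, the same point of the circle as 0.
  have i1 : IntervalIntegrable (fun α => chord 0 α ^ p * chord φ α ^ q) MeasureTheory.volume
      0 (φ / 2) := by
    refine (intervalIntegrable_chord_rpow hp ?_).mul_continuousOn (hc _ _ _ fun α hα => ?_)
    · rw [abs_lt]; constructor <;> linarith
    · rw [Set.uIcc_of_le (by linarith)] at hα
      exact ⟨by linarith [hα.2], by rw [abs_lt]; constructor <;> linarith [hα.1, hα.2]⟩
  have i2 : IntervalIntegrable (fun α => chord 0 α ^ p * chord φ α ^ q) MeasureTheory.volume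
      (φ / 2) φ := by
    refine (intervalIntegrable_chord_rpow hq ?_).symm.continuousOn_mul (hc _ _ _ fun α hα => ?_)
    · rw [abs_lt]; constructor <;> linarith
    · rw [Set.uIcc_of_le (by linarith)] at hα
      exact ⟨by linarith [hα.1], by rw [abs_lt]; constructor <;> linarith [hα.1, hα.2]⟩
  have i3 : IntervalIntegrable (fun α => chord 0 α ^ p * chord φ α ^ q) MeasureTheory.volume
      φ ((φ + 2 * Real.pi) / 2) := by
    refine (intervalIntegrable_chord_rpow hq ?_).continuousOn_mul (hc _ _ _ fun α hα => ?_)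
    · rw [abs_lt]; constructor <;> linarith
    · rw [Set.uIcc_of_le (by linarith)] at hα
      exact ⟨by linarith [hα.1], by rw [abs_lt]; constructor <;> linarith [hα.1, hα.2]⟩
  have i4 : IntervalIntegrable (fun α => chord 0 α ^ p * chord φ α ^ q) MeasureTheory.volume
      ((φ + 2 * Real.pi) / 2) (2 * Real.pi) := by
    simp only [← hper]
    refine (intervalIntegrable_chord_rpow hp ?_).symm.mul_continuousOn (hc _ _ _ fun α hα => ?_)
    · rw [abs_lt]; constructor <;> linarith
    · rw [Set.uIcc_of_le (by linarith)] at hα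
      exact ⟨by linarith [hα.1], by rw [abs_lt]; constructor <;> linarith [hα.1, hα.2]⟩
  exact ((i1.trans i2).trans i3).trans i4

/-- A chord times its length to a power larger than `-1` is continuous. -/
lemma continuous_chord_rpow_mul (a : ℝ) {p : ℝ} (hp : -1 < p) :
    Continuous fun α => ((chord a α ^ p : ℝ) : ℂ) * (cis α - cis a) := by
  rw [continuous_iff_continuousAt]
  intro α
  by_cases h : chord a α = 0
  · have h0 : cis α - cis a = 0 := by
      rw [chord, norm_eq_zero, sub_eq_zero] at h; rw [h, sub_self]
    rw [ContinuousAt, h0, mul_zero, tendsto_zero_iff_norm_tendsto_zero]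
    have e : ∀ β, ‖((chord a β ^ p : ℝ) : ℂ) * (cis β - cis a)‖ = chord a β ^ (p + 1) := by
      intro β
      rw [norm_mul, Complex.norm_real, Real.norm_of_nonneg (Real.rpow_nonneg (chord_nonneg _ _) _),
        norm_sub_rev, ← chord, Real.rpow_add_one' (chord_nonneg _ _) (by linarith)]
    simp only [e]
    have := ((continuous_chord a).rpow_const fun β => Or.inr (by linarith : 0 ≤ p + 1)).tendsto α
    rwa [h, Real.zero_rpow (by linarith)] at this
  · exact (Complex.continuous_ofReal.continuousAt.comp
      ((continuous_chord a).continuousAt.rpow_const (Or.inl h))).mul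
      (continuous_cis.continuousAt.sub continuousAt_const)

end CircularJacobi

end

/-! ### The circular Jacobi weight and its Pearson equation. -/

noncomputable section

namespace CircularJacobi

open Polynomial MeasureTheory

/-- The part of the circular Jacobi weight (in the angle `α = π - θ`) which does not depend on the
moving singularity, times the factor `z^{-n}` which turns Toeplitz into Hankel determinants. -/
def fixedWeight (n : ℕ) (ω₁ ω₂ α : ℝ) : ℂ :=
  ((Real.exp (ω₂ * (Real.pi - α)) : ℝ) : ℂ) * (cis α)⁻¹ ^ n * ((chord 0 α ^ (2 * ω₁) : ℝ) : ℂ)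

/-- The factor of the weight with a jump at the moving singularity. -/
def jump (ζ : ℂ) (φ α : ℝ) : ℂ := if 0 < α ∧ α < φ then 1 - ζ else 1

/-- The circular Jacobi weight in the angle `α = π - θ`, times `z^{-n}`. -/
def circleWeight (n : ℕ) (ω₁ ω₂ μ : ℝ) (ζ : ℂ) (φ α : ℝ) : ℂ :=
  fixedWeight n ω₁ ω₂ α * (((chord φ α ^ (2 * μ) : ℝ) : ℂ) * jump ζ φ α)

/-- The linear functional of integration against the weight, normalised by a phase. -/
def momentFunctional (n : ℕ) (ω₁ ω₂ μ : ℝ) (ζ : ℂ) (φ : ℝ) : ℂ[X] →ₗ[ℂ] ℂ :=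
  -- Prescribing monomials makes the functional linear without any integrability. With the phase
  -- e^{iμφ}, the weight has -it · 2μ/(z - t) as its logarithmic derivative in φ, with no constant
  -- term.
  (basisMonomials ℂ).constr ℂ fun k =>
    cis (μ * φ) * ∫ α in (0 : ℝ)..2 * Real.pi, cis α ^ k * circleWeight n ω₁ ω₂ μ ζ φ α

/-- The exponents of the weight at `0`, `1` and the moving singularity. -/
def exponents (n : ℕ) (ω₁ ω₂ μ : ℝ) : Fin 3 → ℂ :=
  -- The exponent at 0 collects z^{-n}, the Jacobian dα = dz/(iz), z^{-ω₁} and z^{-μ} from the two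
  -- absolute values, and z^{iω₂} from the exponential.
  ![-(n + 1) - ω₁ - μ + Complex.I * ω₂, 2 * ω₁, 2 * μ]

lemma norm_jump_le (ζ : ℂ) (φ α : ℝ) : ‖jump ζ φ α‖ ≤ 1 + ‖ζ‖ := by
  rw [jump]
  split_ifs
  · exact (norm_sub_le _ _).trans (by rw [norm_one])
  · rw [norm_one]; linarith [norm_nonneg ζ]

lemma measurable_jump (ζ : ℂ) (φ : ℝ) : Measurable (jump ζ φ) :=
  Measurable.ite measurableSet_Ioo measurable_const measurable_const

lemma continuous_eval_cis (f : ℂ[X]) : Continuous fun α => f.eval (cis α) :=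
  f.continuous.comp continuous_cis

lemma continuous_smooth_factor (n : ℕ) (ω₂ : ℝ) :
    Continuous fun α => ((Real.exp (ω₂ * (Real.pi - α)) : ℝ) : ℂ) * (cis α)⁻¹ ^ n := by
  refine (Complex.continuous_ofReal.comp (by fun_prop)).mul
    ((continuous_cis.inv₀ fun α => cis_ne_zero α).pow n)

variable {n : ℕ} {ω₁ ω₂ μ : ℝ} {ζ : ℂ} {φ : ℝ}

lemma intervalIntegrable_mul_circleWeight (hω : -(1 / 2) < ω₁) (hμ : -(1 / 2) < μ)
    (hφ : φ ∈ Set.Ioo 0 (2 * Real.pi)) {g : ℝ → ℂ} (hg : Continuous g) :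
    IntervalIntegrable (fun α => g α * circleWeight n ω₁ ω₂ μ ζ φ α) volume 0 (2 * Real.pi) := by
  have h1 : IntervalIntegrable
      (fun α => ((chord 0 α ^ (2 * ω₁) * chord φ α ^ (2 * μ) : ℝ) : ℂ)) volume 0 (2 * Real.pi) := by
    have h0 := intervalIntegrable_chord_mul_chord hφ (by linarith : -1 < 2 * ω₁)
      (by linarith : -1 < 2 * μ)
    rw [intervalIntegrable_iff] at h0 ⊢
    exact h0.ofReal
  have h2 := h1.continuousOn_mul (hg.mul (continuous_smooth_factor n ω₂)).continuousOn
  have h3 : IntervalIntegrable (fun α => (g α * (((Real.exp (ω₂ * (Real.pi - α)) : ℝ) : ℂ)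
      * (cis α)⁻¹ ^ n) * ((chord 0 α ^ (2 * ω₁) * chord φ α ^ (2 * μ) : ℝ) : ℂ)) * jump ζ φ α)
      volume 0 (2 * Real.pi) := by
    rw [intervalIntegrable_iff] at h2 ⊢
    exact h2.mul_bdd (measurable_jump ζ φ).aestronglyMeasurable
      (Filter.Eventually.of_forall fun α => norm_jump_le ζ φ α)
  refine h3.congr fun α _ => ?_
  simp only [circleWeight, fixedWeight]
  push_cast
  ring

lemma momentFunctional_apply (hω : -(1 / 2) < ω₁) (hμ : -(1 / 2) < μ)
    (hφ : φ ∈ Set.Ioo 0 (2 * Real.pi)) (f : ℂ[X]) :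
    momentFunctional n ω₁ ω₂ μ ζ φ f = cis (μ * φ) *
      ∫ α in (0 : ℝ)..2 * Real.pi, f.eval (cis α) * circleWeight n ω₁ ω₂ μ ζ φ α := by
  induction f using Polynomial.induction_on' with
  | add p q hp hq =>
    rw [map_add, hp, hq, ← mul_add, ← intervalIntegral.integral_add
      (intervalIntegrable_mul_circleWeight hω hμ hφ (continuous_eval_cis p))
      (intervalIntegrable_mul_circleWeight hω hμ hφ (continuous_eval_cis q))]
    simp only [eval_add, add_mul]
  | monomial k a =>
    have h := (basisMonomials ℂ).constr_basis ℂ (fun k => cis (μ * φ) *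
      ∫ α in (0 : ℝ)..2 * Real.pi, cis α ^ k * circleWeight n ω₁ ω₂ μ ζ φ α) k
    rw [coe_basisMonomials] at h
    have e : monomial k a = a • monomial k (1 : ℂ) := by rw [smul_monomial, smul_eq_mul, mul_one]
    rw [e, map_smul, momentFunctional, h, smul_eq_mul, mul_left_comm,
      ← intervalIntegral.integral_const_mul]
    simp only [eval_smul, eval_monomial, one_mul, smul_eq_mul, mul_assoc]

/-- The polynomial `∑ (c_i + 1) σ / (x - x_i)` of the Pearson equation. -/
def pearsonPoly (c : Fin 3 → ℂ) (t : ℂ) : ℂ[X] :=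
  C (c 0 + 1) * ((X - 1) * (X - C t)) + C (c 1 + 1) * (X * (X - C t)) + C (c 2 + 1) * (X * (X - 1))

/-- The primitive of the Pearson equation. -/
def pearsonPrimitive (n : ℕ) (ω₁ ω₂ μ : ℝ) (φ : ℝ) (f : ℂ[X]) (α : ℝ) : ℂ :=
  f.eval (cis α) * (((Real.exp (ω₂ * (Real.pi - α)) : ℝ) : ℂ) * (cis α)⁻¹ ^ n)
    * (((chord 0 α ^ (2 * ω₁) : ℝ) : ℂ) * (cis α - cis 0))
    * (((chord φ α ^ (2 * μ) : ℝ) : ℂ) * (cis α - cis φ))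

lemma continuous_pearsonPrimitive (hω : -(1 / 2) < ω₁) (hμ : -(1 / 2) < μ) (f : ℂ[X]) :
    Continuous (pearsonPrimitive n ω₁ ω₂ μ φ f) :=
  (((continuous_eval_cis f).mul (continuous_smooth_factor n ω₂)).mul
    (continuous_chord_rpow_mul 0 (by linarith))).mul (continuous_chord_rpow_mul φ (by linarith))

lemma hasDerivAt_eval_cis (f : ℂ[X]) (α : ℝ) :
    HasDerivAt (fun α => f.eval (cis α)) ((derivative f).eval (cis α) * (Complex.I * cis α)) α :=
  (f.hasDerivAt (cis α)).comp α (hasDerivAt_cis α)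

lemma hasDerivAt_smooth_factor (n : ℕ) (ω₂ α : ℝ) :
    HasDerivAt (fun α => ((Real.exp (ω₂ * (Real.pi - α)) : ℝ) : ℂ) * (cis α)⁻¹ ^ n)
      (-(ω₂ + n * Complex.I) * (((Real.exp (ω₂ * (Real.pi - α)) : ℝ) : ℂ) * (cis α)⁻¹ ^ n)) α := by
  have h1 : HasDerivAt (fun α => ((Real.exp (ω₂ * (Real.pi - α)) : ℝ) : ℂ))
      ((Real.exp (ω₂ * (Real.pi - α)) * (ω₂ * -1) : ℝ) : ℂ) α :=
    ((((hasDerivAt_id α).const_sub Real.pi).const_mul ω₂).exp).ofReal_comp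
  have h2 : ∀ α, (cis α)⁻¹ ^ n = cis (-(n * α)) := by
    intro α
    rw [cis, cis, ← Complex.exp_neg, ← Complex.exp_nat_mul]
    push_cast
    ring_nf
  have h3 : HasDerivAt (fun α => (cis α)⁻¹ ^ n) (-(n * Complex.I) * (cis α)⁻¹ ^ n) α := by
    simp only [h2]
    have h4 : HasDerivAt (fun α : ℝ => -((n : ℝ) * α)) (-((n : ℝ) * 1)) α :=
      ((hasDerivAt_id α).const_mul (n : ℝ)).neg
    have h5 := (hasDerivAt_cis (-(n * α))).scomp α h4
    refine h5.congr_deriv ?_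
    rw [Complex.real_smul]
    push_cast
    ring
  refine (h1.mul h3).congr_deriv ?_
  push_cast
  ring

/-- The factors z - 1 and z - t of the primitive clear the poles of the logarithmic derivative of
the weight; the factor z comes from d/dα = iz d/dz. -/
lemma hasDerivAt_pearsonPrimitive {α : ℝ} (h0 : chord 0 α ≠ 0) (hα : chord φ α ≠ 0) (f : ℂ[X]) :
    HasDerivAt (pearsonPrimitive n ω₁ ω₂ μ φ f)
      (Complex.I * (X * (X - 1) * (X - C (cis φ)) * derivative f
        + pearsonPoly (exponents n ω₁ ω₂ μ) (cis φ) * f).eval (cis α)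
        * (fixedWeight n ω₁ ω₂ α * ((chord φ α ^ (2 * μ) : ℝ) : ℂ))) α := by
  have s0 : cis α - 1 ≠ 0 := sub_ne_zero.2 (by rw [← cis_zero]; exact chord_ne_zero_iff.1 h0)
  have s1 : cis α - cis φ ≠ 0 := sub_ne_zero.2 (chord_ne_zero_iff.1 hα)
  have hc := fun a => (hasDerivAt_cis α).sub_const (cis a)
  refine ((((hasDerivAt_eval_cis f α).mul (hasDerivAt_smooth_factor n ω₂ α)).mul
    ((hasDerivAt_chord_rpow (2 * ω₁) h0).mul (hc 0))).mul
    ((hasDerivAt_chord_rpow (2 * μ) hα).mul (hc φ))).congr_deriv ?_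
  simp only [Pi.mul_apply, fixedWeight, pearsonPoly, exponents, eval_add, eval_mul, eval_sub,
    eval_X, eval_C, eval_one, Matrix.cons_val, cis_zero]
  generalize ((chord φ α ^ (2 * μ) : ℝ) : ℂ) = u
  generalize ((chord 0 α ^ (2 * ω₁) : ℝ) : ℂ) = v
  generalize ((Real.exp (ω₂ * (Real.pi - α)) : ℝ) : ℂ) = w
  generalize (cis α)⁻¹ ^ n = r
  generalize cis α = x at *
  generalize cis φ = t at *
  push_cast
  field_simp
  ring_nf
  simp only [Complex.I_sq]
  ring

/-- Between consecutive singular points the jump factor is constant. The primitive is continuous and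
vanishes at both ends because the exponents 2ω₁ and 2μ exceed -1, so the jump leaves no boundary
term. -/
lemma integral_pearson_aux (hω : -(1 / 2) < ω₁) (hμ : -(1 / 2) < μ) (f : ℂ[X]) {a b : ℝ}
    (hab : a ≤ b) (h0 : ∀ α ∈ Set.Ioo a b, chord 0 α ≠ 0 ∧ chord φ α ≠ 0)
    (ha : chord 0 a = 0 ∨ chord φ a = 0) (hb : chord 0 b = 0 ∨ chord φ b = 0) (ε : ℂ)
    (hjump : ∀ α ∈ Set.Ioo a b, jump ζ φ α = ε)
    (hint : IntervalIntegrable (fun α => (X * (X - 1) * (X - C (cis φ)) * derivative f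
        + pearsonPoly (exponents n ω₁ ω₂ μ) (cis φ) * f).eval (cis α)
        * circleWeight n ω₁ ω₂ μ ζ φ α) volume a b) :
    ∫ α in a..b, (X * (X - 1) * (X - C (cis φ)) * derivative f
        + pearsonPoly (exponents n ω₁ ω₂ μ) (cis φ) * f).eval (cis α)
        * circleWeight n ω₁ ω₂ μ ζ φ α = 0 := by
  have hz : ∀ α, chord 0 α = 0 ∨ chord φ α = 0 → pearsonPrimitive n ω₁ ω₂ μ φ f α = 0 := by
    intro α hα
    simp only [chord, norm_eq_zero, sub_eq_zero] at hα
    rw [pearsonPrimitive]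
    rcases hα with h | h <;> rw [h] <;> simp
  have h := intervalIntegral.integral_eq_sub_of_hasDerivAt_of_le hab
    (f := fun α => -Complex.I * ε * pearsonPrimitive n ω₁ ω₂ μ φ f α)
    ((continuous_const.mul (continuous_pearsonPrimitive hω hμ f)).continuousOn)
    (fun α hα => by
      refine ((hasDerivAt_pearsonPrimitive (h0 α hα).1 (h0 α hα).2 f).const_mul
        (-Complex.I * ε)).congr_deriv ?_
      rw [circleWeight, hjump α hα]
      linear_combination (-ε * eval (cis α) (X * (X - 1) * (X - C (cis φ)) * derivative f
        + pearsonPoly (exponents n ω₁ ω₂ μ) (cis φ) * f)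
        * (fixedWeight n ω₁ ω₂ α * ((chord φ α ^ (2 * μ) : ℝ) : ℂ))) * Complex.I_sq) hint
  rw [h, hz a ha, hz b hb, sub_self]

/-- The Pearson equation of the weight, in integrated form. -/
lemma momentFunctional_pearson (hω : -(1 / 2) < ω₁) (hμ : -(1 / 2) < μ)
    (hφ : φ ∈ Set.Ioo 0 (2 * Real.pi)) (f : ℂ[X]) :
    momentFunctional n ω₁ ω₂ μ ζ φ (X * (X - 1) * (X - C (cis φ)) * derivative f
        + pearsonPoly (exponents n ω₁ ω₂ μ) (cis φ) * f) = 0 := by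
  have hint := intervalIntegrable_mul_circleWeight (n := n) (ω₂ := ω₂) (ζ := ζ) hω hμ hφ
    (continuous_eval_cis (X * (X - 1) * (X - C (cis φ)) * derivative f
        + pearsonPoly (exponents n ω₁ ω₂ μ) (cis φ) * f))
  have hφ' : φ ∈ Set.uIcc 0 (2 * Real.pi) := by
    rw [Set.uIcc_of_le (hφ.1.trans hφ.2).le]; exact ⟨hφ.1.le, hφ.2.le⟩
  have i1 := hint.mono_set (Set.uIcc_subset_uIcc_left hφ')
  have i2 := hint.mono_set (Set.uIcc_subset_uIcc_right hφ')
  have z0 : chord 0 0 = 0 := by simp [chord]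
  have zφ : chord φ φ = 0 := by simp [chord]
  have z2 : chord 0 (2 * Real.pi) = 0 := by simp [chord, cis_two_pi, cis_zero]
  have nz : ∀ α ∈ Set.Ioo 0 (2 * Real.pi), α ≠ φ → chord 0 α ≠ 0 ∧ chord φ α ≠ 0 := by
    intro α hα hne
    refine ⟨chord_ne_zero hα.1.ne' ?_, chord_ne_zero hne ?_⟩ <;> rw [abs_lt] <;>
      constructor <;> linarith [hα.1, hα.2, hφ.1, hφ.2]
  rw [momentFunctional_apply hω hμ hφ, ← intervalIntegral.integral_add_adjacent_intervals i1 i2,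
    integral_pearson_aux hω hμ f hφ.1.le _ (Or.inl z0) (Or.inr zφ) (1 - ζ) _ i1,
    integral_pearson_aux hω hμ f hφ.2.le _ (Or.inr zφ) (Or.inl z2) 1 _ i2, add_zero, mul_zero]
  · exact fun α hα => nz α ⟨hφ.1.trans hα.1, hα.2⟩ hα.1.ne'
  · exact fun α hα => if_neg fun h => hα.1.le.not_gt h.2
  · exact fun α hα => nz α ⟨hα.1, hα.2.trans hφ.2⟩ hα.2.ne
  · exact fun α hα => if_pos hα

end CircularJacobi

end

/-! ### Differentiation under the integral in the position of the moving singularity. -/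

noncomputable section

namespace CircularJacobi

open Polynomial MeasureTheory

section MovingSingularity

variable {n : ℕ} {ω₁ ω₂ μ : ℝ} {ζ : ℂ} {φ : ℝ}

/-- The factor of the integrand which depends on the moving singularity. -/
def movingFactor (μ : ℝ) (ζ : ℂ) (α s : ℝ) : ℂ :=
  cis (μ * s) * (((chord α s ^ (2 * μ) : ℝ) : ℂ) * (cis s - cis α)) * (cis s - cis α) * jump ζ s α

/-- The derivative of `movingFactor`. -/
def movingFactorDeriv (μ : ℝ) (ζ : ℂ) (α s : ℝ) : ℂ :=
  2 * Complex.I * (1 + μ) * cis s * cis (μ * s)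
    * (((chord α s ^ (2 * μ) : ℝ) : ℂ) * (cis s - cis α)) * jump ζ s α

lemma hasDerivAt_cis_mul (μ s : ℝ) :
    HasDerivAt (fun s => cis (μ * s)) (Complex.I * μ * cis (μ * s)) s := by
  have h4 : HasDerivAt (fun s : ℝ => μ * s) (μ * 1) s := (hasDerivAt_id s).const_mul μ
  refine ((hasDerivAt_cis (μ * s)).scomp s h4).congr_deriv ?_
  rw [Complex.real_smul]
  push_cast
  ring

lemma norm_chord_rpow_mul (a α : ℝ) {p : ℝ} (hp : -1 < p) :
    ‖((chord a α ^ p : ℝ) : ℂ) * (cis α - cis a)‖ = chord a α ^ (p + 1) := by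
  rw [norm_mul, Complex.norm_real, Real.norm_of_nonneg (Real.rpow_nonneg (chord_nonneg _ _) _),
    norm_sub_rev, ← chord, Real.rpow_add_one' (chord_nonneg _ _) (by linarith)]

/-- The jump factor changes only at s = α. There the function is a factor tending to 0 times one
that is O(s - α), so the derivative exists and is 0. -/
lemma hasDerivAt_movingFactor (hμ : -(1 / 2) < μ) {α s : ℝ} (h : |s - α| < 2 * Real.pi) :
    HasDerivAt (movingFactor μ ζ α) (movingFactorDeriv μ ζ α s) s := by
  rcases eq_or_ne s α with rfl | hne
  · have e : movingFactorDeriv μ ζ s s = 0 := by simp [movingFactorDeriv]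
    rw [e, hasDerivAt_iff_isLittleO]
    have e2 : ∀ x, movingFactor μ ζ s x - movingFactor μ ζ s s - (x - s) • (0 : ℂ)
        = (((chord s x ^ (2 * μ) : ℝ) : ℂ) * (cis x - cis s))
          * (cis (μ * x) * (cis x - cis s) * jump ζ x s) := by
      intro x; simp only [movingFactor, sub_self, mul_zero, zero_mul, smul_zero]; ring
    simp only [e2]
    have h1 : (fun x => ((chord s x ^ (2 * μ) : ℝ) : ℂ) * (cis x - cis s)) =o[nhds s]
        fun _ => (1 : ℝ) := by
      rw [Asymptotics.isLittleO_one_iff]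
      have := (continuous_chord_rpow_mul s (by linarith : -1 < 2 * μ)).tendsto s
      rwa [sub_self, mul_zero] at this
    have h2 : (fun x => cis (μ * x) * (cis x - cis s) * jump ζ x s) =O[nhds s]
        fun x => x - s := by
      refine Asymptotics.IsBigO.of_bound (1 + ‖ζ‖) (Filter.Eventually.of_forall fun x => ?_)
      rw [norm_mul, norm_mul, norm_cis, one_mul, mul_comm, norm_sub_rev, ← chord, chord_comm,
        chord_comm]
      refine mul_le_mul (norm_jump_le _ _ _) ?_ (chord_nonneg _ _) (by positivity)
      exact chord_le_abs _ _
    simpa using h1.mul_isBigO h2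
  · have hc : chord α s ≠ 0 := chord_ne_zero hne h
    have hev : (fun x => jump ζ x α) =ᶠ[nhds s] fun _ => jump ζ s α := by
      rcases lt_or_gt_of_ne hne with hlt | hlt
      · filter_upwards [eventually_lt_nhds hlt] with x hx
        simp only [jump, hx.not_gt, hlt.not_gt, and_false]
      · filter_upwards [eventually_gt_nhds hlt] with x hx
        simp only [jump, show α < x from hx, show α < s from hlt, and_true]
    have hj : HasDerivAt (fun x => jump ζ x α) 0 s := (hasDerivAt_const s _).congr_of_eventuallyEq hev
    have hs := (hasDerivAt_cis s).sub_const (cis α)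
    refine ((((hasDerivAt_cis_mul μ s).mul ((hasDerivAt_chord_rpow (2 * μ) hc).mul hs)).mul
      hs).mul hj).congr_deriv ?_
    have hsub : cis s - cis α ≠ 0 := sub_ne_zero.2 (chord_ne_zero_iff.1 hc)
    simp only [movingFactorDeriv, Pi.mul_apply]
    push_cast
    field_simp
    ring

lemma norm_movingFactorDeriv_le (hμ : -(1 / 2) < μ) (α s : ℝ) :
    ‖movingFactorDeriv μ ζ α s‖ ≤ 2 * (1 + |μ|) * 2 ^ (2 * μ + 1) * (1 + ‖ζ‖) := by
  rw [movingFactorDeriv, norm_mul, norm_mul, norm_mul, norm_mul, norm_mul, norm_mul, norm_cis,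
    norm_cis, mul_one, mul_one, norm_chord_rpow_mul _ _ (by linarith : -1 < 2 * μ),
    Complex.norm_I, mul_one, Complex.norm_ofNat]
  have h1 : ‖(1 + μ : ℂ)‖ ≤ 1 + |μ| := by
    refine (norm_add_le _ _).trans ?_
    rw [norm_one, Complex.norm_real, Real.norm_eq_abs]
  have h2 : chord α s ^ (2 * μ + 1) ≤ 2 ^ (2 * μ + 1) :=
    Real.rpow_le_rpow (chord_nonneg _ _) (chord_le_two _ _) (by linarith)
  have h3 := norm_jump_le ζ s α
  have h4 : 0 ≤ chord α s ^ (2 * μ + 1) := Real.rpow_nonneg (chord_nonneg _ _) _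
  gcongr

lemma intervalIntegrable_mul_fixedWeight (hω : -(1 / 2) < ω₁) {g : ℝ → ℂ} (hg : Continuous g) :
    IntervalIntegrable (fun α => g α * fixedWeight n ω₁ ω₂ α) volume 0 (2 * Real.pi) := by
  have h := intervalIntegrable_mul_circleWeight (n := n) (ω₂ := ω₂) (ζ := 0) (μ := 0)
    (φ := Real.pi) hω (by norm_num) ⟨Real.pi_pos, by linarith [Real.pi_pos]⟩ hg
  refine h.congr fun α _ => ?_
  simp [circleWeight, jump]

lemma aestronglyMeasurable_movingFactor (hμ : -(1 / 2) < μ) (s : ℝ) (ν : Measure ℝ) :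
    AEStronglyMeasurable (fun α => movingFactor μ ζ α s) ν := by
  have h : Continuous fun α => ((chord α s ^ (2 * μ) : ℝ) : ℂ) * (cis s - cis α) := by
    have := (continuous_chord_rpow_mul s (by linarith : -1 < 2 * μ)).neg
    convert! this using 2 with α
    rw [chord_comm, Pi.neg_apply, ← mul_neg, neg_sub]
  exact (((continuous_const.mul h).mul
    (continuous_const.sub continuous_cis)).aestronglyMeasurable).mul
    (measurable_jump ζ s).aestronglyMeasurable

lemma aestronglyMeasurable_movingFactorDeriv (hμ : -(1 / 2) < μ) (s : ℝ) (ν : Measure ℝ) :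
    AEStronglyMeasurable (fun α => movingFactorDeriv μ ζ α s) ν := by
  have h : Continuous fun α => ((chord α s ^ (2 * μ) : ℝ) : ℂ) * (cis s - cis α) := by
    have := (continuous_chord_rpow_mul s (by linarith : -1 < 2 * μ)).neg
    convert! this using 2 with α
    rw [chord_comm, Pi.neg_apply, ← mul_neg, neg_sub]
  exact ((continuous_const.mul h).aestronglyMeasurable).mul
    (measurable_jump ζ s).aestronglyMeasurable

lemma map_sq_mul_eq (hω : -(1 / 2) < ω₁) (hμ : -(1 / 2) < μ)
    (hφ : φ ∈ Set.Ioo 0 (2 * Real.pi)) (g : ℂ[X]) :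
    momentFunctional n ω₁ ω₂ μ ζ φ ((X - C (cis φ)) ^ 2 * g)
      = ∫ α in (0 : ℝ)..2 * Real.pi, g.eval (cis α) * fixedWeight n ω₁ ω₂ α
        * movingFactor μ ζ α φ := by
  rw [momentFunctional_apply hω hμ hφ, ← intervalIntegral.integral_const_mul]
  congr 1
  funext α
  simp only [eval_mul, eval_pow, eval_sub, eval_X, eval_C, circleWeight, movingFactor]
  rw [chord_comm]
  ring

/-- The derivative of moments with a double zero at the moving singularity. -/
lemma hasDerivAt_map_sq_mul (hω : -(1 / 2) < ω₁) (hμ : -(1 / 2) < μ)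
    (hφ : φ ∈ Set.Ioo 0 (2 * Real.pi)) (g : ℂ[X]) :
    HasDerivAt (fun s => momentFunctional n ω₁ ω₂ μ ζ s ((X - C (cis s)) ^ 2 * g))
      (-(exponents n ω₁ ω₂ μ 2 + 2) * (Complex.I * cis φ)
        * momentFunctional n ω₁ ω₂ μ ζ φ ((X - C (cis φ)) * g)) φ := by
  have hnhds : Set.Ioo 0 (2 * Real.pi) ∈ nhds φ := isOpen_Ioo.mem_nhds hφ
  have hgm : AEStronglyMeasurable (fun α => g.eval (cis α) * fixedWeight n ω₁ ω₂ α)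
      (volume.restrict (Set.uIoc 0 (2 * Real.pi))) := by
    have := intervalIntegrable_mul_fixedWeight (n := n) (ω₂ := ω₂) hω (continuous_eval_cis g)
    rw [intervalIntegrable_iff] at this
    exact this.aestronglyMeasurable
  have hF_int : IntervalIntegrable (fun α => g.eval (cis α) * fixedWeight n ω₁ ω₂ α
      * movingFactor μ ζ α φ) volume 0 (2 * Real.pi) := by
    have h := intervalIntegrable_mul_circleWeight (n := n) (ω₂ := ω₂) (ζ := ζ) hω hμ hφ
      (g := fun α => cis (μ * φ) * ((cis φ - cis α) ^ 2 * g.eval (cis α)))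
      (continuous_const.mul (((continuous_const.sub continuous_cis).pow 2).mul
        (continuous_eval_cis g)))
    refine h.congr fun α _ => ?_
    simp only [circleWeight, movingFactor]
    rw [chord_comm]
    ring
  -- The double zero leaves the exponent 2μ + 1 > 0 after differentiation, so the derivative is
  -- bounded uniformly in s. The bare weight would leave the exponent 2μ - 1, which need not be
  -- integrable.
  have key := (intervalIntegral.hasDerivAt_integral_of_dominated_loc_of_deriv_le
    (F := fun s α => g.eval (cis α) * fixedWeight n ω₁ ω₂ α * movingFactor μ ζ α s)
    (F' := fun s α => g.eval (cis α) * fixedWeight n ω₁ ω₂ α * movingFactorDeriv μ ζ α s)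
    (bound := fun α => ‖g.eval (cis α) * fixedWeight n ω₁ ω₂ α‖
      * (2 * (1 + |μ|) * 2 ^ (2 * μ + 1) * (1 + ‖ζ‖)))
    (μ := volume) (a := 0) (b := 2 * Real.pi) hnhds
    (Filter.Eventually.of_forall fun s => hgm.mul (aestronglyMeasurable_movingFactor hμ s _))
    hF_int (hgm.mul (aestronglyMeasurable_movingFactorDeriv hμ φ _))
    (Filter.Eventually.of_forall fun α _ s _ => by
      rw [norm_mul]
      exact mul_le_mul_of_nonneg_left (norm_movingFactorDeriv_le hμ α s) (norm_nonneg _))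
    ((intervalIntegrable_mul_fixedWeight hω (continuous_eval_cis g)).norm.mul_const _)
    (Filter.Eventually.of_forall fun α hα s hs => by
      refine (hasDerivAt_movingFactor hμ ?_).const_mul _
      rw [Set.uIoc_of_le (by positivity)] at hα
      rw [abs_lt]
      constructor <;> linarith [hα.1, hα.2, hs.1, hs.2])).2
  have hev : (fun s => momentFunctional n ω₁ ω₂ μ ζ s ((X - C (cis s)) ^ 2 * g)) =ᶠ[nhds φ]
      fun s => ∫ α in (0 : ℝ)..2 * Real.pi, g.eval (cis α) * fixedWeight n ω₁ ω₂ α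
        * movingFactor μ ζ α s := by
    filter_upwards [hnhds] with s hs using map_sq_mul_eq hω hμ hs g
  refine (key.congr_of_eventuallyEq hev).congr_deriv ?_
  rw [momentFunctional_apply hω hμ hφ, ← mul_assoc, ← intervalIntegral.integral_const_mul]
  congr 1
  funext α
  simp only [eval_mul, eval_sub, eval_X, eval_C, circleWeight, movingFactorDeriv, exponents,
    Matrix.cons_val]
  rw [chord_comm]
  ring

end MovingSingularity

end CircularJacobi

end

/-! ### From the Pearson equation to semiclassical functionals and the evolution of all moments. -/

noncomputable section

namespace CircularJacobi

open Polynomial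

/-- The functional `f ↦ -a L((s f)' + r f)`. -/
def insertionMap (a : ℂ) (s r : ℂ[X]) (L : ℂ[X] →ₗ[ℂ] ℂ) : ℂ[X] →ₗ[ℂ] ℂ :=
  (-a) • (L ∘ₗ (derivative ∘ₗ LinearMap.mulLeft ℂ s + LinearMap.mulLeft ℂ r))

lemma insertionMap_apply (a : ℂ) (s r : ℂ[X]) (L : ℂ[X] →ₗ[ℂ] ℂ) (f : ℂ[X]) :
    insertionMap a s r L f = -a * L (derivative (s * f) + r * f) := rfl

/-- The insertions of the poles `0, 1, t` expressed by moments. -/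
def insertions (c : Fin 3 → ℂ) (t : ℂ) (L : ℂ[X] →ₗ[ℂ] ℂ) : Fin 3 → ℂ[X] →ₗ[ℂ] ℂ :=
  -- Each insertion is an integration by parts against the product of the two other linear factors,
  -- divided by the value of that product at the pole.
  ![insertionMap t⁻¹ ((X - 1) * (X - C t))
      (C (c 1) * (X - C t) + C (c 2) * (X - 1) + C (c 0) * (X - 1 - C t)) L,
    insertionMap (1 - t)⁻¹ (X * (X - C t))
      (C (c 0) * (X - C t) + C (c 2) * X + C (c 1) * (X + 1 - C t)) L,
    insertionMap (t * (t - 1))⁻¹ (X * (X - 1))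
      (C (c 0) * (X - 1) + C (c 1) * X + C (c 2) * (X + C (t - 1))) L]

section Pearson

variable {c : Fin 3 → ℂ} {t : ℂ} {L : ℂ[X] →ₗ[ℂ] ℂ}

lemma isSemiclassical_of_pearson (h0 : t ≠ 0) (h1 : t ≠ 1)
    (hp : ∀ f, L (X * (X - 1) * (X - C t) * derivative f + pearsonPoly c t * f) = 0) :
    IsSemiclassical t c L (insertions c t L) where
  insert_mul i f := by
    have h1' : t - 1 ≠ 0 := sub_ne_zero.2 h1
    have h1'' : 1 - t ≠ 0 := sub_ne_zero.2 h1.symm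
    have e : ∀ (x a : ℂ) (s r : ℂ[X]), a ≠ 0 → derivative (s * ((X - C x) * f)) + r * ((X - C x) * f)
        = (X * (X - 1) * (X - C t) * derivative f + pearsonPoly c t * f) - C (c i * a) * f →
        insertionMap a⁻¹ s r L ((X - C x) * f) = c i * L f := by
      intro x a s r ha h
      rw [insertionMap_apply, h, map_sub, hp, map_C_mul]
      field_simp
      ring
    fin_cases i
    · refine e 0 t _ _ h0 ?_
      simp only [pearsonPoly, derivative_mul, derivative_sub, derivative_X, derivative_one,
        derivative_C, derivative_zero, C_0, C_mul, C_add, C_1, Fin.mk_zero, Fin.isValue]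
      ring
    · refine e 1 (1 - t) _ _ h1'' ?_
      simp only [pearsonPoly, derivative_mul, derivative_sub, derivative_X, derivative_one,
        derivative_C, C_mul, C_add, C_1, C_sub, Fin.mk_one, Fin.isValue]
      ring
    · refine e t (t * (t - 1)) _ _ (mul_ne_zero h0 h1') ?_
      simp only [pearsonPoly, derivative_mul, derivative_sub, derivative_X, derivative_one,
        derivative_C, C_mul, C_add, C_1, C_sub, Fin.reduceFinMk, Fin.isValue]
      ring
  map_derivative f := by
    have h1' : t - 1 ≠ 0 := sub_ne_zero.2 h1
    have h1'' : 1 - t ≠ 0 := sub_ne_zero.2 h1.symm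
    -- Lagrange interpolation of the constant 1: t(t-1) = (t-1)(X-1)(X-t) - tX(X-t) + X(X-1).
    have e : C (t * (t - 1)) * derivative f
        = C (t - 1) * (derivative ((X - 1) * (X - C t) * f)
          + (C (c 1) * (X - C t) + C (c 2) * (X - 1) + C (c 0) * (X - 1 - C t)) * f)
        - C t * (derivative (X * (X - C t) * f)
          + (C (c 0) * (X - C t) + C (c 2) * X + C (c 1) * (X + 1 - C t)) * f)
        + (derivative (X * (X - 1) * f)
          + (C (c 0) * (X - 1) + C (c 1) * X + C (c 2) * (X + C (t - 1))) * f) := by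
      simp only [derivative_mul, derivative_sub, derivative_X, derivative_one, derivative_C,
        C_mul, C_1, C_sub]
      ring
    have h := congrArg L e
    rw [map_add, map_sub, map_C_mul, map_C_mul, map_C_mul] at h
    have e2 : L (derivative f) = (t * (t - 1))⁻¹ * (t * (t - 1) * L (derivative f)) := by
      field_simp
    rw [e2, h, Fin.sum_univ_three]
    simp only [insertions, Matrix.cons_val, insertionMap_apply]
    rw [← neg_sub t 1]
    field_simp
    ring

/-- The coefficient of `y` in the expansion of `pearsonPoly` in powers of `y = x - t`. -/
def pearsonCoeff (c : Fin 3 → ℂ) (t : ℂ) : ℂ :=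
  (c 0 + 1) * (t - 1) + (c 1 + 1) * t + (c 2 + 1) * (2 * t - 1)

lemma pearsonPoly_eq (c : Fin 3 → ℂ) (t : ℂ) :
    pearsonPoly c t = C ((c 2 + 1) * (t * (t - 1))) + C (pearsonCoeff c t) * (X - C t)
      + (X - C t) ^ 2 * C (c 0 + c 1 + c 2 + 3) := by
  simp only [pearsonPoly, pearsonCoeff, C_mul, C_add, C_1, C_sub, map_ofNat]
  ring

lemma pearson_X_sub_C (c : Fin 3 → ℂ) (t : ℂ) :
    X * (X - 1) * (X - C t) * derivative (X - C t) + pearsonPoly c t * (X - C t)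
      = C ((c 2 + 2) * (t * (t - 1))) * (X - C t)
        + (X - C t) ^ 2 * (C (2 * t - 1 + pearsonCoeff c t)
          + C (c 0 + c 1 + c 2 + 4) * (X - C t)) := by
  rw [pearsonPoly_eq]
  simp only [derivative_sub, derivative_X, derivative_C, C_mul, C_add, C_1, C_sub, map_ofNat]
  ring

end Pearson

section Evolution

variable {c : Fin 3 → ℂ} {L : ℝ → ℂ[X] →ₗ[ℂ] ℂ} {φ : ℝ}
  (h1 : ∀ᶠ s in nhds φ, cis s ≠ 1)
  (hp : ∀ᶠ s in nhds φ, ∀ f, L s (X * (X - 1) * (X - C (cis s)) * derivative f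
    + pearsonPoly c (cis s) * f) = 0)
  (hc1 : c 2 + 1 ≠ 0) (hc2 : c 2 + 2 ≠ 0)
  (hd : ∀ g, HasDerivAt (fun s => L s ((X - C (cis s)) ^ 2 * g))
    (-(c 2 + 2) * (Complex.I * cis φ) * L φ ((X - C (cis φ)) * g)) φ)

include h1 hp hc1 hc2 hd

/-- Only moments with a double zero at t are known to be differentiable. The Pearson equation for f
= X - t and then for f = 1 yields L(X - t) and L(1), with the nonzero factors (c_2 + 2) t(t - 1) and
(c_2 + 1) t(t - 1). Higher moments follow by recursion. -/
lemma differentiableAt_moments (f : ℂ[X]) : DifferentiableAt ℝ (fun s => L s f) φ := by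
  have ht : DifferentiableAt ℝ cis φ := (hasDerivAt_cis φ).differentiableAt
  have hB : ∀ g, DifferentiableAt ℝ (fun s => L s ((X - C (cis s)) ^ 2 * g)) φ :=
    fun g => (hd g).differentiableAt
  have ht1 : cis φ * (cis φ - 1) ≠ 0 :=
    mul_ne_zero (cis_ne_zero φ) (sub_ne_zero.2 h1.self_of_nhds)
  have hinv : DifferentiableAt ℝ (fun s => (cis s * (cis s - 1))⁻¹) φ :=
    (ht.mul (ht.sub_const 1)).inv ht1
  have hco : DifferentiableAt ℝ (fun s => pearsonCoeff c (cis s)) φ := by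
    unfold pearsonCoeff
    fun_prop
  have hy : DifferentiableAt ℝ (fun s => L s (X - C (cis s))) φ := by
    have hev : (fun s => L s (X - C (cis s))) =ᶠ[nhds φ] fun s =>
        -(c 2 + 2)⁻¹ * (cis s * (cis s - 1))⁻¹ *
          ((2 * cis s - 1 + pearsonCoeff c (cis s)) * L s ((X - C (cis s)) ^ 2 * 1)
          + (c 0 + c 1 + c 2 + 4) * (L s ((X - C (cis s)) ^ 2 * X)
            - cis s * L s ((X - C (cis s)) ^ 2 * 1))) := by
      filter_upwards [h1, hp] with s hs1 hs
      have h := hs (X - C (cis s))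
      have e : (X - C (cis s)) ^ 2 * (C (2 * cis s - 1 + pearsonCoeff c (cis s))
          + C (c 0 + c 1 + c 2 + 4) * (X - C (cis s)))
          = C (2 * cis s - 1 + pearsonCoeff c (cis s)) * ((X - C (cis s)) ^ 2 * 1)
          + C (c 0 + c 1 + c 2 + 4) * ((X - C (cis s)) ^ 2 * X
            - C (cis s) * ((X - C (cis s)) ^ 2 * 1)) := by ring
      rw [pearson_X_sub_C, map_add, map_C_mul, e, map_add, map_C_mul, map_C_mul,
        map_sub (L s) ((X - C (cis s)) ^ 2 * X), map_C_mul] at h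
      have hs1' := sub_ne_zero.2 hs1
      have hs0 := cis_ne_zero s
      field_simp
      linear_combination h
    refine DifferentiableAt.congr_of_eventuallyEq ?_ hev
    exact ((differentiableAt_const _).mul hinv).mul (((((ht.const_mul 2).sub_const 1).add hco).mul
      (hB 1)).add (((hB X).sub (ht.mul (hB 1))).const_mul _))
  have hone : DifferentiableAt ℝ (fun s => L s 1) φ := by
    have hev : (fun s => L s 1) =ᶠ[nhds φ] fun s =>
        -(c 2 + 1)⁻¹ * (cis s * (cis s - 1))⁻¹ *
          (pearsonCoeff c (cis s) * L s (X - C (cis s))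
          + (c 0 + c 1 + c 2 + 3) * L s ((X - C (cis s)) ^ 2 * 1)) := by
      filter_upwards [h1, hp] with s hs1 hs
      have h := hs 1
      have e : pearsonPoly c (cis s) * 1 = C ((c 2 + 1) * (cis s * (cis s - 1))) * 1
          + (C (pearsonCoeff c (cis s)) * (X - C (cis s))
          + C (c 0 + c 1 + c 2 + 3) * ((X - C (cis s)) ^ 2 * 1)) := by
        rw [pearsonPoly_eq]; ring
      rw [derivative_one, mul_zero, zero_add, e, map_add, map_C_mul, map_add, map_C_mul,
        map_C_mul] at h
      have hs1' := sub_ne_zero.2 hs1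
      have hs0 := cis_ne_zero s
      field_simp
      linear_combination h
    refine DifferentiableAt.congr_of_eventuallyEq ?_ hev
    exact ((differentiableAt_const _).mul hinv).mul ((hco.mul hy).add ((hB 1).const_mul _))
  have hpow : ∀ k : ℕ, DifferentiableAt ℝ (fun s => L s (X ^ k)) φ
      ∧ DifferentiableAt ℝ (fun s => L s (X ^ (k + 1))) φ := by
    intro k
    induction k with
    | zero =>
      refine ⟨by simpa using hone, ?_⟩
      have e : ∀ s, L s (X ^ (0 + 1)) = L s (X - C (cis s)) + cis s * L s 1 := by
        intro s
        rw [← map_C_mul, ← map_add]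
        congr 1
        ring
      simp only [e]
      exact hy.add (ht.mul hone)
    | succ k ih =>
      refine ⟨ih.2, ?_⟩
      have e : ∀ s, L s (X ^ (k + 1 + 1)) = L s ((X - C (cis s)) ^ 2 * X ^ k)
          + 2 * cis s * L s (X ^ (k + 1)) - cis s ^ 2 * L s (X ^ k) := by
        intro s
        rw [← map_C_mul, ← map_C_mul, ← map_add, ← map_sub]
        congr 1
        simp only [C_mul, C_pow, map_ofNat]
        ring
      simp only [e]
      exact ((hB _).add ((ht.const_mul 2).mul ih.2)).sub ((ht.pow 2).mul ih.1)
  have e : ∀ s, L s f = ∑ k ∈ Finset.range (f.natDegree + 1), f.coeff k * L s (X ^ k) :=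
    fun s => HasPolyDerivAt.map_eq_sum _ le_rfl
  simp only [e]
  exact DifferentiableAt.fun_sum fun k _ => (hpow k).1.const_mul _

omit h1 hp hc1 hc2 hd in
lemma hasPolyDerivAt_X_sub_C_cis (φ : ℝ) :
    HasPolyDerivAt 1 (fun s => X - C (cis s)) (-C (Complex.I * cis φ)) φ where
  natDegree_le s := (natDegree_X_sub_C _).le
  natDegree_le' := by rw [natDegree_neg, natDegree_C]; exact zero_le_one
  hasDerivAt_coeff k := by
    simp only [coeff_sub, coeff_neg, coeff_C]
    split_ifs
    · exact (hasDerivAt_cis φ).const_sub _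
    · simpa using hasDerivAt_const φ ((X : ℂ[X]).coeff k)

/-- Moments evolve by the insertion of the moving pole. -/
lemma hasEvolution_of_pearson : HasEvolution c L (fun s => insertions c (cis s) (L s)) φ := by
  have hS : ∀ᶠ s in nhds φ, IsSemiclassical (cis s) c (L s) (insertions c (cis s) (L s)) := by
    filter_upwards [h1, hp] with s hs1 hs
    exact isSemiclassical_of_pearson (cis_ne_zero s) hs1 hs
  refine ⟨h1, hS, ?_⟩
  have S := hS.self_of_nhds
  have hdiff := differentiableAt_moments h1 hp hc1 hc2 hd
  set t := cis φ with ht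
  set l := insertions c t (L φ) with hl
  have ht1 : t * (t - 1) ≠ 0 :=
    mul_ne_zero (cis_ne_zero φ) (sub_ne_zero.2 h1.self_of_nhds)
  obtain ⟨L', hL'⟩ : ∃ L' : ℂ[X] →ₗ[ℂ] ℂ, ∀ f, HasDerivAt (fun s => L s f) (L' f) φ := by
    refine ⟨{ toFun := fun f => deriv (fun s => L s f) φ, map_add' := ?_, map_smul' := ?_ },
      fun f => (hdiff f).hasDerivAt⟩
    · intro f g
      have := (hdiff f).hasDerivAt.add (hdiff g).hasDerivAt
      simp only [map_add]
      exact this.deriv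
    · intro a f
      have := (hdiff f).hasDerivAt.const_mul a
      simp only [map_smul, smul_eq_mul, RingHom.id_apply]
      exact this.deriv
  -- The defect of the evolution law. It vanishes on multiples of (X - t)² and satisfies the Pearson
  -- equation, which forces it to vanish on X - t and on 1, hence everywhere.
  set Λ : ℂ[X] →ₗ[ℂ] ℂ := L' + (Complex.I * t) • l 2 with hΛ
  have hΛ_apply : ∀ f, Λ f = L' f + Complex.I * t * l 2 f := fun f => rfl
  have hsq : ∀ g, Λ ((X - C t) ^ 2 * g) = 0 := by
    intro g
    have hX := hasPolyDerivAt_X_sub_C_cis φ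
    have h := ((hX.mul (hX.mul (HasPolyDerivAt.const g φ)))).hasDerivAt_map hL'
    have e : ∀ s, (X - C (cis s)) ^ 2 * g = (X - C (cis s)) * ((X - C (cis s)) * g) :=
      fun s => by ring
    have h2 := hd g
    simp only [e] at h2
    have h3 := h.unique h2
    have e4 : -C (Complex.I * t) * ((X - C t) * g)
        + (X - C t) * (-C (Complex.I * t) * g + (X - C t) * 0)
        = C (-2 * (Complex.I * t)) * ((X - C t) * g) := by
      rw [neg_mul 2, C_neg, C_mul (a := 2), C_ofNat]
      ring
    rw [← ht, e4, map_C_mul] at h3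
    rw [hΛ_apply, pow_two, mul_assoc, S.insert_two]
    linear_combination h3
  -- Differentiate the Pearson equation in the angle and subtract the integration by parts for X(X -
  -- 1) f.
  have hpear : ∀ f, Λ (X * (X - 1) * (X - C t) * derivative f + pearsonPoly c t * f) = 0 := by
    intro f
    set G : ℂ[X] := X * (X - 1) * derivative f + (C (c 0 + 1) * (X - 1) + C (c 1 + 1) * X) * f
      with hG
    set H : ℂ[X] := C (c 2 + 1) * (X * (X - 1) * f) with hH
    have e : ∀ s, X * (X - 1) * (X - C (cis s)) * derivative f + pearsonPoly c (cis s) * f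
        = (X - C (cis s)) * G + H := fun s => by rw [pearsonPoly, hG, hH]; ring
    have h := ((hasPolyDerivAt_X_sub_C_cis φ).mul (HasPolyDerivAt.const G φ)).hasDerivAt_map hL'
    have h2 := h.add (hL' H)
    have h3 : HasDerivAt (fun s => L s ((X - C (cis s)) * G) + L s H) 0 φ := by
      refine (hasDerivAt_const φ (0 : ℂ)).congr_of_eventuallyEq ?_
      filter_upwards [hp] with s hs
      rw [← map_add, ← e]
      exact hs f
    have h4 := h2.unique h3
    rw [mul_zero, add_zero, neg_mul, map_neg, map_C_mul] at h4
    have h5 := S.map_derivative (X * (X - 1) * f)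
    have e0 : X * (X - 1) * f = X * ((X - 1) * f) := by ring
    have e1 : X * (X - 1) * f = (X - 1) * (X * f) := by ring
    have e2 : derivative (X * (X - 1) * f)
        = G - C (c 0) * ((X - 1) * f) - C (c 1) * (X * f) := by
      rw [hG]
      simp only [derivative_mul, derivative_sub, derivative_X, derivative_one, C_add, C_1]
      ring
    rw [Fin.sum_univ_three, e0, S.insert_zero, ← e0, e1, S.insert_one, ← e1, e2, map_sub, map_sub,
      map_C_mul, map_C_mul] at h5
    rw [ht, e, ← ht, hΛ_apply, map_add, map_add, S.insert_two]
    rw [← ht] at h4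
    have h6 : l 2 H = (c 2 + 1) * l 2 (X * (X - 1) * f) := map_C_mul _ _ _
    rw [h6]
    linear_combination h4 + Complex.I * t * (c 2 + 1) * h5
  have hy : Λ (X - C t) = 0 := by
    have h := hpear (X - C t)
    rw [pearson_X_sub_C, map_add, hsq, add_zero, map_C_mul] at h
    exact (mul_eq_zero.1 h).resolve_left (mul_ne_zero hc2 ht1)
  have hone : Λ 1 = 0 := by
    have h := hpear 1
    rw [derivative_one, mul_zero, zero_add, mul_one, pearsonPoly_eq, map_add, hsq, add_zero,
      map_add, map_C_mul, hy, mul_zero, add_zero, ← mul_one (C _), map_C_mul] at h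
    exact (mul_eq_zero.1 h).resolve_left (mul_ne_zero hc1 ht1)
  intro f
  have hf : Λ f = 0 := by
    obtain ⟨f₁, -, hf₁⟩ := exists_eq_C_add_X_sub_C_mul t (g := f) (Nat.le_succ _)
    obtain ⟨f₂, -, hf₂⟩ := exists_eq_C_add_X_sub_C_mul t (g := f₁) (Nat.le_succ _)
    have e : f = C (f.eval t) * 1 + C (f₁.eval t) * (X - C t) + (X - C t) ^ 2 * f₂ := by
      conv_lhs => rw [hf₁, hf₂]
      ring
    rw [e, map_add, map_add, map_C_mul, map_C_mul, hone, hy, hsq]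
    ring
  refine (hL' f).congr_deriv ?_
  rw [hΛ_apply] at hf
  linear_combination hf

end Evolution

/-- The circular Jacobi moments satisfy the evolution equations. -/
theorem hasEvolution_momentFunctional {n : ℕ} {ω₁ ω₂ μ : ℝ} {ζ : ℂ} {φ : ℝ}
    (hω : -(1 / 2) < ω₁) (hμ : -(1 / 2) < μ) (hφ : φ ∈ Set.Ioo 0 (2 * Real.pi)) :
    HasEvolution (exponents n ω₁ ω₂ μ) (momentFunctional n ω₁ ω₂ μ ζ)
      (fun s => insertions (exponents n ω₁ ω₂ μ) (cis s) (momentFunctional n ω₁ ω₂ μ ζ s)) φ := by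
  have hnhds : Set.Ioo 0 (2 * Real.pi) ∈ nhds φ := isOpen_Ioo.mem_nhds hφ
  have h2 : exponents n ω₁ ω₂ μ 2 = ((2 * μ : ℝ) : ℂ) := by simp [exponents]
  refine hasEvolution_of_pearson ?_ ?_ ?_ ?_ fun g => hasDerivAt_map_sq_mul hω hμ hφ g
  · filter_upwards [hnhds] with s hs
    rw [← cis_zero]
    refine chord_ne_zero_iff.1 (chord_ne_zero hs.1.ne' ?_)
    rw [abs_lt]
    constructor <;> linarith [hs.1, hs.2]
  · filter_upwards [hnhds] with s hs using fun f => momentFunctional_pearson hω hμ hs f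
  · rw [h2]
    exact_mod_cast (by linarith : (2 * μ + 1 : ℝ) ≠ 0)
  · rw [h2]
    exact_mod_cast (by linarith : (2 * μ + 2 : ℝ) ≠ 0)

end CircularJacobi

end

/-! ### The average as a Hankel determinant. -/

noncomputable section

namespace CircularJacobi

open Polynomial MeasureTheory

lemma chord_neg (a α : ℝ) : chord (-a) (-α) = chord a α := by
  rw [chord_eq_abs_sin, chord_eq_abs_sin, ← abs_neg, ← Real.sin_neg]
  congr 3
  ring

lemma chord_const_sub (b a α : ℝ) : chord (b - a) (b - α) = chord a α := by
  rw [chord_eq_abs_sin, chord_eq_abs_sin, ← abs_neg, ← Real.sin_neg]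
  congr 3
  ring

lemma cis_pi : cis Real.pi = -1 := by
  rw [cis, mul_comm, Complex.exp_pi_mul_I]

lemma norm_one_add_cis (α : ℝ) : ‖1 + cis (Real.pi - α)‖ = chord 0 α := by
  rw [sub_eq_add_neg, cis_add, cis_pi, neg_one_mul, ← sub_eq_add_neg, ← cis_zero, ← chord,
    ← chord_neg, neg_neg, neg_zero]

/-- The modulus of a Vandermonde determinant on the unit circle. -/
lemma prod_chord_sq {n : ℕ} (α : Fin (n + 1) → ℝ) :
    ((∏ j, ∏ k ∈ Finset.Ioi j, chord (α j) (α k) ^ 2 : ℝ) : ℂ)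
      = ((Equiv.Perm.sign (Fin.revPerm (n := n + 1)) : ℤ) : ℂ) * (∏ l, (cis (α l))⁻¹ ^ n)
        * (Matrix.vandermonde fun l => cis (α l)).det ^ 2 := by
  have h1 : ((∏ j, ∏ k ∈ Finset.Ioi j, chord (α j) (α k) ^ 2 : ℝ) : ℂ)
      = (Matrix.vandermonde fun l => cis (α l)).det
        * (Matrix.vandermonde fun l => (cis (α l))⁻¹).det := by
    rw [Matrix.det_vandermonde, Matrix.det_vandermonde, ← Finset.prod_mul_distrib]
    push_cast
    refine Finset.prod_congr rfl fun j _ => ?_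
    rw [← Finset.prod_mul_distrib]
    refine Finset.prod_congr rfl fun k _ => ?_
    have hconj : ∀ β, (cis β)⁻¹ = (starRingEnd ℂ) (cis β) := fun β => by
      rw [Complex.inv_def, Complex.normSq_eq_norm_sq, norm_cis]; simp
    rw [hconj, hconj, ← map_sub, Complex.mul_conj, Complex.normSq_eq_norm_sq, chord, norm_sub_rev]
    push_cast
    rfl
  -- z^{-j} = z^{-n} z^{n-j}: the columns are reversed. This is the origin of the sign and of the
  -- factor z^{-n} in the weight.
  have h2 : (Matrix.vandermonde fun l => (cis (α l))⁻¹).det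
      = (∏ l, (cis (α l))⁻¹ ^ n) * (((Equiv.Perm.sign (Fin.revPerm (n := n + 1)) : ℤ) : ℂ)
        * (Matrix.vandermonde fun l => cis (α l)).det) := by
    rw [← Matrix.det_permute', ← Matrix.det_mul_column]
    congr 1
    ext l j
    simp only [Matrix.vandermonde_apply, Matrix.of_apply, Matrix.submatrix_apply, id,
      Fin.revPerm_apply, Fin.val_rev]
    have h0 := cis_ne_zero (α l)
    have hj : (j : ℕ) + (n + 1 - (j + 1)) = n := by omega
    rw [inv_pow, inv_pow, inv_mul_eq_div, inv_eq_one_div, div_eq_div_iff (pow_ne_zero _ h0)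
      (pow_ne_zero _ h0), ← pow_add, one_mul, add_comm, hj]
  rw [h1, h2]
  ring

/-- Andréief's identity for the square of a Vandermonde determinant. -/
lemma integral_prod_mul_vandermonde_sq {n : ℕ} (ν : Measure ℝ) [SigmaFinite ν] (w x : ℝ → ℂ)
    (hint : ∀ k : ℕ, Integrable (fun θ => x θ ^ k * w θ) ν) :
    ∫ θ : Fin (n + 1) → ℝ, (∏ l, w (θ l)) * (Matrix.vandermonde fun l => x (θ l)).det ^ 2
        ∂(Measure.pi fun _ => ν)
      = (n + 1).factorial * (Matrix.of fun j k : Fin (n + 1) =>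
        ∫ θ, x θ ^ ((j : ℕ) + k) * w θ ∂ν).det := by
  have e : ∀ θ : Fin (n + 1) → ℝ,
      (∏ l, w (θ l)) * (Matrix.vandermonde fun l => x (θ l)).det ^ 2
      = ∑ σ : Equiv.Perm (Fin (n + 1)), ∑ τ : Equiv.Perm (Fin (n + 1)),
        (((Equiv.Perm.sign σ : ℤ) : ℂ) * ((Equiv.Perm.sign τ : ℤ) : ℂ))
          * ∏ l, (x (θ l) ^ ((σ l : ℕ) + τ l) * w (θ l)) := by
    intro θ
    rw [← Matrix.det_transpose, pow_two, Matrix.det_apply', Finset.sum_mul_sum, Finset.mul_sum]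
    refine Finset.sum_congr rfl fun σ _ => ?_
    rw [Finset.mul_sum]
    refine Finset.sum_congr rfl fun τ _ => ?_
    simp only [Matrix.transpose_apply, Matrix.vandermonde_apply, pow_add, Finset.prod_mul_distrib]
    ring
  have hi : ∀ σ τ : Equiv.Perm (Fin (n + 1)), Integrable (fun θ : Fin (n + 1) → ℝ =>
      (((Equiv.Perm.sign σ : ℤ) : ℂ) * ((Equiv.Perm.sign τ : ℤ) : ℂ))
          * ∏ l, (x (θ l) ^ ((σ l : ℕ) + τ l) * w (θ l))) (Measure.pi fun _ => ν) :=
    fun σ τ => (Integrable.fintype_prod_dep fun l => hint ((σ l : ℕ) + τ l)).const_mul _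
  simp only [e]
  rw [integral_finsetSum _ fun σ _ => integrable_finsetSum _ fun τ _ => hi σ τ]
  -- For fixed σ the sum over τ is the moment determinant with permuted rows; its sign cancels that
  -- of σ, so all (n + 1)! terms agree.
  have e2 : ∀ σ : Equiv.Perm (Fin (n + 1)), ∫ θ : Fin (n + 1) → ℝ,
      ∑ τ : Equiv.Perm (Fin (n + 1)),
        (((Equiv.Perm.sign σ : ℤ) : ℂ) * ((Equiv.Perm.sign τ : ℤ) : ℂ))
          * ∏ l, (x (θ l) ^ ((σ l : ℕ) + τ l) * w (θ l)) ∂(Measure.pi fun _ => ν)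
      = (Matrix.of fun j k : Fin (n + 1) => ∫ θ, x θ ^ ((j : ℕ) + k) * w θ ∂ν).det := by
    intro σ
    set H : Matrix (Fin (n + 1)) (Fin (n + 1)) ℂ :=
      Matrix.of fun j k => ∫ θ, x θ ^ ((j : ℕ) + k) * w θ ∂ν with hH
    rw [integral_finsetSum _ fun τ _ => hi σ τ]
    have h3 := Matrix.det_permute σ H
    rw [← Matrix.det_transpose, Matrix.det_apply'] at h3
    have h4 : ((Equiv.Perm.sign σ : ℤ) : ℂ) * ((Equiv.Perm.sign σ : ℤ) : ℂ) = 1 := by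
      rw [← Int.cast_mul, ← Units.val_mul, Int.units_mul_self]; simp
    rw [← one_mul H.det, ← h4, mul_assoc, ← h3, Finset.mul_sum]
    refine Finset.sum_congr rfl fun τ _ => ?_
    rw [integral_const_mul, integral_fintype_prod_eq_prod
      (fun (l : Fin (n + 1)) θ => x θ ^ ((σ l : ℕ) + τ l) * w θ), mul_assoc]
    rfl
  rw [Finset.sum_congr rfl fun σ _ => e2 σ, Finset.sum_const, Finset.card_univ,
    Fintype.card_perm, Fintype.card_fin, nsmul_eq_mul]

section Average

variable {n : ℕ} {ω₁ ω₂ μ : ℝ} {ξ : ℂ} {φ : ℝ}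

/-- In the angle α = π - θ the fixed singularity z = -1 sits at α = 0, the moving one at α = φ, and
the cut arc is 0 < α < φ. -/
lemma integrand_eq (α : Fin (n + 1) → ℝ) :
    (∏ l, (1 - xiStar μ ξ * (Set.Ioo (Real.pi - φ) Real.pi).indicator (fun _ => (1 : ℂ))
        (Real.pi - α l))
      * ((Real.exp (ω₂ * (Real.pi - α l)) * ‖1 + cis (Real.pi - α l)‖ ^ (2 * ω₁)
          * ‖cis (Real.pi - φ) - cis (Real.pi - α l)‖ ^ (2 * μ) : ℝ) : ℂ)) * (∏ l, (cis (α l))⁻¹ ^ n)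
      = ∏ l, circleWeight n ω₁ ω₂ μ (xiStar μ ξ) φ (α l) := by
  rw [← Finset.prod_mul_distrib]
  refine Finset.prod_congr rfl fun l _ => ?_
  have hj : 1 - xiStar μ ξ * (Set.Ioo (Real.pi - φ) Real.pi).indicator (fun _ => (1 : ℂ))
      (Real.pi - α l) = jump (xiStar μ ξ) φ (α l) := by
    rw [jump, Set.indicator_apply]
    have : Real.pi - α l ∈ Set.Ioo (Real.pi - φ) Real.pi ↔ 0 < α l ∧ α l < φ := by
      rw [Set.mem_Ioo]; constructor <;> rintro ⟨h1, h2⟩ <;> constructor <;> linarith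
    simp only [this]
    split_ifs <;> ring
  rw [hj, norm_one_add_cis, ← chord, chord_const_sub, circleWeight, fixedWeight]
  push_cast
  ring

lemma integral_pi_sub {E : Type*} [NormedAddCommGroup E] [NormedSpace ℝ E] (g : ℝ → E) :
    ∫ θ in Set.Ioc (-Real.pi) Real.pi, g (Real.pi - θ) = ∫ α in (0 : ℝ)..2 * Real.pi, g α := by
  rw [← intervalIntegral.integral_of_le (by linarith [Real.pi_pos]),
    intervalIntegral.integral_comp_sub_left, sub_self, sub_neg_eq_add, two_mul]

/-- The circular Jacobi average is a Hankel determinant. -/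
theorem exists_cJacobiAverage_eq (n : ℕ) (ω₁ ω₂ μ : ℝ) (ξ : ℂ) (hω : -(1 / 2) < ω₁)
    (hμ : -(1 / 2) < μ) :
    ∃ K : ℂ, ∀ φ ∈ Set.Ioo 0 (2 * Real.pi), cJacobiAverage (n + 1) ω₁ ω₂ μ ξ φ
      = K * cis (-(μ * φ)) ^ (n + 1)
        * (hankel n (momentFunctional n ω₁ ω₂ μ (xiStar μ ξ) φ)).det := by
  -- Only independence of φ matters for the constant: it drops out of the logarithmic derivative.
  refine ⟨((Equiv.Perm.sign (Fin.revPerm (n := n + 1)) : ℤ) : ℂ) * (n + 1).factorial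
    / cueIntegral (n + 1) fun _ => 1, fun φ hφ => ?_⟩
  rw [cJacobiAverage, cueAverage, div_mul_eq_mul_div, div_mul_eq_mul_div]
  congr 1
  set ν : Measure ℝ := volume.restrict (Set.Ioc (-Real.pi) Real.pi) with hν
  set W := circleWeight n ω₁ ω₂ μ (xiStar μ ξ) φ with hW
  have e : ∀ θ : Fin (n + 1) → ℝ,
      (∏ l, (1 - xiStar μ ξ * (Set.Ioo (Real.pi - φ) Real.pi).indicator (fun _ => (1 : ℂ)) (θ l))
        * ((Real.exp (ω₂ * θ l) * ‖1 + cis (θ l)‖ ^ (2 * ω₁)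
          * ‖cis (Real.pi - φ) - cis (θ l)‖ ^ (2 * μ) : ℝ) : ℂ))
        * ((∏ j, ∏ k ∈ Finset.Ioi j, ‖cis (θ k) - cis (θ j)‖ ^ 2 : ℝ) : ℂ)
      = ((Equiv.Perm.sign (Fin.revPerm (n := n + 1)) : ℤ) : ℂ)
        * ((∏ l, W (Real.pi - θ l))
          * (Matrix.vandermonde fun l => cis (Real.pi - θ l)).det ^ 2) := by
    intro θ
    have h1 : (∏ j, ∏ k ∈ Finset.Ioi j, ‖cis (θ k) - cis (θ j)‖ ^ 2 : ℝ)
        = ∏ j, ∏ k ∈ Finset.Ioi j, chord (Real.pi - θ j) (Real.pi - θ k) ^ 2 := by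
      refine Finset.prod_congr rfl fun j _ => Finset.prod_congr rfl fun k _ => ?_
      rw [chord_const_sub, chord, norm_sub_rev]
    have h2 := integrand_eq (n := n) (ω₁ := ω₁) (ω₂ := ω₂) (μ := μ) (ξ := ξ) (φ := φ)
      fun l => Real.pi - θ l
    simp only [sub_sub_cancel] at h2
    rw [h1, prod_chord_sq, hW, ← h2]
    ring
  have hint : ∀ k : ℕ, Integrable (fun θ => cis (Real.pi - θ) ^ k * W (Real.pi - θ)) ν := by
    intro k
    have h := (intervalIntegrable_mul_circleWeight (n := n) (ω₂ := ω₂) (ζ := xiStar μ ξ) hω hμ hφ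
      (continuous_cis.pow k)).comp_sub_left Real.pi
    rw [sub_zero, intervalIntegrable_iff, Set.uIoc_of_ge (by linarith [Real.pi_pos])] at h
    have hpi : Real.pi - 2 * Real.pi = -Real.pi := by ring
    rw [hpi] at h
    exact h
  rw [cueIntegral, volume_pi, Measure.restrict_pi_pi]
  simp only [e]
  rw [integral_const_mul, integral_prod_mul_vandermonde_sq ν (fun θ => W (Real.pi - θ))
    (fun θ => cis (Real.pi - θ)) hint, mul_assoc, mul_assoc]
  congr 2
  have hH : (Matrix.of fun j k : Fin (n + 1) =>
      ∫ θ, cis (Real.pi - θ) ^ ((j : ℕ) + k) * W (Real.pi - θ) ∂ν)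
      = cis (-(μ * φ)) • hankel n (momentFunctional n ω₁ ω₂ μ (xiStar μ ξ) φ) := by
    ext j k
    rw [Matrix.smul_apply, hankel, Matrix.of_apply, Matrix.of_apply,
      momentFunctional_apply hω hμ hφ, smul_eq_mul, ← mul_assoc, ← cis_add, neg_add_cancel,
      cis_zero, one_mul, hν, integral_pi_sub fun α => cis α ^ ((j : ℕ) + k) * W α]
    simp only [eval_pow, eval_X]
    rfl
  rw [hH, Matrix.det_smul, Fintype.card_fin]

end Average

end CircularJacobi

end

/-! ### Algebra of the scaled equation with ε = 1/N. -/

noncomputable section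

namespace CircularJacobi

open Complex

section Scalar

/-- The product of the residues at `t`, recovered from the derivative `u₁` of the
logarithmic derivative; `ε = 1 / N` and `t = 1 + i ε τ`. -/
def residueB (w μ ε τ u₁ : ℂ) : ℂ :=
  (μ + I * u₁ / (1 + I * ε * τ)) / (1 + ε * (w + μ))

/-- The part of the quadratic form of the residues that does not involve the residue at `0`. -/
def residueX (w wb μ b : ℂ) : ℂ :=
  (wb + μ - b) * (wb + μ - b - (w + wb)) - b * (b - 2 * μ)

/-- The scaled product of the residues at `0`. -/
def residueG (w wb μ ε τ u u₁ : ℂ) : ℂ :=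
  (((w + μ) * (μ + I * u₁) - u₁ * τ / (1 + I * ε * τ)) / (1 + ε * (w + μ))
    - (wb + μ) * (residueB w μ ε τ u₁ - 2 * μ) - residueX w wb μ (residueB w μ ε τ u₁) + u)
    / (1 + ε * (w + μ))

/-- The scaled second derivative. -/
def residueS (w μ ε τ u₁ u₂ : ℂ) : ℂ :=
  I * τ * (u₂ - I * ε * u₁) / ((1 + I * ε * τ) * (1 + ε * (w + μ)))

/-- The cubic of which `residueS` is a square root, in terms of `b` and `g`. -/
def residueCubic (w wb μ ε b g : ℂ) : ℂ :=
  (residueX w wb μ b + g * (1 + ε * (w - μ))) ^ 2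
    + 4 * ε * (residueX w wb μ b + g * (1 + ε * (w - μ))) * g * b + 8 * μ * ε ^ 2 * g ^ 2 * b
    + 4 * g * (1 + ε * (wb + μ)) * b * (b - 2 * μ)

/-- The cubic of which `residueS` is a square root. -/
def scaledCubic (w wb μ ε τ u u₁ : ℂ) : ℂ :=
  residueCubic w wb μ ε (residueB w μ ε τ u₁) (residueG w wb μ ε τ u u₁)

/-- The scaled `σ`-form of Painlevé VI. -/
def scaledSigma (w wb μ ε τ u u₁ u₂ : ℂ) : ℂ :=
  (1 + ε * (w + μ)) ^ 2 * (residueS w μ ε τ u₁ u₂ ^ 2 - scaledCubic w wb μ ε τ u u₁)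

theorem e₂_eq (b : Fin 4 → ℂ) :
    e₂ b = b 0 * b 1 + b 0 * b 2 + b 0 * b 3 + b 1 * b 2 + b 1 * b 3 + b 2 * b 3 := by
  simp [e₂, Fin.sum_univ_four, show Finset.Ioi (0 : Fin 4) = {1, 2, 3} from rfl,
    show Finset.Ioi (1 : Fin 4) = {2, 3} from rfl, show Finset.Ioi (2 : Fin 4) = {3} from rfl,
    show Finset.Ioi (3 : Fin 4) = ∅ from rfl]
  ring

/-- The left hand side of the `σ`-form of Painlevé VI in terms of residues `b`, `β`. -/
theorem sigmaPVI_eq_mul (N w wb μ b β s t h h₁ h₂ : ℂ) (B : Fin 4 → ℂ)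
    (hB : B = ![(N + w - μ) / 2, wb + (N + w + μ) / 2, (N - w + μ) / 2, -μ - (N + w + μ) / 2])
    (x : ℂ) 
    (hx : x = (N + β + b) * (N + β + b + (w + wb)) - β * (β + N + wb + μ) - b * (b - 2 * μ))
    (h1 : h₁ = -(N + w + μ) * b + 2 * μ * N + e₂' B)
    (hq : 2 * h - (2 * t - 1) * h₁ = 
      (-2 * (N + β + b) * b - (w + wb) * b + 2 * μ * (N + β + b)
              + x + 2 * (b * (b - 2 * μ))) - (2 * β * b + (N + wb + μ) * b - 2 * μ * β - x)
       + e₂' B - e₂ B)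
    (h2 : t * (1 - t) * h₂ = (N + w + μ) * s) :
    sigmaPVI B t h h₁ h₂ = h₁ * ((N + w + μ) ^ 2 *
      (s ^ 2 - x ^ 2 + 4 * (β * (β + N + wb + μ)) * (b * (b - 2 * μ)))) := by
  rw [sigmaPVI, h2, hq, Fin.prod_univ_four]
  -- The terms without h' cancel between the square and the product, since the square of ∏ b_k
  -- equals ∏ b_k². What remains of them is divisible by h', and this is the quotient.
  have key : h₁ * (-2 * (N + β + b) * b - (w + wb) * b + 2 * μ * (N + β + b)
              + x + 2 * (b * (b - 2 * μ)) - (2 * β * b + (N + wb + μ) * b - 2 * μ * β - x)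
       + e₂' B - e₂ B) ^ 2 + 2 * (B 0 * B 1 * B 2 * B 3) * (-2 * (N + β + b) * b - (w + wb) * b + 2 * μ * (N + β + b)
              + x + 2 * (b * (b - 2 * μ)) - (2 * β * b + (N + wb + μ) * b - 2 * μ * β - x)
       + e₂' B - e₂ B) - h₁ ^ 3 - (B 0 ^ 2 + B 1 ^ 2 + B 2 ^ 2 + B 3 ^ 2) * h₁ ^ 2
       - (B 0 ^ 2 * B 1 ^ 2 + B 0 ^ 2 * B 2 ^ 2 + B 0 ^ 2 * B 3 ^ 2 + B 1 ^ 2 * B 2 ^ 2 + B 1 ^ 2 * B 3 ^ 2 + B 2 ^ 2 * B 3 ^ 2) * h₁ 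
       - (B 0 ^ 2 * B 1 ^ 2 * B 2 ^ 2 + B 0 ^ 2 * B 1 ^ 2 * B 3 ^ 2 + B 0 ^ 2 * B 2 ^ 2 * B 3 ^ 2 + B 1 ^ 2 * B 2 ^ 2 * B 3 ^ 2) = (N + w + μ) ^ 2 *
      ( - x ^ 2 + 4 * (β * (β + N + wb + μ)) * (b * (b - 2 * μ))) := by
    rw [e₂_eq, hx, h1, e₂', hB]
    simp only [Matrix.cons_val]
    ring
  linear_combination h₁ * key

/-- With γ = β - c_0 the terms γ² in x cancel, so the expression of the logarithmic derivative is
linear in γ and can be solved for Nγ. -/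
theorem eq_residueG {N ε τ : ℂ} (w wb μ u u₁ γ : ℂ) (hε : ε * N = 1) (ht : 1 + I * ε * τ ≠ 0)
    (hd : 1 + ε * (w + μ) ≠ 0) {b β x t : ℂ} (hb : b = residueB w μ ε τ u₁)
    (hβ : β = -(N + wb + μ) + γ) (htt : t = 1 + I * ε * τ)
    (hx : x = (N + β + b) * (N + β + b + (w + wb)) - β * γ - b * (b - 2 * μ))
    (hu : u + μ * N * (t - 1) = (t - 1) * (2 * β * b + (N + wb + μ) * b - 2 * μ * β - x)
      + t * (-2 * (N + β + b) * b - (w + wb) * b + 2 * μ * (N + β + b) + x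
        + 2 * (b * (b - 2 * μ)))) :
    N * γ = residueG w wb μ ε τ u u₁ := by
  have hNt : N * (t - 1) = I * τ := by
    rw [htt]
    linear_combination I * τ * hε
  have hu₁ : u₁ = I * t * (μ - b * (1 + ε * (w + μ))) := by
    rw [hb, residueB, ← htt, div_mul_cancel₀ _ hd]
    rw [← htt] at ht
    field_simp
    linear_combination u₁ * I_sq
  rw [residueG, eq_div_iff hd, ← hb, ← htt]
  rw [← htt] at ht
  have h : ((w + μ) * (μ + I * u₁) - u₁ * τ / t) / (1 + ε * (w + μ))
      = -(I * τ * μ) + (w + μ) * t * b + I * τ * b := by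
    have h' : u₁ * τ / t = I * (μ - b * (1 + ε * (w + μ))) * τ := by
      rw [hu₁]
      field_simp
    rw [div_eq_iff hd, h', hu₁, htt]
    linear_combination (w + μ) * (1 + I * ε * τ) * (μ - b * (1 + ε * (w + μ))) * I_sq
  rw [h, residueX]
  rw [hx, hβ] at hu
  linear_combination -hu + (b - μ) * hNt + γ * (w + μ) * hε

/-- Although β is of size N, both N + β and β · εg stay bounded: εN = 1 removes N completely and
leaves a polynomial in ε. -/
theorem residueCubic_eq {N ε : ℂ} (w wb μ b g : ℂ) (hε : ε * N = 1) {β x : ℂ}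
    (hβ : β = -(N + wb + μ) + ε * g)
    (hx : x = (N + β + b) * (N + β + b + (w + wb)) - β * (ε * g) - b * (b - 2 * μ)) :
    residueCubic w wb μ ε b g = x ^ 2 - 4 * (β * (ε * g)) * (b * (b - 2 * μ)) := by
  have hx' : x = residueX w wb μ b + g * (1 + ε * (w - μ)) + 2 * ε * g * b := by
    rw [hx, hβ, residueX]
    linear_combination g * hε
  have hβ' : β * (ε * g) = -g - (wb + μ) * ε * g + ε ^ 2 * g ^ 2 := by
    rw [hβ]
    linear_combination -g * hε
  rw [hx', hβ', residueCubic]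
  ring

/-- The `σ`-form of Painlevé VI in the scaled variables. -/
theorem sigmaPVI_eq_scaledSigma {N : ℕ} {ε τ t : ℂ} (ω₁ ω₂ μ : ℝ) (u u₁ u₂ : ℂ)
    (hε : ε * N = 1) (ht : t ≠ 0) (htt : t = 1 + I * ε * τ)
    (hd : 1 + ε * (omega ω₁ ω₂ + μ) ≠ 0) :
    sigmaPVI (bVI N ω₁ ω₂ μ) t (u + C₁ N ω₁ ω₂ μ * t - C₂ N ω₁ ω₂ μ)
        (u₁ * (N / (I * t)) + C₁ N ω₁ ω₂ μ) (-(u₂ * N ^ 2 / t ^ 2) + I * N * u₁ / t ^ 2)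
      = (u₁ * (N / (I * t)) + C₁ N ω₁ ω₂ μ) * (N ^ 2 * scaledSigma (omega ω₁ ω₂)
          ((starRingEnd ℂ) (omega ω₁ ω₂)) μ ε τ u u₁ u₂) := by
  set w := omega ω₁ ω₂
  set wb := (starRingEnd ℂ) w
  set b := residueB w μ ε τ u₁ with hb
  set g := residueG w wb μ ε τ u u₁ with hg
  set s := residueS w μ ε τ u₁ u₂ with hs
  set β := -(N + wb + μ) + ε * g with hβ
  set x := (N + β + b) * (N + β + b + (w + wb)) - β * (ε * g) - b * (b - 2 * μ) with hx
  have hNt : N * (t - 1) = I * τ := by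
    rw [htt]
    linear_combination I * τ * hε
  have hN : (N : ℂ) ≠ 0 := right_ne_zero_of_mul_eq_one hε
  have hK : (N + w + μ : ℂ) = N * (1 + ε * (w + μ)) := by linear_combination -(w + μ) * hε
  have hu₁ : u₁ = I * t * (μ - b * (1 + ε * (w + μ))) := by
    rw [hb, residueB, ← htt, div_mul_cancel₀ _ hd]
    field_simp
    linear_combination u₁ * I_sq
  have key := sigmaPVI_eq_mul N w wb μ b β s t (u + C₁ N ω₁ ω₂ μ * t - C₂ N ω₁ ω₂ μ)
    (u₁ * (N / (I * t)) + C₁ N ω₁ ω₂ μ) (-(u₂ * N ^ 2 / t ^ 2) + I * N * u₁ / t ^ 2)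
    (bVI N ω₁ ω₂ μ) rfl x (by rw [hx, hβ]; ring) ?_ ?_ ?_
  · rw [key, hK, scaledSigma, scaledCubic, ← hb, ← hg,
      residueCubic_eq w wb μ b g hε (β := β) (x := x) hβ hx]
    rw [hβ]
    ring
  · rw [C₁, hu₁]
    field_simp
    linear_combination b * hK
  · have h : ((w + μ) * (μ + I * u₁) - u₁ * τ / t) / (1 + ε * (w + μ))
        = -(I * τ * μ) + (w + μ) * t * b + I * τ * b := by
      have h' : u₁ * τ / t = I * (μ - b * (1 + ε * (w + μ))) * τ := by
        rw [hu₁]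
        field_simp
      rw [div_eq_iff hd, h', hu₁, htt]
      linear_combination (w + μ) * (1 + I * ε * τ) * (μ - b * (1 + ε * (w + μ))) * I_sq
    have hgd : g * (1 + ε * (w + μ)) = -(I * τ * μ) + (w + μ) * t * b + I * τ * b
        - (wb + μ) * (b - 2 * μ) - residueX w wb μ b + u := by
      rw [hg, residueG, div_mul_cancel₀ _ hd, ← htt, ← hb, h]
    have hh : u₁ * (N / (I * t)) = -(N + w + μ) * b + μ * N := by
      rw [hu₁]
      field_simp
      linear_combination b * hK
    rw [C₁, C₂, hh, hx, hβ]
    rw [residueX] at hgd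
    ring_nf
    ring_nf at hgd
    linear_combination -2 * hgd - 2 * (μ - b) * hNt - 2 * g * hε
  · rw [hs, residueS, ← htt, hK]
    field_simp
    linear_combination u₂ * hNt - I * u₁ * htt

/-- At ε = 0, b = μ + iu' = h' + v₁ and b - 2μ = h' + v₂. With p = b(b - 2μ) and x = `residueX`, (x
+ g)² + 4gp = (x + g + 2p)² - 4p(x + p), and x + p = (h' + v₃)(h' + v₄). Completing the square thus
produces the product of four factors in (V). -/
theorem scaledSigma_zero (ω₁ ω₂ μ : ℝ) (X : ℝ) (u u₁ u₂ : ℂ) :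
    scaledSigma (omega ω₁ ω₂) ((starRingEnd ℂ) (omega ω₁ ω₂)) μ 0 X u u₁ u₂
      = sigmaPV (vV ω₁ ω₂ μ) (-(I * X)) (u + I * ω₂ / 2 * (-(I * X)) + 2 * ω₁ * μ + (ω₂ : ℂ) ^ 2 / 2)
        (I * u₁ + I * ω₂ / 2) (-u₂) := by
  have hc : (starRingEnd ℂ) (omega ω₁ ω₂) = ω₁ - I * ω₂ := by
    simp [omega, sub_eq_add_neg]
  rw [omega] at hc
  have hI4 : I ^ 4 = 1 := by rw [show (4 : ℕ) = 2 * 2 from rfl, pow_mul, I_sq]; ring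
  simp only [scaledSigma, scaledCubic, residueCubic, residueS, residueG, residueB, residueX,
    sigmaPV, vV, Fin.prod_univ_four, omega, hc, Matrix.cons_val, mul_zero, zero_mul, add_zero, div_one]
  ring_nf
  simp only [I_sq, hI4]
  ring

/-! ### Regularity at ε = 0 and growth in the first derivative. -/

section Limits

open Filter Topology

variable {α : Type*} {l : Filter α} {w wb μ : ℂ} {ε τ u u₁ u₂ : α → ℂ} {X v v₁ v₂ : ℂ}

theorem tendsto_one_add_mul (hε : Tendsto ε l (𝓝 0)) (c : ℂ) :
    Tendsto (fun a => 1 + ε a * c) l (𝓝 1) := by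
  simpa using (hε.mul_const c).const_add 1

theorem tendsto_one_add_I_mul (hε : Tendsto ε l (𝓝 0)) (hτ : Tendsto τ l (𝓝 X)) :
    Tendsto (fun a => 1 + I * ε a * τ a) l (𝓝 1) := by
  simpa using ((hε.const_mul I).mul hτ).const_add 1

theorem tendsto_residueB (hε : Tendsto ε l (𝓝 0)) (hτ : Tendsto τ l (𝓝 X))
    (hu₁ : Tendsto u₁ l (𝓝 v₁)) :
    Tendsto (fun a => residueB w μ (ε a) (τ a) (u₁ a)) l (𝓝 (residueB w μ 0 X v₁)) := by
  have h1 := tendsto_one_add_mul hε (w + μ)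
  have h2 := tendsto_one_add_I_mul hε hτ
  have := ((hu₁.const_mul I).div h2 one_ne_zero).const_add μ |>.div h1 one_ne_zero
  simpa [residueB, Pi.div_def] using this

theorem tendsto_residueG (hε : Tendsto ε l (𝓝 0)) (hτ : Tendsto τ l (𝓝 X))
    (hu : Tendsto u l (𝓝 v)) (hu₁ : Tendsto u₁ l (𝓝 v₁)) :
    Tendsto (fun a => residueG w wb μ (ε a) (τ a) (u a) (u₁ a)) l
      (𝓝 (residueG w wb μ 0 X v v₁)) := by
  have h1 := tendsto_one_add_mul hε (w + μ)
  have h2 := tendsto_one_add_I_mul hε hτ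
  have hb := tendsto_residueB (w := w) (μ := μ) hε hτ hu₁
  have hX : Continuous (residueX w wb μ) := by unfold residueX; fun_prop
  have := ((((((hu₁.const_mul I).const_add μ).const_mul (w + μ)).sub
    ((hu₁.mul hτ).div h2 one_ne_zero)).div h1 one_ne_zero).sub
    ((hb.sub_const (2 * μ)).const_mul (wb + μ)) |>.sub ((hX.tendsto _).comp hb) |>.add hu).div h1
    one_ne_zero
  simpa [residueG, Pi.div_def] using this

theorem tendsto_scaledCubic (hε : Tendsto ε l (𝓝 0)) (hτ : Tendsto τ l (𝓝 X))
    (hu : Tendsto u l (𝓝 v)) (hu₁ : Tendsto u₁ l (𝓝 v₁)) :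
    Tendsto (fun a => scaledCubic w wb μ (ε a) (τ a) (u a) (u₁ a)) l
      (𝓝 (scaledCubic w wb μ 0 X v v₁)) := by
  have hb := tendsto_residueB (w := w) (μ := μ) hε hτ hu₁
  have hg := tendsto_residueG (w := w) (wb := wb) (μ := μ) hε hτ hu hu₁
  have hX : Continuous (residueX w wb μ) := by unfold residueX; fun_prop
  have hY := ((hX.tendsto _).comp hb).add (hg.mul ((hε.mul_const (w - μ)).const_add 1))
  exact (((hY.pow 2).add ((((hε.const_mul 4).mul hY).mul hg).mul hb)).add
    ((((hε.pow 2).const_mul (8 * μ)).mul (hg.pow 2)).mul hb)).add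
    ((((hg.const_mul 4).mul ((hε.mul_const (wb + μ)).const_add 1)).mul hb).mul
      (hb.sub_const (2 * μ)))

theorem tendsto_scaledSigma (hε : Tendsto ε l (𝓝 0)) (hτ : Tendsto τ l (𝓝 X))
    (hu : Tendsto u l (𝓝 v)) (hu₁ : Tendsto u₁ l (𝓝 v₁)) (hu₂ : Tendsto u₂ l (𝓝 v₂)) :
    Tendsto (fun a => scaledSigma w wb μ (ε a) (τ a) (u a) (u₁ a) (u₂ a)) l
      (𝓝 (scaledSigma w wb μ 0 X v v₁ v₂)) := by
  have h1 := tendsto_one_add_mul hε (w + μ)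
  have h2 := tendsto_one_add_I_mul hε hτ
  have hs : Tendsto (fun a => residueS w μ (ε a) (τ a) (u₁ a) (u₂ a)) l
      (𝓝 (residueS w μ 0 X v₁ v₂)) := by
    have := ((hτ.const_mul I).mul (hu₂.sub ((hε.const_mul I).mul hu₁))).div (h2.mul h1)
      (by norm_num)
    simpa [residueS, Pi.div_def] using this
  have := (h1.pow 2).mul ((hs.pow 2).sub (tendsto_scaledCubic (w := w) (wb := wb) (μ := μ)
    hε hτ hu hu₁))
  simpa [scaledSigma] using this

open Asymptotics in
/-- The cubic growth of `scaledCubic` in the first derivative. -/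
theorem isBigO_scaledCubic (hε : Tendsto ε l (𝓝 0)) (hτ : Tendsto τ l (𝓝 X))
    (hu : Tendsto u l (𝓝 v)) :
    (fun a => scaledCubic w wb μ (ε a) (τ a) (u a) (u₁ a)) =O[l] fun a => (1 + ‖u₁ a‖) ^ 3 := by
  have hW : ∀ a, 0 ≤ 1 + ‖u₁ a‖ := fun a => by positivity
  have one : ∀ c : ℂ, (fun _ : α => c) =O[l] fun a => 1 + ‖u₁ a‖ := fun c =>
    IsBigO.of_bound ‖c‖ (.of_forall fun a => by
      rw [Real.norm_of_nonneg (hW a)]; nlinarith [norm_nonneg c, norm_nonneg (u₁ a)])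
  have h1 := (tendsto_one_add_mul hε (w + μ))
  have h2 := tendsto_one_add_I_mul hε hτ
  have hmul : ∀ {f g : α → ℂ} {z : ℂ}, Tendsto f l (𝓝 z) →
      g =O[l] (fun a => 1 + ‖u₁ a‖) → (fun a => f a * g a) =O[l] fun a => 1 + ‖u₁ a‖ := by
    intro f g z hf hg
    simpa using (hf.isBigO_one ℝ).mul hg
  have hdiv : ∀ {f g : α → ℂ}, Tendsto f l (𝓝 1) →
      g =O[l] (fun a => 1 + ‖u₁ a‖) → (fun a => g a / f a) =O[l] fun a => 1 + ‖u₁ a‖ := by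
    intro f g hf hg
    simpa [div_eq_inv_mul] using hmul (hf.inv₀ one_ne_zero) hg
  have hu₁ : u₁ =O[l] fun a => 1 + ‖u₁ a‖ := IsBigO.of_bound 1 (.of_forall fun a => by
    rw [Real.norm_of_nonneg (hW a)]; linarith)
  have hc : ∀ {f : α → ℂ} {z : ℂ}, Tendsto f l (𝓝 z) → f =O[l] fun a => 1 + ‖u₁ a‖ := by
    intro f z hf
    simpa using hmul hf (one 1)
  have hb : (fun a => residueB w μ (ε a) (τ a) (u₁ a)) =O[l] fun a => 1 + ‖u₁ a‖ :=
    hdiv h1 ((one μ).add (hdiv h2 (hu₁.const_mul_left I)))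
  have hX : (fun a => residueX w wb μ (residueB w μ (ε a) (τ a) (u₁ a)))
      =O[l] fun a => 1 + ‖u₁ a‖ := by
    -- The squares of b cancel, so this is affine in b. Without the cancellation its square would be
    -- quartic in the first derivative instead of quadratic.
    have : ∀ b, residueX w wb μ b = (wb + μ) * (μ - w) + (w - wb) * b := by
      intro b
      rw [residueX]
      ring
    simp only [this]
    exact (one _).add (hb.const_mul_left _)
  have hg : (fun a => residueG w wb μ (ε a) (τ a) (u a) (u₁ a)) =O[l] fun a => 1 + ‖u₁ a‖ := by
    refine hdiv h1 ((((hdiv h1 ((((one μ).add (hu₁.const_mul_left I)).const_mul_left _).sub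
      (hdiv h2 ?_))).sub ((hb.sub (one _)).const_mul_left _)).sub hX).add (hc hu))
    simpa only [mul_comm] using hmul hτ hu₁
  have hY : (fun a => residueX w wb μ (residueB w μ (ε a) (τ a) (u₁ a))
      + residueG w wb μ (ε a) (τ a) (u a) (u₁ a) * (1 + ε a * (w - μ)))
      =O[l] fun a => 1 + ‖u₁ a‖ := by
    refine hX.add ?_
    simpa only [mul_comm] using hmul (tendsto_one_add_mul hε (w - μ)) hg
  have hsq : (fun a => (1 + ‖u₁ a‖) ^ 2) =O[l] fun a => (1 + ‖u₁ a‖) ^ 3 :=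
    IsBigO.of_bound 1 (.of_forall fun a => by
      rw [Real.norm_of_nonneg (by positivity), Real.norm_of_nonneg (by positivity), one_mul]
      exact pow_le_pow_right₀ (by linarith [norm_nonneg (u₁ a)]) (by norm_num))
  have t1 := (hY.pow 2).trans hsq
  have t2 := (hmul (hε.const_mul 4) hY).mul (hg.mul hb)
  have t3 := (hmul ((hε.pow 2).const_mul (8 * μ)) hg).mul (hg.mul hb)
  have t4 := (hmul ((tendsto_one_add_mul hε (wb + μ)).const_mul 4) hg).mul
    (hb.mul (hb.sub (one (2 * μ))))
  have e : ∀ a, scaledCubic w wb μ (ε a) (τ a) (u a) (u₁ a) = _ := fun a => rfl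
  simp only [scaledCubic, residueCubic]
  refine ((t1.add ?_).add ?_).add ?_
  · exact t2.congr (fun a => by ring) (fun a => by ring)
  · exact t3.congr (fun a => by ring) (fun a => by ring)
  · exact t4.congr (fun a => by ring) (fun a => by ring)

end Limits

end Scalar

end CircularJacobi

end

/-! ### Derivatives along the circle and the imaginary axis; the reduction of (VI) to (V). -/

noncomputable section

namespace CircularJacobi

open Complex Filter Topology

section Curves

/-- The chain rule for a real parameter of a curve in the complex plane. -/
theorem hasDerivWithinAt_comp_parameter {a : ℂ → ℝ} {a' : ℂ} {S : Set ℂ} {t : ℂ} {f : ℝ → ℂ}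
    {f' : ℂ} (hf : HasDerivAt f f' (a t))
    (ha : HasDerivWithinAt (fun z => (a z : ℂ)) a' S t) :
    HasDerivWithinAt (fun z => f (a z)) (f' * a') S t := by
  have hc : Tendsto a (𝓝[S] t) (𝓝 (a t)) := by
    have := (continuous_re.tendsto _).comp ha.continuousWithinAt
    simpa [Function.comp_def] using this
  rw [hasDerivWithinAt_iff_isLittleO] at ha ⊢
  rw [hasDerivAt_iff_isLittleO] at hf
  have hO : (fun z => a z - a t) =O[𝓝[S] t] fun z => z - t := by
    have h1 : (fun z => (a z : ℂ) - a t) =O[𝓝[S] t] fun z => z - t := by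
      have h2 : (fun z => (z - t) • a') =O[𝓝[S] t] fun z => z - t := by
        simpa [mul_comm] using (Asymptotics.isBigO_refl (fun z => z - t) (𝓝[S] t)).const_mul_left a'
      simpa using ha.isBigO.add h2
    refine (Asymptotics.isBigO_norm_left.1 ?_)
    refine (Asymptotics.isBigO_norm_left.2 h1).congr_left fun z => ?_
    rw [← ofReal_sub, norm_real]
  have h3 := (hf.comp_tendsto hc).trans_isBigO hO
  refine (h3.add (ha.const_mul_left f')).congr_left fun z => ?_
  simp only [Function.comp_apply, real_smul, smul_eq_mul, ofReal_sub]
  ring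

theorem arg_cis {φ : ℝ} (hφ : φ ∈ Set.Ioc (-Real.pi) Real.pi) : (cis φ).arg = φ := by
  rw [cis_eq_cos_add_sin, ofReal_cos, ofReal_sin]
  exact arg_cos_add_sin_mul_I hφ

theorem cis_mem_unitCircle (φ : ℝ) : cis φ ∈ unitCircle := by
  simp [unitCircle, norm_cis]

theorem cis_arg {z : ℂ} (hz : z ∈ unitCircle) : cis z.arg = z := by
  have h : ‖z‖ = 1 := by simpa [unitCircle] using hz
  have := norm_mul_exp_arg_mul_I z
  rw [h, ofReal_one, one_mul, mul_comm] at this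
  exact this

theorem cis_mem_slitPlane {φ : ℝ} (hφ : φ ∈ Set.Ioo (-Real.pi) Real.pi) : cis φ ∈ slitPlane := by
  rw [mem_slitPlane_iff_arg, arg_cis ⟨hφ.1, hφ.2.le⟩]
  exact ⟨hφ.2.ne, cis_ne_zero φ⟩

theorem hasDerivWithinAt_arg {φ : ℝ} (hφ : φ ∈ Set.Ioo (-Real.pi) Real.pi) :
    HasDerivWithinAt (fun z : ℂ => (z.arg : ℂ)) (1 / (I * cis φ)) unitCircle (cis φ) := by
  have h := ((hasDerivAt_log (cis_mem_slitPlane hφ)).const_mul (-I)).hasDerivWithinAt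
    (s := unitCircle)
  have he : ∀ z ∈ unitCircle, (z.arg : ℂ) = -I * log z := by
    intro z hz
    have hn : ‖z‖ = 1 := by simpa [unitCircle] using hz
    rw [log, hn, Real.log_one, ofReal_zero, zero_add]
    linear_combination (z.arg : ℂ) * I_sq
  refine (h.congr he (he _ (cis_mem_unitCircle φ))).congr_deriv ?_
  rw [one_div, mul_inv, inv_I]

/-- Over the one-dimensional field ℂ unique differentiability only needs an accumulation point, and
a connected set with two points has no isolated ones. -/
theorem uniqueDiffWithinAt_unitCircle {z : ℂ} (hz : z ∈ unitCircle) :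
    UniqueDiffWithinAt ℂ unitCircle z := by
  rw [uniqueDiffWithinAt_iff_accPt]
  refine (isPreconnected_sphere (E := ℂ) (by simp) 0 1).preperfect_of_nontrivial
    ⟨1, by simp, -1, by simp, by norm_num⟩ _ hz

theorem mem_rotated {J : Set ℝ} {t : ℂ} : t ∈ rotated J ↔ ∃ X ∈ J, t = -(I * X) := by
  refine exists_congr fun X => and_congr_right fun _ => ⟨fun h => ?_, fun h => ?_⟩
  · rw [← h]; linear_combination t * I_sq
  · rw [h]; linear_combination -(X : ℂ) * I_sq

theorem I_mul_neg_I_mul (X : ℝ) : I * (-(I * X)) = X := by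
  linear_combination -(X : ℂ) * I_sq

theorem uniqueDiffOn_rotated {J : Set ℝ} (hJ : IsOpen J) : UniqueDiffOn ℂ (rotated J) := by
  intro t ht
  obtain ⟨X, hX, rfl⟩ := mem_rotated.1 ht
  rw [uniqueDiffWithinAt_iff_accPt]
  have h := uniqueDiffWithinAt_iff_accPt.1 (hJ.uniqueDiffWithinAt hX)
  have h2 := h.map (f := fun x : ℝ => -(I * (x : ℂ))) (by fun_prop) (fun x y hxy => by
    simpa using hxy)
  refine h2.mono ?_
  rw [map_principal, principal_mono]
  rintro _ ⟨x, hx, rfl⟩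
  exact mem_rotated.2 ⟨x, hx, rfl⟩

theorem hasDerivWithinAt_hV {J : Set ℝ} (ω₁ ω₂ μ : ℝ) {u : ℝ → ℂ} {u' : ℂ} {X : ℝ} (hX : X ∈ J)
    (hu : HasDerivAt u u' X) :
    HasDerivWithinAt (hV ω₁ ω₂ μ u) (I * u' + I * ω₂ / 2) (rotated J) (-(I * X)) := by
  have ha : HasDerivWithinAt (fun z : ℂ => (((I * z).re : ℝ) : ℂ)) I (rotated J) (-(I * X)) := by
    have h := ((hasDerivAt_id (-(I * X))).const_mul I).hasDerivWithinAt (s := rotated J)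
    rw [mul_one] at h
    have he : ∀ z ∈ rotated J, (((I * z).re : ℝ) : ℂ) = I * id z := by
      rintro z ⟨x, -, hx⟩
      simp only [id]
      rw [hx, ofReal_re]
    exact h.congr he (he _ (mem_rotated.2 ⟨X, hX, rfl⟩))
  have hX' : (I * -(I * X)).re = X := by rw [I_mul_neg_I_mul, ofReal_re]
  have h1 := hasDerivWithinAt_comp_parameter (f := u) (f' := u') (by rwa [hX']) ha
  have h2 := ((((hasDerivAt_id (-(I * X))).const_mul (I * ω₂ / 2)).hasDerivWithinAt
    (s := rotated J)))
  refine (((h1.add h2).add_const (2 * ω₁ * μ : ℂ)).add_const ((ω₂ : ℂ) ^ 2 / 2)).congr_deriv ?_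
  ring

/-- The first two derivatives of `hV` along the rotated set. -/
theorem derivWithin_hV {J : Set ℝ} (hJ : IsOpen J) (ω₁ ω₂ μ : ℝ) {u u' : ℝ → ℂ}
    (hu : ∀ X ∈ J, HasDerivAt u (u' X) X) :
    Set.EqOn (derivWithin (hV ω₁ ω₂ μ u) (rotated J))
      (fun t => I * u' (I * t).re + I * ω₂ / 2) (rotated J) := by
  intro t ht
  obtain ⟨X, hX, rfl⟩ := mem_rotated.1 ht
  rw [(hasDerivWithinAt_hV ω₁ ω₂ μ hX (hu X hX)).derivWithin (uniqueDiffOn_rotated hJ _ ht)]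
  simp only [I_mul_neg_I_mul, ofReal_re]

theorem hasDerivWithinAt_derivWithin_hV {J : Set ℝ} (hJ : IsOpen J) (ω₁ ω₂ μ : ℝ) {u u' : ℝ → ℂ}
    {u'' : ℂ} (hu : ∀ X ∈ J, HasDerivAt u (u' X) X) {X : ℝ} (hX : X ∈ J)
    (hu' : HasDerivAt u' u'' X) :
    HasDerivWithinAt (derivWithin (hV ω₁ ω₂ μ u) (rotated J)) (-u'') (rotated J) (-(I * X)) := by
  -- With all parameters zero `hV` is composition with the real parameter, so the first-derivative
  -- formula applies to u' itself.
  have h := hasDerivWithinAt_hV 0 0 0 hX hu'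
  have h2 := ((h.const_mul I).add_const (I * ω₂ / 2)).congr (f₁ :=
    derivWithin (hV ω₁ ω₂ μ u) (rotated J)) (fun t ht => ?_) ?_
  · refine h2.congr_deriv ?_
    simp only [ofReal_zero, mul_zero, zero_div, add_zero]
    linear_combination u'' * I_sq
  · rw [derivWithin_hV hJ ω₁ ω₂ μ hu ht]
    simp [hV]
  · rw [derivWithin_hV hJ ω₁ ω₂ μ hu (mem_rotated.2 ⟨X, hX, rfl⟩)]
    simp [hV]

theorem sigmaPVAt_hV {J : Set ℝ} (hJ : IsOpen J) (ω₁ ω₂ μ : ℝ) {u u' : ℝ → ℂ}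
    {u'' : ℂ} (hu : ∀ X ∈ J, HasDerivAt u (u' X) X) {X : ℝ} (hX : X ∈ J)
    (hu' : HasDerivAt u' u'' X) :
    sigmaPVAt (vV ω₁ ω₂ μ) (rotated J) (hV ω₁ ω₂ μ u) (-(I * X))
      = scaledSigma (omega ω₁ ω₂) ((starRingEnd ℂ) (omega ω₁ ω₂)) μ 0 X (u X) (u' X) u'' := by
  have ht := mem_rotated.2 ⟨X, hX, rfl⟩
  rw [scaledSigma_zero, sigmaPVAt, derivWithin_hV hJ ω₁ ω₂ μ hu ht,
    (hasDerivWithinAt_derivWithin_hV hJ ω₁ ω₂ μ hu hX hu').derivWithin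
      (uniqueDiffOn_rotated hJ _ ht)]
  simp only [hV, I_mul_neg_I_mul, ofReal_re]

theorem hasDerivWithinAt_hVI (N : ℕ) (ω₁ ω₂ μ : ℝ) {u : ℝ → ℂ} {u' : ℂ} {φ : ℝ}
    (hφ : φ ∈ Set.Ioo (-Real.pi) Real.pi) (hu : HasDerivAt u u' (N * φ)) :
    HasDerivWithinAt (hVI N ω₁ ω₂ μ u) (u' * (N / (I * cis φ)) + C₁ N ω₁ ω₂ μ) unitCircle
      (cis φ) := by
  have harg := arg_cis ⟨hφ.1, hφ.2.le⟩
  have ha : HasDerivWithinAt (fun z : ℂ => ((N * z.arg : ℝ) : ℂ)) (N * (1 / (I * cis φ)))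
      unitCircle (cis φ) := by
    simpa only [ofReal_mul, ofReal_natCast] using (hasDerivWithinAt_arg hφ).const_mul (N : ℂ)
  have h1 := hasDerivWithinAt_comp_parameter (f := u) (f' := u') (by rwa [harg]) ha
  have h2 := (((hasDerivAt_id (cis φ)).const_mul (C₁ N ω₁ ω₂ μ)).hasDerivWithinAt
    (s := unitCircle))
  refine ((h1.add h2).sub_const (C₂ N ω₁ ω₂ μ)).congr_deriv ?_
  ring

theorem derivWithin_hVI (N : ℕ) (ω₁ ω₂ μ : ℝ) {u : ℝ → ℂ} {u' : ℂ} {φ : ℝ}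
    (hφ : φ ∈ Set.Ioo (-Real.pi) Real.pi) (hu : HasDerivAt u u' (N * φ)) :
    derivWithin (hVI N ω₁ ω₂ μ u) unitCircle (cis φ)
      = u' * (N / (I * cis φ)) + C₁ N ω₁ ω₂ μ :=
  (hasDerivWithinAt_hVI N ω₁ ω₂ μ hφ hu).derivWithin
    (uniqueDiffWithinAt_unitCircle (cis_mem_unitCircle φ))

theorem derivWithin_derivWithin_hVI (N : ℕ) (ω₁ ω₂ μ : ℝ) {J : Set ℝ} (hJ : IsOpen J)
    {u u' : ℝ → ℂ} {u'' : ℂ} {φ : ℝ} (hφ : φ ∈ Set.Ioo (-Real.pi) Real.pi) (hφJ : N * φ ∈ J)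
    (hu : ∀ X ∈ J, HasDerivAt u (u' X) X) (hu' : HasDerivAt u' u'' (N * φ)) :
    derivWithin (derivWithin (hVI N ω₁ ω₂ μ u) unitCircle) unitCircle (cis φ)
      = -(u'' * N ^ 2 / cis φ ^ 2) + I * N * u' (N * φ) / cis φ ^ 2 := by
  have harg := arg_cis ⟨hφ.1, hφ.2.le⟩
  have ha : HasDerivWithinAt (fun z : ℂ => ((N * z.arg : ℝ) : ℂ)) (N * (1 / (I * cis φ)))
      unitCircle (cis φ) := by
    simpa only [ofReal_mul, ofReal_natCast] using (hasDerivWithinAt_arg hφ).const_mul (N : ℂ)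
  have h1 := hasDerivWithinAt_comp_parameter (f := u') (f' := u'') (by rwa [harg]) ha
  have hne : I * cis φ ≠ 0 := mul_ne_zero I_ne_zero (cis_ne_zero φ)
  have h2 := ((((hasDerivAt_id (cis φ)).const_mul I).inv hne).const_mul (N : ℂ)).hasDerivWithinAt
    (s := unitCircle)
  have h3 : HasDerivWithinAt (fun z : ℂ => u' (N * z.arg) * (N * (I * z)⁻¹) + C₁ N ω₁ ω₂ μ) _
      unitCircle (cis φ) := (h1.mul h2).add_const (C₁ N ω₁ ω₂ μ)
  have hct : Tendsto arg (𝓝[unitCircle] (cis φ)) (𝓝 φ) := by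
    have := (continuousAt_arg (cis_mem_slitPlane hφ)).tendsto
    rw [harg] at this
    exact this.mono_left nhdsWithin_le_nhds
  have hJ' : ∀ᶠ z in 𝓝[unitCircle] (cis φ), (N : ℝ) * z.arg ∈ J :=
    (hct.const_mul (N : ℝ)).eventually (hJ.mem_nhds hφJ)
  -- The formula for the first derivative holds on a neighbourhood in the circle because J is open;
  -- it is then differentiated again.
  have hev : derivWithin (hVI N ω₁ ω₂ μ u) unitCircle =ᶠ[𝓝[unitCircle] (cis φ)]
      fun z => u' (N * z.arg) * (N * (I * z)⁻¹) + C₁ N ω₁ ω₂ μ := by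
    filter_upwards [hJ', hct.eventually (isOpen_Ioo.mem_nhds hφ), self_mem_nhdsWithin]
      with z hz1 hz2 hz3
    have := derivWithin_hVI N ω₁ ω₂ μ hz2 (hu _ hz1)
    rw [cis_arg hz3] at this
    rw [this, div_eq_mul_inv]
  rw [hev.derivWithin_eq (hev.self_of_nhdsWithin (cis_mem_unitCircle φ)), h3.derivWithin
    (uniqueDiffWithinAt_unitCircle (cis_mem_unitCircle φ)), harg]
  have hc := cis_ne_zero φ
  have hI := I_ne_zero
  simp only [id, Pi.inv_apply]
  field_simp
  linear_combination (N ^ 2 * u'' - N * I * u' (N * φ)) * I_sq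

end Curves

section Reduction

/-- The variable `τ` with `e^{iX/N} = 1 + i τ / N`. -/
def scaledTau (N : ℕ) (X : ℝ) : ℂ := N * (cis (X / N) - 1) / I

theorem cis_eq_scaledTau {N : ℕ} (hN : (N : ℂ) ≠ 0) (X : ℝ) :
    cis (X / N) = 1 + I * (N : ℂ)⁻¹ * scaledTau N X := by
  rw [scaledTau]
  field_simp [I_ne_zero]
  ring

theorem tendsto_natCast_inv {α : Type*} {l : Filter α} {n : α → ℕ} (hn : Tendsto n l atTop) :
    Tendsto (fun a => (n a : ℂ)⁻¹) l (𝓝 0) :=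
  (tendsto_inv_atTop_nhds_zero_nat (𝕜 := ℂ)).comp hn

theorem tendsto_div_natCast {α : Type*} {l : Filter α} {n : α → ℕ} (hn : Tendsto n l atTop)
    {x : α → ℝ} {X : ℝ} (hx : Tendsto x l (𝓝 X)) :
    Tendsto (fun a => x a / n a) l (𝓝 0) :=
  hx.div_atTop (tendsto_natCast_atTop_atTop.comp hn)

theorem tendsto_cis_sub_one_div :
    Tendsto (fun φ : ℝ => dslope cis 0 φ) (𝓝 0) (𝓝 I) := by
  have h := hasDerivAt_cis 0
  rw [cis_zero, mul_one] at h
  have hc : ContinuousAt (dslope cis 0) 0 :=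
    continuousAt_dslope_same.2 h.differentiableAt
  have := hc.tendsto
  rwa [dslope_same, h.deriv] at this

/-- The point may vary with the index, as the joint limits N → ∞, Y → X require. -/
theorem tendsto_scaledTau {α : Type*} {l : Filter α} {n : α → ℕ} (hn : Tendsto n l atTop)
    {x : α → ℝ} {X : ℝ} (hx : Tendsto x l (𝓝 X)) :
    Tendsto (fun a => scaledTau (n a) (x a)) l (𝓝 X) := by
  have h1 := (tendsto_cis_sub_one_div.comp (tendsto_div_natCast hn hx)).div_const I
  have h2 := ((continuous_ofReal.tendsto X).comp hx).mul h1
  rw [div_self I_ne_zero, mul_one] at h2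
  refine h2.congr' ?_
  filter_upwards [hn.eventually_ge_atTop 1] with a ha
  have hN : (n a : ℂ) ≠ 0 := by exact_mod_cast (by omega : n a ≠ 0)
  have := sub_smul_dslope cis (0 : ℝ) (x a / n a)
  rw [sub_zero, cis_zero, real_smul] at this
  rw [scaledTau, ← this]
  simp only [Function.comp_apply, ofReal_div, ofReal_natCast]
  field_simp

/-- Divided by N², the constant is a polynomial in 1/N. At 0 the three products contribute 1/4 - 1/4
- 1/4. -/
theorem tendsto_C₁ (ω₁ ω₂ μ : ℝ) :
    Tendsto (fun N : ℕ => C₁ N ω₁ ω₂ μ / (N : ℂ) ^ 2) atTop (𝓝 (-(1 / 4))) := by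
  set w := omega ω₁ ω₂ with hw
  let f : ℂ → ℂ := fun ε => (1 + ε * (w - μ)) / 2 * ((1 + ε * (μ - w)) / 2)
    + (1 + ε * (w - μ)) / 2 * (-(ε * μ) - (1 + ε * (w + μ)) / 2)
    + (1 + ε * (μ - w)) / 2 * (-(ε * μ) - (1 + ε * (w + μ)) / 2) + μ * ε
  have hf : Continuous f := by fun_prop
  have h0 : f 0 = -(1 / 4) := by simp only [f]; norm_num
  have h := (hf.tendsto 0).comp (tendsto_inv_atTop_nhds_zero_nat (𝕜 := ℂ))
  rw [h0] at h
  refine h.congr' ?_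
  filter_upwards [eventually_ge_atTop 1] with N hN
  have hN : (N : ℂ) ≠ 0 := by exact_mod_cast (by omega : N ≠ 0)
  simp only [Function.comp_apply, f, C₁, e₂', bVI, Matrix.cons_val, ← hw]
  field_simp
  ring

/-- The reduction of the `σ`-form of Painlevé VI to that of Painlevé V. -/
theorem tendsto_sigmaPVIAt (ω₁ ω₂ μ : ℝ) {J : Set ℝ} {u : ℝ → ℂ} (hJ : IsOpen J)
    (hu : DifferentiableOn ℝ u J) (hu' : DifferentiableOn ℝ (deriv u) J) {X : ℝ} (hX : X ∈ J) :
    Tendsto (fun N : ℕ => sigmaPVIAt (bVI N ω₁ ω₂ μ) unitCircle (hVI N ω₁ ω₂ μ u) (cis (X / N))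
        / derivWithin (hVI N ω₁ ω₂ μ u) unitCircle (cis (X / N)) / (N : ℂ) ^ 2) atTop
        (𝓝 (sigmaPVAt (vV ω₁ ω₂ μ) (rotated J) (hV ω₁ ω₂ μ u) (-(I * X)))) ∧
      Tendsto (fun N : ℕ => derivWithin (hVI N ω₁ ω₂ μ u) unitCircle (cis (X / N)) / (N : ℂ) ^ 2)
        atTop (𝓝 (-(1 / 4))) := by
  have hd : ∀ X ∈ J, HasDerivAt u (deriv u X) X := fun X hX =>
    (hu.differentiableAt (hJ.mem_nhds hX)).hasDerivAt
  have hd' : HasDerivAt (deriv u) (deriv (deriv u) X) X :=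
    (hu'.differentiableAt (hJ.mem_nhds hX)).hasDerivAt
  have hφ : Tendsto (fun N : ℕ => X / N) atTop (𝓝 0) :=
    tendsto_div_natCast tendsto_id tendsto_const_nhds
  have hφ' : ∀ᶠ N : ℕ in atTop, X / N ∈ Set.Ioo (-Real.pi) Real.pi :=
    hφ.eventually (isOpen_Ioo.mem_nhds ⟨by linarith [Real.pi_pos], Real.pi_pos⟩)
  have hcis : Tendsto (fun N : ℕ => cis (X / N)) atTop (𝓝 1) := by
    have := (continuous_cis.tendsto 0).comp hφ
    rwa [cis_zero] at this
  have hNX : ∀ N : ℕ, (N : ℂ) ≠ 0 → N * (X / N) = X := fun N hN => by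
    have : (N : ℝ) ≠ 0 := by exact_mod_cast hN
    field_simp
  have hε : Tendsto (fun N : ℕ => (N : ℂ)⁻¹) atTop (𝓝 0) := tendsto_natCast_inv tendsto_id
  have hlim2 : Tendsto (fun N : ℕ =>
      derivWithin (hVI N ω₁ ω₂ μ u) unitCircle (cis (X / N)) / (N : ℂ) ^ 2) atTop
      (𝓝 (-(1 / 4))) := by
    have h1 := ((hε.const_mul (deriv u X)).div (hcis.const_mul I) (by simp)).add
      (tendsto_C₁ ω₁ ω₂ μ)
    simp only [mul_zero, zero_div, zero_add] at h1
    refine h1.congr' ?_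
    filter_upwards [hφ', eventually_ge_atTop 1] with N hN hN1
    have hN0 : (N : ℂ) ≠ 0 := by exact_mod_cast (by omega : N ≠ 0)
    rw [derivWithin_hVI N ω₁ ω₂ μ hN (by rw [hNX N hN0]; exact hd X hX)]
    have := cis_ne_zero (X / N)
    simp only [Pi.div_apply]
    field_simp
  refine ⟨?_, hlim2⟩
  rw [sigmaPVAt_hV hJ ω₁ ω₂ μ hd hX hd']
  have hτ : Tendsto (fun N : ℕ => scaledTau N X) atTop (𝓝 X) :=
    tendsto_scaledTau tendsto_id tendsto_const_nhds
  refine (tendsto_scaledSigma hε hτ tendsto_const_nhds tendsto_const_nhds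
    tendsto_const_nhds).congr' ?_
  filter_upwards [hφ', eventually_ge_atTop 1, hlim2.eventually_ne (show -(1 / 4) ≠ (0 : ℂ) by norm_num),
    (tendsto_one_add_mul hε (omega ω₁ ω₂ + μ)).eventually_ne one_ne_zero] with N hN hN1 hN2 hN3
  have hN0 : (N : ℂ) ≠ 0 := by exact_mod_cast (by omega : N ≠ 0)
  have hX' := hNX N hN0
  have h1 := derivWithin_hVI N ω₁ ω₂ μ hN (by rw [hX']; exact hd X hX)
  have h2 := derivWithin_derivWithin_hVI N ω₁ ω₂ μ hJ hN (by rwa [hX']) hd (by rwa [hX'])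
  rw [hX'] at h2
  have h0 : hVI N ω₁ ω₂ μ u (cis (X / N))
      = u X + C₁ N ω₁ ω₂ μ * cis (X / N) - C₂ N ω₁ ω₂ μ := by
    rw [hVI, arg_cis ⟨hN.1, hN.2.le⟩, hX']
  have hne : derivWithin (hVI N ω₁ ω₂ μ u) unitCircle (cis (X / N)) ≠ 0 := fun h =>
    hN2 (by rw [h, zero_div])
  rw [h1] at hne
  rw [sigmaPVIAt, h2, h1, h0, sigmaPVI_eq_scaledSigma ω₁ ω₂ μ _ _ _ (inv_mul_cancel₀ hN0)
    (cis_ne_zero _) (cis_eq_scaledTau hN0 X) hN3,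
    mul_div_cancel_left₀ _ hne, mul_div_cancel_left₀ _ (pow_ne_zero 2 hN0)]

end Reduction

end CircularJacobi

end

/-! ### The exact differential equation at finite N. -/

noncomputable section

namespace CircularJacobi

open Complex Filter Topology

section FiniteN

/-- The Hankel determinant in the scaled variable. -/
def scaledDet (n : ℕ) (ω₁ ω₂ μ : ℝ) (ζ : ℂ) (X : ℝ) : ℂ :=
  (hankel n (momentFunctional n ω₁ ω₂ μ ζ (X / (n + 1 : ℕ)))).det

/-- The pairing of the two orthogonal polynomials under the insertion of the moving pole, in
the scaled variable. -/
def scaledPairing (n : ℕ) (ω₁ ω₂ μ : ℝ) (ζ : ℂ) (φ : ℝ) : ℂ :=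
  insertions (exponents n ω₁ ω₂ μ) (cis φ) (momentFunctional n ω₁ ω₂ μ ζ φ) 2
    (orthPoly n (momentFunctional n ω₁ ω₂ μ ζ φ) * subPoly n (momentFunctional n ω₁ ω₂ μ ζ φ))

/-- The `σ`-function of the average of size `n + 1`, in the scaled variable. -/
def scaledV (n : ℕ) (ω₁ ω₂ μ : ℝ) (ζ : ℂ) (X : ℝ) : ℂ :=
  logDerivForm (n + 1) (exponents n ω₁ ω₂ μ) (cis (X / (n + 1 : ℕ)))
      ((orthPoly n (momentFunctional n ω₁ ω₂ μ ζ (X / (n + 1 : ℕ)))).coeff n)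
    - μ * (n + 1) * (cis (X / (n + 1 : ℕ)) - 1)

/-- The derivative of `scaledV`. -/
def scaledV₁ (n : ℕ) (ω₁ ω₂ μ : ℝ) (ζ : ℂ) (X : ℝ) : ℂ :=
  I * cis (X / (n + 1 : ℕ)) * (μ - (1 + (((n + 1 : ℕ) : ℂ))⁻¹ * (omega ω₁ ω₂ + μ))
    * scaledPairing n ω₁ ω₂ μ ζ (X / (n + 1 : ℕ)))

variable {n : ℕ} {ω₁ ω₂ μ : ℝ} {ζ : ℂ} {X : ℝ}

theorem hasDerivAt_comp_div {f : ℝ → ℂ} {f' : ℂ} {N X : ℝ} (hf : HasDerivAt f f' (X / N)) :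
    HasDerivAt (fun Y => f (Y / N)) ((N : ℂ)⁻¹ * f') X := by
  have h := hf.scomp X ((hasDerivAt_id X).div_const N)
  refine h.congr_deriv ?_
  simp

theorem div_mem_Ioo (hX : X ∈ Set.Ioo 0 (2 * Real.pi * (n + 1 : ℕ))) :
    X / (n + 1 : ℕ) ∈ Set.Ioo 0 (2 * Real.pi) := by
  have hN : (0 : ℝ) < (n + 1 : ℕ) := by positivity
  exact ⟨div_pos hX.1 hN, (div_lt_iff₀ hN).2 hX.2⟩

theorem two_mul_add_sum_exponents :
    2 * ((n : ℂ) + 1) + ∑ i, exponents n ω₁ ω₂ μ i = n + 1 + omega ω₁ ω₂ + μ := by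
  rw [Fin.sum_univ_three, exponents, omega]
  simp only [Matrix.cons_val]
  ring

/-- The real part of N + ω + μ is positive, since N ≥ 1 while ω₁ and μ exceed -1/2. -/
theorem one_add_mul_ne_zero (hω : -(1 / 2) < ω₁) (hμ : -(1 / 2) < μ) :
    1 + (((n + 1 : ℕ) : ℂ))⁻¹ * (omega ω₁ ω₂ + μ) ≠ 0 := by
  have hN : ((n + 1 : ℕ) : ℂ) ≠ 0 := by exact_mod_cast n.succ_ne_zero
  intro h
  have h2 : ((n + 1 : ℕ) : ℂ) + (omega ω₁ ω₂ + μ) = 0 := by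
    linear_combination (((n + 1 : ℕ) : ℂ)) * h
      - (omega ω₁ ω₂ + μ) * mul_inv_cancel₀ hN
  have h3 := congrArg re h2
  simp [omega] at h3
  have : (0 : ℝ) ≤ n := n.cast_nonneg
  linarith

theorem hasDerivAt_scaledV (hω : -(1 / 2) < ω₁) (hμ : -(1 / 2) < μ)
    (hX : X ∈ Set.Ioo 0 (2 * Real.pi * (n + 1 : ℕ))) (hD : scaledDet n ω₁ ω₂ μ ζ X ≠ 0) :
    HasDerivAt (scaledV n ω₁ ω₂ μ ζ) (scaledV₁ n ω₁ ω₂ μ ζ X) X := by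
  have E := hasEvolution_momentFunctional (n := n) (ω₂ := ω₂) (ζ := ζ) hω hμ (div_mem_Ioo hX)
  have hN : ((n + 1 : ℕ) : ℂ) ≠ 0 := by exact_mod_cast n.succ_ne_zero
  set φ := X / ((n + 1 : ℕ) : ℝ) with hφ
  have hp := (E.hasDerivAt_coeff_orthPoly hD)
  have ht := hasDerivAt_cis φ
  have h2 : exponents n ω₁ ω₂ μ 2 = 2 * μ := by simp [exponents]
  have hf := ((hp.const_mul (-(2 * ((n : ℂ) + 1) + ∑ i, exponents n ω₁ ω₂ μ i))).sub_const
    (((n : ℂ) + 1) ^ 2)).add ((((ht.sub_const 1).const_mul (exponents n ω₁ ω₂ μ 2)).sub_const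
    (exponents n ω₁ ω₂ μ 0)).const_mul ((n : ℂ) + 1)) |>.sub
    ((ht.sub_const 1).const_mul (μ * ((n : ℂ) + 1)))
  have h := hasDerivAt_comp_div (N := ((n + 1 : ℕ) : ℝ)) hf
  refine h.congr_deriv ?_
  rw [two_mul_add_sum_exponents, h2, scaledV₁, ← hφ, scaledPairing, ofReal_natCast]
  have hN' : ((n + 1 : ℕ) : ℂ) = n + 1 := by push_cast; rfl
  rw [← hN']
  field_simp
  rw [hN']
  ring

/-- The second derivative of `scaledV` satisfies the scaled `σ`-form of Painlevé VI. -/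
theorem exists_hasDerivAt_scaledV₁ (hω : -(1 / 2) < ω₁) (hμ : -(1 / 2) < μ)
    (hX : X ∈ Set.Ioo 0 (2 * Real.pi * (n + 1 : ℕ))) (hD : scaledDet n ω₁ ω₂ μ ζ X ≠ 0) :
    ∃ v₂, HasDerivAt (scaledV₁ n ω₁ ω₂ μ ζ) v₂ X ∧
      scaledSigma (omega ω₁ ω₂) ((starRingEnd ℂ) (omega ω₁ ω₂)) μ (((n + 1 : ℕ) : ℂ))⁻¹
        (scaledTau (n + 1) X) (scaledV n ω₁ ω₂ μ ζ X) (scaledV₁ n ω₁ ω₂ μ ζ X) v₂ = 0 := by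
  have E := hasEvolution_momentFunctional (n := n) (ω₂ := ω₂) (ζ := ζ) hω hμ (div_mem_Ioo hX)
  have hN : ((n + 1 : ℕ) : ℂ) ≠ 0 := by exact_mod_cast n.succ_ne_zero
  have hN' : ((n + 1 : ℕ) : ℂ) = n + 1 := by push_cast; rfl
  obtain ⟨s, β, x, hs, hrel⟩ := E.exists_relation hD
  have hd := one_add_mul_ne_zero (n := n) (ω₂ := ω₂) hω hμ
  have htt := cis_eq_scaledTau (N := n + 1) hN X
  have ht0 := cis_ne_zero (X / ((n + 1 : ℕ) : ℝ))
  have ht1 := E.ne_one_self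
  have hV₁ : scaledV₁ n ω₁ ω₂ μ ζ X = I * cis (X / (n + 1 : ℕ)) *
    (μ - (1 + (((n + 1 : ℕ) : ℂ))⁻¹ * (omega ω₁ ω₂ + μ))
    * scaledPairing n ω₁ ω₂ μ ζ (X / (n + 1 : ℕ))) := rfl
  set w := omega ω₁ ω₂ with hw
  set wb := (starRingEnd ℂ) w with hwb
  set ε := (((n + 1 : ℕ) : ℂ))⁻¹ with hε
  set τ := scaledTau (n + 1) X with hτ
  set φ := X / ((n + 1 : ℕ) : ℝ) with hφ
  set t := cis φ with ht
  set den := 1 + ε * (w + μ) with hden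
  set b := scaledPairing n ω₁ ω₂ μ ζ φ with hb
  have hwb' : wb = ω₁ - I * ω₂ := by simp [hwb, hw, omega, sub_eq_add_neg]
  have hε0 : ε ≠ 0 := inv_ne_zero hN
  have hτ0 : τ ≠ 0 := by
    intro h
    rw [h, mul_zero, add_zero] at htt
    exact ht1 htt
  have c0 : exponents n ω₁ ω₂ μ 0 = -(((n + 1 : ℕ) : ℂ) + wb + μ) := by
    rw [hwb', hN']; simp only [exponents, Matrix.cons_val]; ring
  have c1 : exponents n ω₁ ω₂ μ 1 = w + wb := by
    rw [hwb', hw, omega]; simp only [exponents, Matrix.cons_val]; ring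
  have c2 : exponents n ω₁ ω₂ μ 2 = 2 * μ := by simp [exponents]
  obtain ⟨hs2, hx, hV⟩ := hrel b rfl
  rw [c0, c2] at hs2
  rw [c0, c1, c2, ← hN'] at hx hV
  -- γ = b_0 - c_0 is the quantity of which N times is `residueG`, regular at ε = 0.
  set γ := β - -(((n + 1 : ℕ) : ℂ) + wb + μ) with hγ
  have hB : b = residueB w μ ε τ (scaledV₁ n ω₁ ω₂ μ ζ X) := by
    rw [residueB, ← htt, hV₁, eq_div_iff hd]
    field_simp
    linear_combination (den * b - μ) * I_sq
  have hβ : β = -(((n + 1 : ℕ) : ℂ) + wb + μ) + γ := by rw [hγ]; ring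
  have hG := eq_residueG (N := ((n + 1 : ℕ) : ℂ)) w wb μ (scaledV n ω₁ ω₂ μ ζ X)
    (scaledV₁ n ω₁ ω₂ μ ζ X) γ (inv_mul_cancel₀ hN) (by rwa [← htt]) hd hB hβ htt hx (by
      rw [scaledV, ← hN', hV]
      ring)
  have hγ' : γ = ε * residueG w wb μ ε τ (scaledV n ω₁ ω₂ μ ζ X)
      (scaledV₁ n ω₁ ω₂ μ ζ X) := by
    rw [← hG, ← mul_assoc, inv_mul_cancel₀ hN, one_mul]
  have hcub := residueCubic_eq (N := ((n + 1 : ℕ) : ℂ)) w wb μ b _ (inv_mul_cancel₀ hN)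
    (by rw [← hγ', ← hβ]) (by rw [← hγ', ← hx])
  have hf := (hasDerivAt_cis φ).const_mul I |>.mul ((hs.const_mul den).const_sub (μ : ℂ))
  have h := hasDerivAt_comp_div (N := ((n + 1 : ℕ) : ℝ)) hf
  rw [ofReal_natCast] at h
  have ht1' : t - 1 = I * ε * τ := by rw [htt]; ring
  refine ⟨ε * (I * (I * t) * (μ - den * b) + I * t * -(den * (I * (t - 1)⁻¹ * s))), h, ?_⟩
  -- The combination u'' - iεu' removes the derivative of the prefactor e^{iφ}, leaving the
  -- derivative of b, that is, s.
  have hS : residueS w μ ε τ (scaledV₁ n ω₁ ω₂ μ ζ X)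
      (ε * (I * (I * t) * (μ - den * b) + I * t * -(den * (I * (t - 1)⁻¹ * s)))) = s := by
    rw [residueS, hV₁, ← htt, ht1', div_eq_iff (mul_ne_zero ht0 hd)]
    field_simp
    linear_combination (-den * s) * I_sq
  rw [scaledSigma, scaledCubic, hS, ← hB, hcub, ← hγ', hs2]
  ring

theorem hasDerivAt_scaledDet (hω : -(1 / 2) < ω₁) (hμ : -(1 / 2) < μ)
    (hX : X ∈ Set.Ioo 0 (2 * Real.pi * (n + 1 : ℕ))) (hD : scaledDet n ω₁ ω₂ μ ζ X ≠ 0) :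
    HasDerivAt (scaledDet n ω₁ ω₂ μ ζ) (scaledDet n ω₁ ω₂ μ ζ X * (((n + 1 : ℕ) : ℂ)⁻¹ * (I *
      (scaledV n ω₁ ω₂ μ ζ X / (cis (X / (n + 1 : ℕ)) - 1) + μ * (n + 1))))) X := by
  have E := hasEvolution_momentFunctional (n := n) (ω₂ := ω₂) (ζ := ζ) hω hμ (div_mem_Ioo hX)
  have h := hasDerivAt_comp_div (N := ((n + 1 : ℕ) : ℝ)) (E.hasDerivAt_det_hankel hD)
  refine h.congr_deriv ?_
  have ht1 := sub_ne_zero.2 E.ne_one_self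
  rw [ofReal_natCast, scaledV, scaledDet]
  field_simp
  ring

theorem continuousAt_scaledDet (hω : -(1 / 2) < ω₁) (hμ : -(1 / 2) < μ)
    (hX : X ∈ Set.Ioo 0 (2 * Real.pi * (n + 1 : ℕ))) :
    ContinuousAt (scaledDet n ω₁ ω₂ μ ζ) X := by
  have E := hasEvolution_momentFunctional (n := n) (ω₂ := ω₂) (ζ := ζ) hω hμ (div_mem_Ioo hX)
  have h : ContinuousAt (fun s => hankel n (momentFunctional n ω₁ ω₂ μ ζ s))
      (X / (n + 1 : ℕ)) :=
    continuousAt_pi.2 fun i => continuousAt_pi.2 fun j => (E.hasDerivAt _).continuousAt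
  have h2 : ContinuousAt (fun Y : ℝ => hankel n (momentFunctional n ω₁ ω₂ μ ζ (Y / (n + 1 : ℕ))))
      X := ContinuousAt.comp (f := fun Y : ℝ => Y / ((n + 1 : ℕ) : ℝ)) h (by fun_prop)
  exact (continuous_id.matrix_det).continuousAt.comp h2

variable {ξ : ℂ}

theorem exists_scaledAverage_eq (n : ℕ) (ω₂ : ℝ) (ξ : ℂ) (hω : -(1 / 2) < ω₁)
    (hμ : -(1 / 2) < μ) :
    ∃ K : ℂ, ∀ X ∈ Set.Ioo 0 (2 * Real.pi * (n + 1 : ℕ)), scaledAverage (n + 1) ω₁ ω₂ μ ξ X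
      = K * cis (-(μ * (X / (n + 1 : ℕ)))) ^ (n + 1) * scaledDet n ω₁ ω₂ μ (xiStar μ ξ) X := by
  obtain ⟨K, hK⟩ := exists_cJacobiAverage_eq n ω₁ ω₂ μ ξ hω hμ
  exact ⟨K, fun X hX => hK _ (div_mem_Ioo hX)⟩

theorem scaledDet_ne_zero (hω : -(1 / 2) < ω₁) (hμ : -(1 / 2) < μ)
    (hX : X ∈ Set.Ioo 0 (2 * Real.pi * (n + 1 : ℕ)))
    (hA : scaledAverage (n + 1) ω₁ ω₂ μ ξ X ≠ 0) : scaledDet n ω₁ ω₂ μ (xiStar μ ξ) X ≠ 0 := by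
  obtain ⟨K, hK⟩ := exists_scaledAverage_eq n ω₂ ξ hω hμ
  rw [hK X hX] at hA
  exact right_ne_zero_of_mul hA

theorem continuousAt_scaledAverage (hω : -(1 / 2) < ω₁) (hμ : -(1 / 2) < μ)
    (hX : X ∈ Set.Ioo 0 (2 * Real.pi * (n + 1 : ℕ))) :
    ContinuousAt (scaledAverage (n + 1) ω₁ ω₂ μ ξ) X := by
  obtain ⟨K, hK⟩ := exists_scaledAverage_eq n ω₂ ξ hω hμ
  have h : ContinuousAt (fun X => K * cis (-(μ * (X / (n + 1 : ℕ)))) ^ (n + 1)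
      * scaledDet n ω₁ ω₂ μ (xiStar μ ξ) X) X :=
    (continuousAt_const.mul ((continuous_cis.comp (by fun_prop)).pow _).continuousAt).mul
      (continuousAt_scaledDet hω hμ hX)
  exact h.congr (by filter_upwards [isOpen_Ioo.mem_nhds hX] with Y hY using (hK Y hY).symm)

/-- The phase e^{-iμφN} contributes -iμ, cancelling the shift by μN(t - 1) in `scaledV`. What is
left is A'/A = V/τ. -/
theorem hasDerivAt_scaledAverage (hω : -(1 / 2) < ω₁) (hμ : -(1 / 2) < μ)
    (hX : X ∈ Set.Ioo 0 (2 * Real.pi * (n + 1 : ℕ)))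
    (hA : scaledAverage (n + 1) ω₁ ω₂ μ ξ X ≠ 0) :
    HasDerivAt (scaledAverage (n + 1) ω₁ ω₂ μ ξ) (scaledAverage (n + 1) ω₁ ω₂ μ ξ X *
      (scaledV n ω₁ ω₂ μ (xiStar μ ξ) X / scaledTau (n + 1) X)) X := by
  have hD := scaledDet_ne_zero hω hμ hX hA
  obtain ⟨K, hK⟩ := exists_scaledAverage_eq n ω₂ ξ hω hμ
  have hN : ((n + 1 : ℕ) : ℂ) ≠ 0 := by exact_mod_cast n.succ_ne_zero
  have hc : HasDerivAt (fun Y : ℝ => cis (-(μ * (Y / (n + 1 : ℕ)))))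
      ((((n + 1 : ℕ) : ℝ) : ℂ)⁻¹ * (-(I * μ) * cis (-(μ * (X / (n + 1 : ℕ)))))) X := by
    refine hasDerivAt_comp_div (f := fun φ => cis (-(μ * φ))) ?_
    have := hasDerivAt_cis_mul (-μ) (X / (n + 1 : ℕ))
    simpa only [neg_mul, ofReal_neg, mul_neg] using this
  have h := ((hc.pow (n + 1)).const_mul K).mul (hasDerivAt_scaledDet hω hμ hX hD)
  refine (h.congr_of_eventuallyEq ?_).congr_deriv ?_
  · filter_upwards [isOpen_Ioo.mem_nhds hX] with Y hY using hK Y hY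
  · have ht1 := (hasEvolution_momentFunctional (n := n) (ω₂ := ω₂) (ζ := xiStar μ ξ) hω hμ
      (div_mem_Ioo hX)).ne_one_self
    have ht1 := sub_ne_zero.2 ht1
    have hc0 := cis_ne_zero (-(μ * (X / (n + 1 : ℕ))))
    rw [hK X hX, scaledTau]
    have hN' : ((n + 1 : ℕ) : ℂ) = n + 1 := by push_cast; rfl
    simp only [Pi.pow_apply, ofReal_natCast, Nat.add_sub_cancel]
    rw [← hN']
    field_simp
    ring

theorem scaledTau_ne_zero (hX : X ∈ Set.Ioo 0 (2 * Real.pi * (n + 1 : ℕ))) :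
    scaledTau (n + 1) X ≠ 0 := by
  have hφ := div_mem_Ioo hX
  have hN : ((n + 1 : ℕ) : ℂ) ≠ 0 := by exact_mod_cast n.succ_ne_zero
  have h1 : cis (X / (n + 1 : ℕ)) ≠ cis 0 := chord_ne_zero_iff.1
    (chord_ne_zero hφ.1.ne' (by rw [sub_zero, abs_of_pos hφ.1]; exact hφ.2))
  rw [cis_zero] at h1
  exact div_ne_zero (mul_ne_zero hN (sub_ne_zero.2 h1)) I_ne_zero

theorem scaledV_eq_mul_scaledLogDeriv (hω : -(1 / 2) < ω₁) (hμ : -(1 / 2) < μ)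
    (hX : X ∈ Set.Ioo 0 (2 * Real.pi * (n + 1 : ℕ)))
    (hA : scaledAverage (n + 1) ω₁ ω₂ μ ξ X ≠ 0) :
    scaledV n ω₁ ω₂ μ (xiStar μ ξ) X
      = scaledTau (n + 1) X / X * scaledLogDeriv (n + 1) ω₁ ω₂ μ ξ X := by
  have hX0 : (X : ℂ) ≠ 0 := by exact_mod_cast hX.1.ne'
  have hτ := scaledTau_ne_zero hX
  rw [scaledLogDeriv, logDeriv_apply, (hasDerivAt_scaledAverage hω hμ hX hA).deriv]
  field_simp

end FiniteN

end CircularJacobi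

end

/-! ### Convergence of derivatives for sequences satisfying the equation. -/

noncomputable section

namespace CircularJacobi

open Filter Topology

section Sequences

/-- The product filter expresses locally uniform statements: one index bound for a whole ball around
X. -/
theorem eventually_atTop_prod_nhds {X : ℝ} {P : ℕ × ℝ → Prop} :
    (∀ᶠ p in atTop ×ˢ 𝓝 X, P p) ↔
      ∃ N, ∃ r > 0, ∀ n ≥ N, ∀ Y, |Y - X| < r → P (n, Y) := by
  rw [(atTop_basis.prod Metric.nhds_basis_ball).eventually_iff]
  constructor
  · rintro ⟨⟨N, r⟩, ⟨-, hr⟩, h⟩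
    exact ⟨N, r, hr, fun n hn Y hY => h ⟨hn, by simpa [Real.dist_eq] using hY⟩⟩
  · rintro ⟨N, r, hr, h⟩
    exact ⟨⟨N, r⟩, ⟨trivial, hr⟩, fun p hp => h p.1 hp.1 p.2 (by
      simpa [Real.dist_eq] using hp.2)⟩

/-- An interior estimate for the first derivative of a function whose second derivative has
at most growth of order `3 / 2` in the first. -/
theorem norm_deriv_le_of_norm_sq_le {f f₁ f₂ : ℝ → ℂ} {x d B k : ℝ} (hd : 0 < d) (hk : 1 ≤ k)
    (h₁ : ∀ y ∈ Set.Icc x (x + d), HasDerivAt f (f₁ y) y)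
    (h₂ : ∀ y ∈ Set.Icc x (x + d), HasDerivAt f₁ (f₂ y) y)
    (hB : ∀ y ∈ Set.Icc x (x + d), ‖f y‖ ≤ B)
    (hg : ∀ y ∈ Set.Icc x (x + d), ‖f₂ y‖ ^ 2 ≤ k ^ 2 * (1 + ‖f₁ y‖) ^ 3) :
    ‖f₁ x‖ ≤ 4 * B / d + 1 + (26 * B * k + 2) ^ 2 := by
  set m := √(1 + ‖f₁ x‖) with hm
  have hm2 : m ^ 2 = 1 + ‖f₁ x‖ := Real.sq_sqrt (by positivity)
  have hm1 : 1 ≤ m := by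
    rw [hm, Real.one_le_sqrt]
    linarith [norm_nonneg (f₁ x)]
  have hB0 : 0 ≤ B := (norm_nonneg _).trans (hB x ⟨le_rfl, by linarith⟩)
  -- With |f₁(x)| of size m², |f₂| is at most of order k m³, so a window of length 1/(8km) changes
  -- f₁ by at most 3m²/8. The increment of f over it is then of order m/k, yet at most 2B, which
  -- bounds m.
  set δ := min d (1 / (8 * k * m)) with hδ
  have hkm : 0 < 8 * k * m := by positivity
  have hδ0 : 0 < δ := lt_min hd (by positivity)
  have hδd : δ ≤ d := min_le_left _ _
  have hδm : δ * (8 * k * m) ≤ 1 := by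
    have := min_le_right d (1 / (8 * k * m))
    rwa [← hδ, le_div_iff₀ hkm] at this
  have hsub : ∀ y ∈ Set.Icc x (x + δ), y ∈ Set.Icc x (x + d) := fun y hy =>
    ⟨hy.1, by linarith [hy.2]⟩
  have hwin : ∀ y ∈ Set.Icc x (x + δ), 3 * k * m ^ 3 * (y - x) ≤ 3 / 8 * m ^ 2 := by
    intro y hy
    have h1 : (y - x) * (8 * k * m) ≤ 1 := by
      refine le_trans ?_ hδm
      gcongr
      linarith [hy.2]
    nlinarith [sq_nonneg m, mul_le_mul_of_nonneg_right h1 (sq_nonneg m)]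
  -- A continuity argument: as long as the bound holds, 1 + |f₁| ≤ 11m²/8, and (11/8)³ < 9 gives the
  -- strict inequality |f₂| < 3km³ needed at the boundary.
  have hmain : ∀ y ∈ Set.Icc x (x + δ), ‖f₁ y - f₁ x‖ ≤ 3 * k * m ^ 3 * (y - x) := by
    refine image_norm_le_of_norm_deriv_right_lt_deriv_boundary (f := fun y => f₁ y - f₁ x)
      (f' := f₂) (B' := fun _ => 3 * k * m ^ 3)
      (fun y hy => ((h₂ y (hsub y hy)).sub_const _).continuousAt.continuousWithinAt)
      (fun y hy => ((h₂ y (hsub y ⟨hy.1, hy.2.le⟩)).sub_const _).hasDerivWithinAt) (by simp)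
      (fun y => by
        simpa using ((hasDerivAt_id y).sub_const x).const_mul (3 * k * m ^ 3)) ?_
    intro y hy hEq
    have hy' : y ∈ Set.Icc x (x + δ) := ⟨hy.1, hy.2.le⟩
    have h3 := hwin y hy'
    have h4 : 1 + ‖f₁ y‖ ≤ 11 / 8 * m ^ 2 := by
      have := norm_le_norm_add_norm_sub' (f₁ y) (f₁ x)
      rw [hEq] at this
      linarith
    have h5 : ‖f₂ y‖ ^ 2 < (3 * k * m ^ 3) ^ 2 := by
      calc ‖f₂ y‖ ^ 2 ≤ k ^ 2 * (1 + ‖f₁ y‖) ^ 3 := hg y (hsub y hy')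
        _ ≤ k ^ 2 * (11 / 8 * m ^ 2) ^ 3 := by gcongr
        _ = (11 / 8) ^ 3 * (k ^ 2 * m ^ 6) := by ring
        _ < 9 * (k ^ 2 * m ^ 6) := by
          have : 0 < k ^ 2 * m ^ 6 := by positivity
          nlinarith
        _ = (3 * k * m ^ 3) ^ 2 := by ring
    exact lt_of_pow_lt_pow_left₀ 2 (by positivity) h5
  have hmv : ‖f (x + δ) - f x - δ * f₁ x‖ ≤ 3 / 8 * m ^ 2 * δ := by
    have h := (convex_Icc x (x + δ)).norm_image_sub_le_of_norm_hasDerivWithin_le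
      (f := fun y => f y - y * f₁ x) (f' := fun y => f₁ y - f₁ x) (C := 3 / 8 * m ^ 2)
      (x := x) (y := x + δ) (fun y hy => by
        have := (h₁ y (hsub y hy)).fun_sub ((Complex.ofRealCLM.hasDerivAt (x := y)).mul_const (f₁ x))
        simpa using this.hasDerivWithinAt)
      (fun y hy => (hmain y hy).trans (hwin y hy)) ⟨le_rfl, by linarith⟩ ⟨by linarith, le_rfl⟩
    have e : f (x + δ) - (x + δ : ℝ) * f₁ x - (f x - x * f₁ x) = f (x + δ) - f x - δ * f₁ x := by
      push_cast
      ring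
    simp only [e] at h
    rwa [add_sub_cancel_left, Real.norm_of_nonneg hδ0.le] at h
  have hδp : δ * ‖f₁ x‖ ≤ 2 * B + 3 / 8 * m ^ 2 * δ := by
    have h1 : ‖(δ : ℂ) * f₁ x‖ = δ * ‖f₁ x‖ := by
      rw [norm_mul, Complex.norm_real, Real.norm_of_nonneg hδ0.le]
    have h2 : (δ : ℂ) * f₁ x = f (x + δ) - f x - (f (x + δ) - f x - δ * f₁ x) := by ring
    rw [← h1, h2]
    have b1 := hB (x + δ) ⟨by linarith, by linarith⟩
    have b2 := hB x ⟨le_rfl, by linarith⟩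
    linarith [norm_sub_le (f (x + δ) - f x) (f (x + δ) - f x - δ * f₁ x),
      norm_sub_le (f (x + δ)) (f x)]
  have hsq : 0 ≤ (26 * B * k + 2) ^ 2 := sq_nonneg _
  have hBd : 0 ≤ 4 * B / d := by positivity
  rcases min_choice d (1 / (8 * k * m)) with h | h
  · rw [← hδ] at h
    rw [h] at hδp
    have : ‖f₁ x‖ ≤ 4 * B / d + 1 := by
      rw [div_add_one hd.ne', le_div_iff₀ hd]
      nlinarith
    linarith
  · rw [← hδ] at h
    have h1 : 5 / 8 * m ^ 2 - 1 ≤ 16 * B * k * m := by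
      have h2 : δ * (5 / 8 * m ^ 2 - 1) ≤ 2 * B := by nlinarith
      have h3 : δ * (8 * k * m) = 1 := by rw [h]; field_simp
      have h4 := mul_le_mul_of_nonneg_right h2 hkm.le
      have h5 : δ * (5 / 8 * m ^ 2 - 1) * (8 * k * m) = 5 / 8 * m ^ 2 - 1 := by
        linear_combination (5 / 8 * m ^ 2 - 1) * h3
      linarith
    -- Dividing 5m²/8 - 1 ≤ 16Bkm by 5m/8 and using m ≥ 1 gives 25.6 Bk + 1.6, rounded up.
    have h6 : m ≤ 26 * B * k + 2 := by
      have hBk : 0 ≤ B * k := by positivity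
      have : m * m ≤ (26 * B * k + 2) * m := by nlinarith
      exact le_of_mul_le_mul_right this (by linarith)
    have h7 : m ^ 2 ≤ (26 * B * k + 2) ^ 2 := by gcongr
    linarith

variable {V V₁ V₂ : ℕ → ℝ → ℂ} {U U₁ : ℝ → ℂ} {X : ℝ}

/-- Local bounds on the first two derivatives. -/
theorem exists_bound_derivs
    (h₁ : ∀ᶠ p : ℕ × ℝ in atTop ×ˢ 𝓝 X, HasDerivAt (V p.1) (V₁ p.1 p.2) p.2)
    (h₂ : ∀ᶠ p : ℕ × ℝ in atTop ×ˢ 𝓝 X, HasDerivAt (V₁ p.1) (V₂ p.1 p.2) p.2)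
    (hg : ∃ C, ∀ᶠ p : ℕ × ℝ in atTop ×ˢ 𝓝 X, ‖V₂ p.1 p.2‖ ^ 2 ≤ C * (1 + ‖V₁ p.1 p.2‖) ^ 3)
    (hV : Tendsto (fun p : ℕ × ℝ => V p.1 p.2) (atTop ×ˢ 𝓝 X) (𝓝 (U X))) :
    ∃ K, ∀ᶠ p : ℕ × ℝ in atTop ×ˢ 𝓝 X, ‖V₁ p.1 p.2‖ ≤ K ∧ ‖V₂ p.1 p.2‖ ≤ K := by
  obtain ⟨C, hC⟩ := hg
  have hVb : ∀ᶠ p : ℕ × ℝ in atTop ×ˢ 𝓝 X, ‖V p.1 p.2‖ ≤ ‖U X‖ + 1 :=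
    hV.norm.eventually_le_const (by linarith)
  obtain ⟨N, r, hr, h⟩ := eventually_atTop_prod_nhds.1 (((h₁.and h₂).and hC).and hVb)
  set k := √(max C 1) with hk
  have hk2 : k ^ 2 = max C 1 := Real.sq_sqrt (le_trans zero_le_one (le_max_right _ _))
  have hk1 : 1 ≤ k := Real.one_le_sqrt.2 (le_max_right _ _)
  set B := ‖U X‖ + 1
  set M := 4 * B / (r / 2) + 1 + (26 * B * k + 2) ^ 2 with hM
  have hM0 : 0 ≤ M := by positivity
  refine ⟨max M (k ^ 2 * (1 + M) ^ 3 + 1), eventually_atTop_prod_nhds.2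
    ⟨N, r / 2, by positivity, fun n hn Y hY => ?_⟩⟩
  have hmem : ∀ y ∈ Set.Icc Y (Y + r / 2), |y - X| < r := by
    intro y hy
    rw [abs_lt] at hY ⊢
    constructor <;> linarith [hy.1, hy.2, hY.1, hY.2]
  have hsq : ∀ y, |y - X| < r → ‖V₂ n y‖ ^ 2 ≤ k ^ 2 * (1 + ‖V₁ n y‖) ^ 3 := by
    intro y hy
    refine (h n hn y hy).1.2.trans ?_
    rw [hk2]
    gcongr
    exact le_max_left _ _
  have hV₁ : ‖V₁ n Y‖ ≤ M :=
    norm_deriv_le_of_norm_sq_le (half_pos hr) hk1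
      (fun y hy => (h n hn y (hmem y hy)).1.1.1) (fun y hy => (h n hn y (hmem y hy)).1.1.2)
      (fun y hy => (h n hn y (hmem y hy)).2) (fun y hy => hsq y (hmem y hy))
  refine ⟨hV₁.trans (le_max_left _ _), le_max_of_le_right ?_⟩
  have h3 : ‖V₂ n Y‖ ^ 2 ≤ k ^ 2 * (1 + M) ^ 3 :=
    (hsq Y (by linarith)).trans (by gcongr)
  nlinarith [sq_nonneg (‖V₂ n Y‖ - 1), norm_nonneg (V₂ n Y)]

/-- Convergence of the first derivatives. -/
theorem exists_tendsto_deriv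
    (h₁ : ∀ᶠ p : ℕ × ℝ in atTop ×ˢ 𝓝 X, HasDerivAt (V p.1) (V₁ p.1 p.2) p.2)
    (h₂ : ∀ᶠ p : ℕ × ℝ in atTop ×ˢ 𝓝 X, HasDerivAt (V₁ p.1) (V₂ p.1 p.2) p.2)
    {K : ℝ} (hK : ∀ᶠ p : ℕ × ℝ in atTop ×ˢ 𝓝 X, ‖V₂ p.1 p.2‖ ≤ K)
    (hV : ∀ᶠ Y in 𝓝 X, Tendsto (fun p : ℕ × ℝ => V p.1 p.2) (atTop ×ˢ 𝓝 Y) (𝓝 (U Y))) :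
    ∃ L, Tendsto (fun p : ℕ × ℝ => V₁ p.1 p.2) (atTop ×ˢ 𝓝 X) (𝓝 L) := by
  refine cauchy_map_iff_exists_tendsto.1 (Metric.cauchy_iff.2 ⟨inferInstance, fun ε hε => ?_⟩)
  -- The common centre is a difference quotient of the limit U with a fixed step η. It is compared
  -- with the quotient of V, which lies within Kη of V₁.
  suffices h : ∃ z : ℂ, ∀ᶠ p : ℕ × ℝ in atTop ×ˢ 𝓝 X, ‖V₁ p.1 p.2 - z‖ < ε / 2 by
    obtain ⟨z, hz⟩ := h
    refine ⟨Metric.ball z (ε / 2), ?_, fun a ha b hb => ?_⟩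
    · rw [mem_map]
      filter_upwards [hz] with p hp
      simpa [dist_eq_norm] using hp
    · have := dist_triangle_right a b z
      rw [Metric.mem_ball] at ha hb
      linarith
  obtain ⟨N, r, hr, h⟩ := eventually_atTop_prod_nhds.1 ((h₁.and h₂).and hK)
  have hK0 : 0 ≤ K := (norm_nonneg _).trans (h N le_rfl X (by simpa using hr)).2
  obtain ⟨r', hr', hV'⟩ := Metric.eventually_nhds_iff.1 hV
  obtain ⟨η, hη0, hηr, hηr', hηK⟩ : ∃ η : ℝ, 0 < η ∧ η < r / 2 ∧ η < r' ∧ K * η < ε / 4 := by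
    refine ⟨min (min (r / 4) (r' / 2)) (ε / (8 * (K + 1))), by positivity, ?_, ?_, ?_⟩
    · exact ((min_le_left _ _).trans (min_le_left _ _)).trans_lt (by linarith)
    · exact ((min_le_left _ _).trans (min_le_right _ _)).trans_lt (by linarith)
    · have := min_le_right (min (r / 4) (r' / 2)) (ε / (8 * (K + 1)))
      rw [le_div_iff₀ (by positivity)] at this
      nlinarith [show 0 < min (min (r / 4) (r' / 2)) (ε / (8 * (K + 1))) by positivity]
  have hX := hV' (y := X) (by simpa using hr')
  have hXη := hV' (y := X + η) (by simpa [Real.dist_eq, abs_of_pos hη0] using hηr')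
  have hsh : Tendsto (fun p : ℕ × ℝ => (p.1, p.2 + η)) (atTop ×ˢ 𝓝 X) (atTop ×ˢ 𝓝 (X + η)) :=
    tendsto_fst.prodMk (tendsto_snd.add_const η)
  have hq := ((hXη.comp hsh).sub hX).div_const (η : ℂ)
  refine ⟨(U (X + η) - U X) / η, ?_⟩
  have hq' := (Metric.tendsto_nhds.1 hq) (ε / 4) (by linarith)
  have hnear : ∀ᶠ p : ℕ × ℝ in atTop ×ˢ 𝓝 X, N ≤ p.1 ∧ |p.2 - X| < r / 2 :=
    eventually_atTop_prod_nhds.2 ⟨N, r / 2, by positivity, fun n hn Y hY => ⟨hn, hY⟩⟩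
  filter_upwards [hq', hnear]
  rintro ⟨n, Y⟩ hp ⟨hn, hY⟩
  simp only [Function.comp_apply, dist_eq_norm] at hp hn hY ⊢
  have hmem : ∀ y ∈ Set.Icc Y (Y + η), |y - X| < r := by
    intro y hy
    rw [abs_lt] at hY ⊢
    constructor <;> linarith [hy.1, hy.2, hY.1, hY.2]
  have hlip : ∀ y ∈ Set.Icc Y (Y + η), ‖V₁ n y - V₁ n Y‖ ≤ K * η := by
    intro y hy
    have := (convex_Icc Y (Y + η)).norm_image_sub_le_of_norm_hasDerivWithin_le
      (f := V₁ n) (f' := V₂ n) (C := K) (fun z hz => (h n hn z (hmem z hz)).1.2.hasDerivWithinAt)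
      (fun z hz => (h n hn z (hmem z hz)).2) ⟨le_rfl, by linarith⟩ hy
    refine this.trans ?_
    gcongr
    rw [Real.norm_of_nonneg (by linarith [hy.1])]
    linarith [hy.2]
  have hmv := (convex_Icc Y (Y + η)).norm_image_sub_le_of_norm_hasDerivWithin_le
      (f := fun y => V n y - y * V₁ n Y) (f' := fun y => V₁ n y - V₁ n Y) (C := K * η)
      (x := Y) (y := Y + η) (fun y hy => by
        have := (h n hn y (hmem y hy)).1.1.fun_sub
          ((Complex.ofRealCLM.hasDerivAt (x := y)).mul_const (V₁ n Y))
        simpa using this.hasDerivWithinAt) hlip ⟨le_rfl, by linarith⟩ ⟨by linarith, le_rfl⟩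
  have hη : (η : ℂ) ≠ 0 := by exact_mod_cast hη0.ne'
  have e : V n (Y + η) - (Y + η : ℝ) * V₁ n Y - (V n Y - Y * V₁ n Y)
      = η * ((V n (Y + η) - V n Y) / η - V₁ n Y) := by
    push_cast
    field_simp
    ring
  simp only [e] at hmv
  rw [add_sub_cancel_left, Real.norm_of_nonneg hη0.le, norm_mul, Complex.norm_real,
    Real.norm_of_nonneg hη0.le, mul_comm η] at hmv
  have hmv' := le_of_mul_le_mul_right hmv hη0
  have e2 : V₁ n Y - (U (X + η) - U X) / η = ((V n (Y + η) - V n Y) / η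
      - (U (X + η) - U X) / η) - ((V n (Y + η) - V n Y) / η - V₁ n Y) := by ring
  rw [e2]
  refine (norm_sub_le _ _).trans_lt ?_
  linarith

/-- Joint convergence at X keeps V close to U(X) on a ball; letting n → ∞ at fixed Y puts U(Y) there
too. -/
theorem tendstoUniformlyOnFilter_of_tendsto
    (h : ∀ᶠ Y in 𝓝 X, Tendsto (fun p : ℕ × ℝ => V p.1 p.2) (atTop ×ˢ 𝓝 Y) (𝓝 (U Y))) :
    TendstoUniformlyOnFilter V U atTop (𝓝 X) := by
  rw [Metric.tendstoUniformlyOnFilter_iff]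
  intro ε hε
  have hX := (Metric.tendsto_nhds.1 h.self_of_nhds) (ε / 2) (half_pos hε)
  obtain ⟨N, r, hr, hN⟩ := eventually_atTop_prod_nhds.1 hX
  obtain ⟨r', hr', hY⟩ := Metric.eventually_nhds_iff.1 h
  refine eventually_atTop_prod_nhds.2 ⟨N, min r r', lt_min hr hr', fun n hn Y hYr => ?_⟩
  have h1 := hN n hn Y (hYr.trans_le (min_le_left _ _))
  have h2 : dist (U Y) (U X) ≤ ε / 2 := by
    have h3 := (hY (y := Y) (hYr.trans_le (min_le_right _ _))).comp
      ((tendsto_id (α := ℕ) (x := atTop)).prodMk (tendsto_const_nhds (x := Y)))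
    refine le_of_tendsto (h3.dist tendsto_const_nhds) ?_
    filter_upwards [eventually_ge_atTop N] with m hm
    exact (hN m hm Y (hYr.trans_le (min_le_left _ _))).le
  have := dist_triangle_right (U Y) (V n Y) (U X)
  simp only at h1 ⊢
  linarith

theorem hasDerivAt_of_tendsto
    (h₁ : ∀ᶠ p : ℕ × ℝ in atTop ×ˢ 𝓝 X, HasDerivAt (V p.1) (V₁ p.1 p.2) p.2)
    (hV : ∀ᶠ Y in 𝓝 X, Tendsto (fun p : ℕ × ℝ => V p.1 p.2) (atTop ×ˢ 𝓝 Y) (𝓝 (U Y)))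
    (hV₁ : ∀ᶠ Y in 𝓝 X, Tendsto (fun p : ℕ × ℝ => V₁ p.1 p.2) (atTop ×ˢ 𝓝 Y) (𝓝 (U₁ Y))) :
    HasDerivAt U (U₁ X) X := by
  refine hasDerivAt_of_tendstoUniformlyOnFilter (tendstoUniformlyOnFilter_of_tendsto hV₁) h₁ ?_
  filter_upwards [hV] with Y hY
  exact hY.comp ((tendsto_id (α := ℕ) (x := atTop)).prodMk (tendsto_const_nhds (x := Y)))

/-- If the squares of the derivatives converge, then so do the derivatives up to sign. -/
theorem exists_hasDerivAt_of_tendsto_sq {ρ : ℂ}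
    (h₂ : ∀ᶠ p : ℕ × ℝ in atTop ×ˢ 𝓝 X, HasDerivAt (V₁ p.1) (V₂ p.1 p.2) p.2)
    (hV₁ : ∀ᶠ Y in 𝓝 X, Tendsto (fun p : ℕ × ℝ => V₁ p.1 p.2) (atTop ×ˢ 𝓝 Y) (𝓝 (U₁ Y)))
    (hρ : Tendsto (fun p : ℕ × ℝ => V₂ p.1 p.2 ^ 2) (atTop ×ˢ 𝓝 X) (𝓝 ρ)) :
    ∃ r, r ^ 2 = ρ ∧ HasDerivAt U₁ r X := by
  replace hV₁ : ∀ᶠ Y in 𝓝 X, Tendsto (fun n => V₁ n Y) atTop (𝓝 (U₁ Y)) := by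
    filter_upwards [hV₁] with Y hY
    exact hY.comp ((tendsto_id (α := ℕ) (x := atTop)).prodMk (tendsto_const_nhds (x := Y)))
  obtain ⟨r, hr⟩ := IsAlgClosed.exists_pow_nat_eq ρ (n := 2) two_pos
  -- the estimate with a fixed sign
  let P : ℂ → ℝ → Prop := fun r η => ∃ δ > 0, ∀ Y, |Y - X| < δ →
    ‖U₁ Y - U₁ X - (Y - X) * r‖ ≤ η * |Y - X|
  have hP : ∀ r, (∀ η > 0, P r η) → HasDerivAt U₁ r X := by
    intro r h
    rw [hasDerivAt_iff_isLittleO, Asymptotics.isLittleO_iff]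
    intro η hη
    obtain ⟨δ, hδ, h'⟩ := h η hη
    refine Metric.eventually_nhds_iff.2 ⟨δ, hδ, fun Y hY => ?_⟩
    simpa using h' Y hY
  have mono : ∀ r η η', η ≤ η' → P r η → P r η' := by
    rintro r η η' hη ⟨δ, hδ, h⟩
    exact ⟨δ, hδ, fun Y hY => (h Y hY).trans (by gcongr)⟩
  -- If r fails for some η₀ it fails for every smaller tolerance by monotonicity, so -r works for
  -- all of them.
  suffices key : ∀ η > 0, P r η ∨ P (-r) η by
    by_cases h : ∀ η > 0, P r η
    · exact ⟨r, hr, hP r h⟩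
    · push Not at h
      obtain ⟨η₀, hη₀, hn⟩ := h
      refine ⟨-r, by rw [neg_sq, hr], hP _ fun η hη => ?_⟩
      have := (key (min η η₀) (lt_min hη hη₀)).resolve_left
        fun h' => hn (mono _ _ _ (min_le_right _ _) h')
      exact mono _ _ _ (min_le_left _ _) this
  intro η hη
  -- reduction to a common sign of the derivatives for infinitely many indices
  have reduce : ∀ r : ℂ, ∀ δ > 0, (∃ᶠ n in atTop, ∀ Y, |Y - X| < δ →
      HasDerivAt (V₁ n) (V₂ n Y) Y ∧ ‖V₂ n Y - r‖ ≤ η) → P r η := by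
    intro r δ hδ hfreq
    obtain ⟨δ', hδ', hlim⟩ := Metric.eventually_nhds_iff.1 hV₁
    refine ⟨min δ δ', lt_min hδ hδ', fun Y hY => ?_⟩
    have hX0 := hlim (y := X) (by simpa using hδ')
    have hY0 := hlim (y := Y) (hY.trans_le (min_le_right _ _))
    have hl := ((hY0.sub hX0).sub_const ((Y - X) * r)).norm
    refine le_of_tendsto_of_frequently hl (hfreq.mono fun n hn => ?_)
    have hball : Convex ℝ (Metric.ball X δ) := convex_ball X δ
    have := hball.norm_image_sub_le_of_norm_hasDerivWithin_le
      (f := fun y => V₁ n y - y * r) (f' := fun y => V₂ n y - r) (C := η) (x := X) (y := Y)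
      (fun y hy => by
        have := (hn y hy).1.fun_sub ((Complex.ofRealCLM.hasDerivAt (x := y)).mul_const r)
        simpa using this.hasDerivWithinAt) (fun y hy => (hn y hy).2)
      (Metric.mem_ball_self hδ) (hY.trans_le (min_le_left _ _))
    rw [Real.norm_eq_abs] at this
    have e : V₁ n Y - Y * r - (V₁ n X - X * r) = V₁ n Y - V₁ n X - (Y - X) * r := by ring
    rwa [e] at this
  by_cases hr0 : r = 0
  · left
    rw [← hr, hr0, zero_pow two_ne_zero] at hρ
    have hb : ∀ᶠ p : ℕ × ℝ in atTop ×ˢ 𝓝 X, ‖V₂ p.1 p.2 - r‖ ≤ η := by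
      have := hρ.norm.eventually_le_const (u := η ^ 2) (by simpa using pow_pos hη 2)
      filter_upwards [this] with p hp
      rw [hr0, sub_zero]
      rw [norm_pow] at hp
      exact le_of_sq_le_sq hp hη.le
    obtain ⟨N, δ, hδ, h⟩ := eventually_atTop_prod_nhds.1 (h₂.and hb)
    refine reduce r δ hδ (Eventually.frequently ?_)
    filter_upwards [eventually_ge_atTop N] with n hn Y hY using h n hn Y hY
  · have hr1 : 0 < ‖r‖ := norm_pos_iff.2 hr0
    -- The radius ‖r‖/2 keeps the discs around r and -r on opposite sides of the line Re(z r̄) = 0.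
    set η' := min η (‖r‖ / 2) with hη'
    have hη'0 : 0 < η' := by positivity
    -- the derivatives are close to one of the two roots
    have hb : ∀ᶠ p : ℕ × ℝ in atTop ×ˢ 𝓝 X, ‖V₂ p.1 p.2 - r‖ ≤ η' ∨ ‖V₂ p.1 p.2 + r‖ ≤ η' := by
      have h := (hρ.sub_const ρ).norm.eventually_le_const (u := η' ^ 2)
        (by simpa using pow_pos hη'0 2)
      filter_upwards [h] with p hp
      by_contra! hcon
      rw [← hr, sq_sub_sq, norm_mul] at hp
      nlinarith [hcon.1, hcon.2]
    obtain ⟨N, δ, hδ, h⟩ := eventually_atTop_prod_nhds.1 (h₂.and hb)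
    -- The function Re(V₁ r̄) has a nowhere vanishing derivative on the ball. Derivatives have the
    -- intermediate value property, so its sign is constant; continuity of V₂ is not needed.
    have hsign : ∀ n ≥ N, (∀ Y, |Y - X| < δ → HasDerivAt (V₁ n) (V₂ n Y) Y ∧ ‖V₂ n Y - r‖ ≤ η) ∨
        ∀ Y, |Y - X| < δ → HasDerivAt (V₁ n) (V₂ n Y) Y ∧ ‖V₂ n Y - -r‖ ≤ η := by
      intro n hn
      have hre : ∀ (z s : ℂ), ‖z - s‖ ≤ η' → ‖s‖ = ‖r‖ → 0 < (z * (starRingEnd ℂ) s).re := by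
        intro z s hz hs
        have h1 : (z * (starRingEnd ℂ) s).re
            = ‖s‖ ^ 2 + ((z - s) * (starRingEnd ℂ) s).re := by
          rw [sub_mul, Complex.sub_re, Complex.mul_conj, Complex.normSq_eq_norm_sq,
            Complex.ofReal_re]
          ring
        have h2 := Complex.abs_re_le_norm ((z - s) * (starRingEnd ℂ) s)
        rw [norm_mul, RCLike.norm_conj, hs] at h2
        have h3 : ‖z - s‖ ≤ ‖r‖ / 2 := hz.trans (min_le_right _ _)
        have h4 := (abs_le.1 h2).1
        rw [h1, hs]
        nlinarith
      have hg : ∀ Y ∈ Metric.ball X δ, HasDerivWithinAt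
          (fun y => (V₁ n y * (starRingEnd ℂ) r).re) ((V₂ n Y * (starRingEnd ℂ) r).re)
          (Metric.ball X δ) Y := by
        intro Y hY
        have := ((h n hn Y hY).1.mul_const ((starRingEnd ℂ) r))
        exact (Complex.reCLM.hasFDerivAt.comp_hasDerivAt Y this).hasDerivWithinAt
      have hneg : ∀ z : ℂ, ‖z + r‖ ≤ η' → (z * (starRingEnd ℂ) r).re < 0 := by
        intro z hz
        have := hre z (-r) (by rwa [sub_neg_eq_add]) (norm_neg r)
        rw [map_neg, mul_neg, Complex.neg_re] at this
        linarith
      have hne : ∀ Y ∈ Metric.ball X δ, (V₂ n Y * (starRingEnd ℂ) r).re ≠ 0 := by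
        intro Y hY
        rcases (h n hn Y hY).2 with h' | h'
        · exact (hre _ r h' rfl).ne'
        · exact (hneg _ h').ne
      rcases hasDerivWithinAt_forall_lt_or_forall_gt_of_forall_ne (convex_ball X δ) hg hne
        with hlt | hgt
      · right
        intro Y hY
        refine ⟨(h n hn Y hY).1, ?_⟩
        rcases (h n hn Y hY).2 with h' | h'
        · exact absurd (hlt Y hY) (hre _ r h' rfl).not_gt
        · rw [sub_neg_eq_add]
          exact h'.trans (min_le_left _ _)
      · left
        intro Y hY
        refine ⟨(h n hn Y hY).1, ?_⟩
        rcases (h n hn Y hY).2 with h' | h'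
        · exact h'.trans (min_le_left _ _)
        · exact absurd (hgt Y hY) (hneg _ h').not_gt
    by_cases hfr : ∃ᶠ n in atTop, ∀ Y, |Y - X| < δ →
        HasDerivAt (V₁ n) (V₂ n Y) Y ∧ ‖V₂ n Y - r‖ ≤ η
    · exact Or.inl (reduce r δ hδ hfr)
    · right
      rw [not_frequently] at hfr
      refine reduce (-r) δ hδ (Eventually.frequently ?_)
      filter_upwards [hfr, eventually_ge_atTop N] with n h1 h2
      exact (hsign n h2).resolve_left h1

end Sequences

end CircularJacobi

end

/-! ### Uniform nonvanishing of the averages and passage to the limit. -/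

noncomputable section

namespace CircularJacobi

open Complex Filter Topology

section Nonvanishing

/-- Up to the first zero, |f|² e^{2Cx} is nondecreasing, so it cannot fall from a positive value to
0. -/
theorem ne_zero_of_norm_deriv_le_Icc {f : ℝ → ℂ} {a b C : ℝ}
    (hc : ∀ y ∈ Set.Icc a b, ContinuousAt f y)
    (h : ∀ y ∈ Set.Icc a b, f y ≠ 0 → ∃ f', HasDerivAt f f' y ∧ ‖f'‖ ≤ C * ‖f y‖)
    (h0 : f a ≠ 0) : ∀ y ∈ Set.Icc a b, f y ≠ 0 := by
  by_contra! hcon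
  obtain ⟨y, hy, hy0⟩ := hcon
  have hcl : IsCompact (Set.Icc a b ∩ f ⁻¹' {0}) := isCompact_Icc.of_isClosed_subset
    (ContinuousOn.preimage_isClosed_of_isClosed (fun z hz => (hc z hz).continuousWithinAt)
      isClosed_Icc isClosed_singleton) Set.inter_subset_left
  obtain ⟨z, ⟨hz, hz0⟩, hmin⟩ := hcl.exists_isLeast ⟨y, hy, hy0⟩
  have hne : ∀ x ∈ Set.Ico a z, f x ≠ 0 := fun x hx hx0 =>
    absurd (hmin ⟨⟨hx.1, hx.2.le.trans hz.2⟩, hx0⟩) (not_le.2 hx.2)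
  have hmem : ∀ x ∈ Set.Icc a z, x ∈ Set.Icc a b := fun x hx => ⟨hx.1, hx.2.trans hz.2⟩
  have hmono : MonotoneOn (fun x => ‖f x‖ ^ 2 * Real.exp (2 * C * x)) (Set.Icc a z) := by
    refine monotoneOn_of_deriv_nonneg (convex_Icc a z) (fun x hx => ?_) (fun x hx => ?_)
      fun x hx => ?_
    · exact ((((hc x (hmem x hx)).norm.pow 2).mul (by fun_prop))).continuousWithinAt
    all_goals
      rw [interior_Icc] at hx
      obtain ⟨f', hf', hle⟩ := h x (hmem x ⟨hx.1.le, hx.2.le⟩) (hne x ⟨hx.1.le, hx.2⟩)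
      have hd := hf'.norm_sq.mul (((hasDerivAt_id x).const_mul (2 * C)).exp)
    · exact hd.differentiableAt.differentiableWithinAt
    · rw [show deriv (fun x => ‖f x‖ ^ 2 * Real.exp (2 * C * x)) x = _ from hd.deriv]
      have h1 := (abs_le.1 (abs_real_inner_le_norm (f x) f')).1
      have h2 : 0 ≤ 2 * inner ℝ (f x) f' + ‖f x‖ ^ 2 * (2 * C) := by
        nlinarith [norm_nonneg (f x), mul_le_mul_of_nonneg_left hle (norm_nonneg (f x))]
      have h3 := mul_nonneg h2 (Real.exp_pos (2 * C * x)).le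
      simp only [id, mul_one]
      linarith
  have := hmono ⟨le_rfl, hz.1⟩ ⟨hz.1, le_rfl⟩ hz.1
  simp only [show f z = 0 from hz0, norm_zero, zero_pow two_ne_zero, zero_mul] at this
  have hpos : 0 < ‖f a‖ ^ 2 * Real.exp (2 * C * a) := by positivity
  linarith

theorem ne_zero_of_norm_deriv_le {f : ℝ → ℂ} {X r C : ℝ}
    (hc : ∀ y, |y - X| < r → ContinuousAt f y)
    (h : ∀ y, |y - X| < r → f y ≠ 0 → ∃ f', HasDerivAt f f' y ∧ ‖f'‖ ≤ C * ‖f y‖)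
    (h0 : f X ≠ 0) : ∀ y, |y - X| < r → f y ≠ 0 := by
  intro y hy
  rw [abs_lt] at hy
  have hr : ∀ z, X - |y - X| ≤ z → z ≤ X + |y - X| → |z - X| < r := by
    intro z h1 h2
    have : |z - X| ≤ |y - X| := abs_le.2 ⟨by linarith, by linarith⟩
    exact this.trans_lt (abs_lt.2 hy)
  rcases le_total X y with hXy | hXy
  · rw [abs_of_nonneg (sub_nonneg.2 hXy)] at hr
    have hm : ∀ z ∈ Set.Icc X y, |z - X| < r := fun z hz =>
      hr z (by linarith [hz.1]) (by linarith [hz.2])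
    exact ne_zero_of_norm_deriv_le_Icc (fun z hz => hc z (hm z hz)) (fun z hz => h z (hm z hz)) h0 y
      ⟨hXy, le_rfl⟩
  · rw [abs_of_nonpos (sub_nonpos.2 hXy)] at hr
    have hm : ∀ z ∈ Set.Icc (-X) (-y), |-z - X| < r := fun z hz =>
      hr (-z) (by linarith [hz.2]) (by linarith [hz.1])
    have := ne_zero_of_norm_deriv_le_Icc (f := fun z => f (-z)) (C := C)
      (fun z hz => ContinuousAt.comp (f := fun z : ℝ => -z) (hc _ (hm z hz)) (by fun_prop))
      (fun z hz hz0 => ?_) (by simpa using h0) (-y) ⟨by linarith, le_rfl⟩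
    · simpa using this
    · obtain ⟨f', hf', hle⟩ := h _ (hm z hz) hz0
      refine ⟨-f', ?_, by rwa [norm_neg]⟩
      simpa [Function.comp_def] using hf'.scomp z (hasDerivAt_neg z)

end Nonvanishing

section Limit

variable {ω₁ ω₂ μ : ℝ} {ξ : ℂ} {J : Set ℝ}

theorem eventually_mem_Ioo {X : ℝ} (hX : 0 < X) :
    ∀ᶠ p : ℕ × ℝ in atTop ×ˢ 𝓝 X, p.2 ∈ Set.Ioo 0 (2 * Real.pi * (p.1 + 1 : ℕ)) := by
  obtain ⟨N, hN⟩ := exists_nat_gt X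
  refine eventually_atTop_prod_nhds.2 ⟨N, min X (N - X), lt_min hX (by linarith),
    fun n hn Y hY => ?_⟩
  have h1 := abs_lt.1 (hY.trans_le (min_le_left _ _))
  have h2 := abs_lt.1 (hY.trans_le (min_le_right _ _))
  have h3 : (N : ℝ) ≤ n := by exact_mod_cast hn
  refine ⟨by linarith [h1.1], ?_⟩
  push_cast
  have h4 : (0 : ℝ) ≤ n := n.cast_nonneg
  nlinarith [Real.pi_gt_three, h2.2]

theorem continuousAt_scaledTau (n : ℕ) (X : ℝ) : ContinuousAt (scaledTau n) X := by
  have := continuous_cis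
  unfold scaledTau
  fun_prop

theorem continuousAt_scaledLogDeriv {n : ℕ} {X : ℝ} (hω : -(1 / 2) < ω₁) (hμ : -(1 / 2) < μ)
    (hX : X ∈ Set.Ioo 0 (2 * Real.pi * (n + 1 : ℕ)))
    (hA : scaledAverage (n + 1) ω₁ ω₂ μ ξ X ≠ 0) :
    ContinuousAt (scaledLogDeriv (n + 1) ω₁ ω₂ μ ξ) X := by
  have h : ContinuousAt (fun Y : ℝ => scaledV n ω₁ ω₂ μ (xiStar μ ξ) Y
      * (Y / scaledTau (n + 1) Y)) X :=
    (hasDerivAt_scaledV hω hμ hX (scaledDet_ne_zero hω hμ hX hA)).continuousAt.mul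
      (continuous_ofReal.continuousAt.div (continuousAt_scaledTau _ _) (scaledTau_ne_zero hX))
  refine h.congr ?_
  filter_upwards [isOpen_Ioo.mem_nhds hX,
    (continuousAt_scaledAverage hω hμ hX).eventually_ne hA] with Y hY hAY
  have hY0 : (Y : ℂ) ≠ 0 := by exact_mod_cast hY.1.ne'
  have hτ := scaledTau_ne_zero hY
  rw [scaledV_eq_mul_scaledLogDeriv hω hμ hY hAY]
  field_simp

theorem tendsto_succ_prod (X : ℝ) :
    Tendsto (fun p : ℕ × ℝ => (p.1 + 1, p.2)) (atTop ×ˢ 𝓝 X) (atTop ×ˢ 𝓝 X) :=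
  ((tendsto_add_atTop_nat 1).comp tendsto_fst).prodMk tendsto_snd

theorem eventually_fst {P : ℕ → Prop} (h : ∀ᶠ n in atTop, P n) (X : ℝ) :
    ∀ᶠ p : ℕ × ℝ in atTop ×ˢ 𝓝 X, P (p.1 + 1) :=
  (tendsto_succ_prod X).eventually (tendsto_fst.eventually h)

theorem tendsto_inv_succ (X : ℝ) :
    Tendsto (fun p : ℕ × ℝ => (((p.1 + 1 : ℕ) : ℂ))⁻¹) (atTop ×ˢ 𝓝 X) (𝓝 0) :=
  tendsto_natCast_inv (tendsto_fst.comp (tendsto_succ_prod X))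

theorem tendsto_scaledTau_succ (X : ℝ) :
    Tendsto (fun p : ℕ × ℝ => scaledTau (p.1 + 1) p.2) (atTop ×ˢ 𝓝 X) (𝓝 (X : ℂ)) :=
  tendsto_scaledTau (tendsto_fst.comp (tendsto_succ_prod X)) tendsto_snd

section Scalar

variable {α : Type*} {l : Filter α} {w wb m : ℂ} {ε τ u u₁ u₂ : α → ℂ} {z v v₁ : ℂ}

/-- Solves the scaled equation for the square of the second derivative, corrected by iε times the
first. Growth and convergence of the second derivatives are both read off from this form. -/
theorem eventually_sq_eq (hz : z ≠ 0) (hε : Tendsto ε l (𝓝 0)) (hτ : Tendsto τ l (𝓝 z))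
    (h : ∀ᶠ a in l, scaledSigma w wb m (ε a) (τ a) (u a) (u₁ a) (u₂ a) = 0) :
    ∀ᶠ a in l, (u₂ a - I * ε a * u₁ a) ^ 2
      = ((1 + I * ε a * τ a) * (1 + ε a * (w + m)) / (I * τ a)) ^ 2
        * scaledCubic w wb m (ε a) (τ a) (u a) (u₁ a) := by
  filter_upwards [h, (tendsto_one_add_mul hε (w + m)).eventually_ne one_ne_zero,
    (tendsto_one_add_I_mul hε hτ).eventually_ne one_ne_zero, hτ.eventually_ne hz]
    with a h0 h1 h2 h3
  have h4 := (mul_eq_zero.1 h0).resolve_left (pow_ne_zero 2 h1)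
  rw [sub_eq_zero] at h4
  rw [← h4, residueS]
  have := I_ne_zero
  field_simp

theorem tendsto_factor (hz : z ≠ 0) (hε : Tendsto ε l (𝓝 0)) (hτ : Tendsto τ l (𝓝 z)) :
    Tendsto (fun a => ((1 + I * ε a * τ a) * (1 + ε a * (w + m)) / (I * τ a)) ^ 2) l
      (𝓝 ((1 / (I * z)) ^ 2)) := by
  have h := (((tendsto_one_add_I_mul hε hτ).mul (tendsto_one_add_mul hε (w + m))).div
    (hτ.const_mul I) (mul_ne_zero I_ne_zero hz)).pow 2
  rwa [one_mul] at h

theorem exists_growth (hz : z ≠ 0) (hε : Tendsto ε l (𝓝 0)) (hτ : Tendsto τ l (𝓝 z))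
    (hu : Tendsto u l (𝓝 v))
    (h : ∀ᶠ a in l, scaledSigma w wb m (ε a) (τ a) (u a) (u₁ a) (u₂ a) = 0) :
    ∃ C, ∀ᶠ a in l, ‖u₂ a‖ ^ 2 ≤ C * (1 + ‖u₁ a‖) ^ 3 := by
  have h1 := ((tendsto_factor (w := w) (m := m) hz hε hτ).isBigO_one ℝ).mul
    (isBigO_scaledCubic (w := w) (wb := wb) (μ := m) (u₁ := u₁) hε hτ hu)
  obtain ⟨C, hC⟩ := h1.bound
  refine ⟨2 * C + 2, ?_⟩
  filter_upwards [hC, eventually_sq_eq hz hε hτ h,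
    hε.norm.eventually_le_const (show ‖(0 : ℂ)‖ < 1 by simp)] with a h1 h2 h3
  rw [← h2, one_mul, Real.norm_of_nonneg (by positivity), norm_pow] at h1
  have h4 : ‖u₂ a‖ ≤ ‖u₂ a - I * ε a * u₁ a‖ + ‖u₁ a‖ := by
    have h5 : ‖I * ε a * u₁ a‖ ≤ ‖u₁ a‖ := by
      rw [norm_mul, norm_mul, norm_I, one_mul]
      exact mul_le_of_le_one_left (norm_nonneg _) h3
    have h6 := norm_add_le (u₂ a - I * ε a * u₁ a) (I * ε a * u₁ a)
    rw [sub_add_cancel] at h6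
    linarith
  have h7 : ‖u₁ a‖ ^ 2 ≤ (1 + ‖u₁ a‖) ^ 3 := by
    have := norm_nonneg (u₁ a)
    nlinarith [pow_nonneg this 3]
  nlinarith [sq_nonneg (‖u₂ a - I * ε a * u₁ a‖ - ‖u₁ a‖), norm_nonneg (u₂ a)]

theorem tendsto_sq (hz : z ≠ 0) (hε : Tendsto ε l (𝓝 0)) (hτ : Tendsto τ l (𝓝 z))
    (hu : Tendsto u l (𝓝 v)) (hu₁ : Tendsto u₁ l (𝓝 v₁))
    (h : ∀ᶠ a in l, scaledSigma w wb m (ε a) (τ a) (u a) (u₁ a) (u₂ a) = 0)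
    {K : ℝ} (hK : ∀ᶠ a in l, ‖u₂ a‖ ≤ K) :
    Tendsto (fun a => u₂ a ^ 2) l (𝓝 ((1 / (I * z)) ^ 2 * scaledCubic w wb m 0 z v v₁)) := by
  have h1 : Tendsto (fun a => (u₂ a - I * ε a * u₁ a) ^ 2) l
      (𝓝 ((1 / (I * z)) ^ 2 * scaledCubic w wb m 0 z v v₁)) :=
    ((tendsto_factor hz hε hτ).mul (tendsto_scaledCubic hε hτ hu hu₁)).congr'
      ((eventually_sq_eq hz hε hτ h).mono fun a ha => ha.symm)
  have h2 : Tendsto (fun a => I * ε a * u₁ a) l (𝓝 0) := by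
    simpa using (hε.const_mul I).mul hu₁
  have h3 : Tendsto (fun a => u₂ a * (I * ε a * u₁ a)) l (𝓝 0) := by
    have hb : u₂ =O[l] fun _ => (1 : ℝ) :=
      Asymptotics.IsBigO.of_bound K (hK.mono fun a ha => by simpa using ha)
    have := hb.mul_isLittleO ((Asymptotics.isLittleO_one_iff ℝ).2 h2)
    rw [← Asymptotics.isLittleO_one_iff ℝ]
    simpa using this
  have h4 := (h1.add (h3.const_mul 2)).sub (h2.pow 2)
  simp only [mul_zero, add_zero, zero_pow two_ne_zero, sub_zero] at h4
  refine h4.congr fun a => ?_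
  ring

end Scalar

/-- The hypotheses on the sequence of averages. -/
structure ScaledLimit (ω₁ ω₂ μ : ℝ) (ξ : ℂ) (J : Set ℝ) : Prop where
  omega_gt : -(1 / 2) < ω₁
  mu_gt : -(1 / 2) < μ
  isOpen : IsOpen J
  pos : J ⊆ Set.Ioi 0
  ne_zero : ∀ X ∈ J, ∀ᶠ N : ℕ in atTop, scaledAverage N ω₁ ω₂ μ ξ X ≠ 0
  tendsto : TendstoLocallyUniformlyOn (fun (N : ℕ) (X : ℝ) => scaledLogDeriv N ω₁ ω₂ μ ξ X)
    (scaledU ω₁ ω₂ μ ξ) atTop J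

namespace ScaledLimit

variable (H : ScaledLimit ω₁ ω₂ μ ξ J) {X : ℝ} (hX : X ∈ J)
include H hX

/-- Continuity of a uniform limit at X needs only one close approximant continuous at X itself, so
nonvanishing at X alone suffices. -/
theorem continuousAt_scaledU : ContinuousAt (scaledU ω₁ ω₂ μ ξ) X := by
  have h := continuousWithinAt_of_locally_uniform_approx_of_continuousWithinAt
    (f := scaledU ω₁ ω₂ μ ξ) (s := J) hX fun u hu => ?_
  · exact h.continuousAt (H.isOpen.mem_nhds hX)
  · obtain ⟨t, ht, hev⟩ := H.tendsto u hu X hX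
    have hr : ∀ᶠ n : ℕ in atTop, X ∈ Set.Ioo 0 (2 * Real.pi * (n + 1 : ℕ)) :=
      ((eventually_mem_Ioo (H.pos hX)).curry).mono fun n hn => hn.self_of_nhds
    obtain ⟨n, ⟨h1, h2⟩, h3⟩ := (((tendsto_add_atTop_nat 1).eventually
      (hev.and (H.ne_zero X hX))).and hr).exists
    exact ⟨t, ht, _,
      (continuousAt_scaledLogDeriv H.omega_gt H.mu_gt h3 h2).continuousWithinAt, h1⟩

theorem tendsto_scaledLogDeriv :
    Tendsto (fun p : ℕ × ℝ => scaledLogDeriv p.1 ω₁ ω₂ μ ξ p.2) (atTop ×ˢ 𝓝 X)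
      (𝓝 (scaledU ω₁ ω₂ μ ξ X)) := by
  rw [Metric.tendsto_nhds]
  intro ε hε
  obtain ⟨t, ht, hev⟩ := Metric.tendstoLocallyUniformlyOn_iff.1 H.tendsto (ε / 2) (half_pos hε) X hX
  rw [H.isOpen.nhdsWithin_eq hX] at ht
  have hc := Metric.tendsto_nhds.1 (H.continuousAt_scaledU hX).tendsto (ε / 2) (half_pos hε)
  filter_upwards [tendsto_fst.eventually hev, tendsto_snd.eventually ht,
    tendsto_snd.eventually hc] with p h1 h2 h3
  have h4 := h1 p.2 h2
  have := dist_triangle (scaledLogDeriv p.1 ω₁ ω₂ μ ξ p.2) (scaledU ω₁ ω₂ μ ξ p.2)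
    (scaledU ω₁ ω₂ μ ξ X)
  rw [dist_comm] at h4
  linarith

/-- Nonvanishing is assumed pointwise, with N depending on X. The logarithmic derivatives are
bounded near X for all large N, so a value nonzero at X stays nonzero on a fixed ball. At a zero of
the average `logDeriv` takes the value 0 by division by zero, so the derivative is estimated only
where the average is nonzero. -/
theorem eventually_scaledAverage_ne_zero :
    ∀ᶠ p : ℕ × ℝ in atTop ×ˢ 𝓝 X, scaledAverage (p.1 + 1) ω₁ ω₂ μ ξ p.2 ≠ 0 := by
  have hX0 : 0 < X := H.pos hX
  have hb := ((H.tendsto_scaledLogDeriv hX).comp (tendsto_succ_prod X)).norm.eventually_le_const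
    (lt_add_one _)
  obtain ⟨N, r, hr, h⟩ := eventually_atTop_prod_nhds.1
    ((hb.and (eventually_mem_Ioo hX0)).and (eventually_fst (H.ne_zero X hX) X))
  refine eventually_atTop_prod_nhds.2 ⟨N, min r (X / 2), by positivity, fun n hn => ?_⟩
  set B := ‖scaledU ω₁ ω₂ μ ξ X‖ + 1
  refine ne_zero_of_norm_deriv_le (C := B / (X / 2)) (fun Y hY => ?_) (fun Y hY hA => ?_)
    (h n hn X (by simpa using hr)).2
  · exact continuousAt_scaledAverage H.omega_gt H.mu_gt
      (h n hn Y (hY.trans_le (min_le_left _ _))).1.2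
  · obtain ⟨⟨hu, hm⟩, -⟩ := h n hn Y (hY.trans_le (min_le_left _ _))
    have hY0 : (Y : ℂ) ≠ 0 := by exact_mod_cast hm.1.ne'
    refine ⟨_, hasDerivAt_scaledAverage H.omega_gt H.mu_gt hm hA, ?_⟩
    have hτ := scaledTau_ne_zero hm
    rw [scaledV_eq_mul_scaledLogDeriv H.omega_gt H.mu_gt hm hA]
    have e : scaledTau (n + 1) Y / Y * scaledLogDeriv (n + 1) ω₁ ω₂ μ ξ Y / scaledTau (n + 1) Y
        = scaledLogDeriv (n + 1) ω₁ ω₂ μ ξ Y / Y := by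
      field_simp
    rw [e, norm_mul, norm_div, norm_real, Real.norm_of_nonneg hm.1.le, mul_comm]
    have hY2 := (abs_lt.1 (hY.trans_le (min_le_right _ _))).1
    have hu' : ‖scaledLogDeriv (n + 1) ω₁ ω₂ μ ξ Y‖ ≤ B := hu
    gcongr
    linarith

theorem tendsto_scaledV :
    Tendsto (fun p : ℕ × ℝ => scaledV p.1 ω₁ ω₂ μ (xiStar μ ξ) p.2) (atTop ×ˢ 𝓝 X)
      (𝓝 (scaledU ω₁ ω₂ μ ξ X)) := by
  have hX0 : (X : ℂ) ≠ 0 := by exact_mod_cast (H.pos hX).ne'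
  have hτ := tendsto_scaledTau (tendsto_fst.comp (tendsto_succ_prod X))
    (tendsto_snd (f := (atTop : Filter ℕ)) (g := 𝓝 X))
  have h := (hτ.div ((continuous_ofReal.tendsto X).comp tendsto_snd) hX0).mul
    ((H.tendsto_scaledLogDeriv hX).comp (tendsto_succ_prod X))
  rw [div_self hX0, one_mul] at h
  refine h.congr' ?_
  filter_upwards [eventually_mem_Ioo (H.pos hX), H.eventually_scaledAverage_ne_zero hX]
    with p h1 h2
  exact (scaledV_eq_mul_scaledLogDeriv H.omega_gt H.mu_gt h1 h2).symm

theorem eventually_hasDerivAt :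
    ∀ᶠ p : ℕ × ℝ in atTop ×ˢ 𝓝 X,
      HasDerivAt (scaledV p.1 ω₁ ω₂ μ (xiStar μ ξ)) (scaledV₁ p.1 ω₁ ω₂ μ (xiStar μ ξ) p.2) p.2 ∧
      HasDerivAt (scaledV₁ p.1 ω₁ ω₂ μ (xiStar μ ξ))
        (deriv (scaledV₁ p.1 ω₁ ω₂ μ (xiStar μ ξ)) p.2) p.2 ∧
      scaledSigma (omega ω₁ ω₂) ((starRingEnd ℂ) (omega ω₁ ω₂)) μ (((p.1 + 1 : ℕ) : ℂ))⁻¹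
        (scaledTau (p.1 + 1) p.2) (scaledV p.1 ω₁ ω₂ μ (xiStar μ ξ) p.2)
        (scaledV₁ p.1 ω₁ ω₂ μ (xiStar μ ξ) p.2)
        (deriv (scaledV₁ p.1 ω₁ ω₂ μ (xiStar μ ξ)) p.2) = 0 := by
  filter_upwards [eventually_mem_Ioo (H.pos hX), H.eventually_scaledAverage_ne_zero hX]
    with p h1 h2
  have hD := scaledDet_ne_zero H.omega_gt H.mu_gt h1 h2
  obtain ⟨v₂, hv, hs⟩ := exists_hasDerivAt_scaledV₁ H.omega_gt H.mu_gt h1 hD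
  rw [hv.deriv]
  exact ⟨hasDerivAt_scaledV H.omega_gt H.mu_gt h1 hD, hv, hs⟩

theorem exists_bound : ∃ K, ∀ᶠ p : ℕ × ℝ in atTop ×ˢ 𝓝 X,
    ‖scaledV₁ p.1 ω₁ ω₂ μ (xiStar μ ξ) p.2‖ ≤ K ∧
      ‖deriv (scaledV₁ p.1 ω₁ ω₂ μ (xiStar μ ξ)) p.2‖ ≤ K := by
  have h := H.eventually_hasDerivAt hX
  have hX0 : (X : ℂ) ≠ 0 := by exact_mod_cast (H.pos hX).ne'
  exact exists_bound_derivs (V := fun n => scaledV n ω₁ ω₂ μ (xiStar μ ξ))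
    (V₁ := fun n => scaledV₁ n ω₁ ω₂ μ (xiStar μ ξ))
    (V₂ := fun n => deriv (scaledV₁ n ω₁ ω₂ μ (xiStar μ ξ)))
    (h.mono fun p hp => hp.1) (h.mono fun p hp => hp.2.1)
    (exists_growth hX0 (tendsto_inv_succ X) (tendsto_scaledTau_succ X) (H.tendsto_scaledV hX)
      (h.mono fun p hp => hp.2.2)) (H.tendsto_scaledV hX)

theorem exists_tendsto_scaledV₁ : ∃ L, Tendsto
    (fun p : ℕ × ℝ => scaledV₁ p.1 ω₁ ω₂ μ (xiStar μ ξ) p.2) (atTop ×ˢ 𝓝 X) (𝓝 L) := by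
  have h := H.eventually_hasDerivAt hX
  obtain ⟨K, hK⟩ := H.exists_bound hX
  exact exists_tendsto_deriv (V := fun n => scaledV n ω₁ ω₂ μ (xiStar μ ξ))
    (V₁ := fun n => scaledV₁ n ω₁ ω₂ μ (xiStar μ ξ))
    (V₂ := fun n => deriv (scaledV₁ n ω₁ ω₂ μ (xiStar μ ξ)))
    (h.mono fun p hp => hp.1) (h.mono fun p hp => hp.2.1) (hK.mono fun p hp => hp.2)
    (by filter_upwards [H.isOpen.mem_nhds hX] with Y hY using H.tendsto_scaledV hY)

omit hX

/-- The scaled limit satisfies the `σ`-form of Painlevé V. -/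
theorem exists_derivs : ∃ U₁ U₂ : ℝ → ℂ, ∀ X ∈ J, HasDerivAt (scaledU ω₁ ω₂ μ ξ) (U₁ X) X ∧
    HasDerivAt U₁ (U₂ X) X ∧ scaledSigma (omega ω₁ ω₂) ((starRingEnd ℂ) (omega ω₁ ω₂)) μ 0 X
      (scaledU ω₁ ω₂ μ ξ X) (U₁ X) (U₂ X) = 0 := by
  choose! U₁ hU₁ using fun X hX => H.exists_tendsto_scaledV₁ (X := X) hX
  have key : ∀ X ∈ J, ∃ r, HasDerivAt (scaledU ω₁ ω₂ μ ξ) (U₁ X) X ∧ HasDerivAt U₁ r X ∧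
      scaledSigma (omega ω₁ ω₂) ((starRingEnd ℂ) (omega ω₁ ω₂)) μ 0 X
      (scaledU ω₁ ω₂ μ ξ X) (U₁ X) r = 0 := by
    intro X hX
    have hX0 : (X : ℂ) ≠ 0 := by exact_mod_cast (H.pos hX).ne'
    have h := H.eventually_hasDerivAt hX
    obtain ⟨K, hK⟩ := H.exists_bound hX
    have hJ := H.isOpen.mem_nhds hX
    have hsq := tendsto_sq hX0 (tendsto_inv_succ X) (tendsto_scaledTau_succ X)
      (H.tendsto_scaledV hX) (hU₁ X hX) (h.mono fun p hp => hp.2.2) (hK.mono fun p hp => hp.2)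
    obtain ⟨r, hr, hd⟩ := exists_hasDerivAt_of_tendsto_sq (U₁ := U₁)
      (V₁ := fun n => scaledV₁ n ω₁ ω₂ μ (xiStar μ ξ))
      (V₂ := fun n => deriv (scaledV₁ n ω₁ ω₂ μ (xiStar μ ξ)))
      (h.mono fun p hp => hp.2.1) (by filter_upwards [hJ] with Y hY using hU₁ Y hY) hsq
    refine ⟨r, ?_, hd, ?_⟩
    · exact hasDerivAt_of_tendsto (V := fun n => scaledV n ω₁ ω₂ μ (xiStar μ ξ))
        (V₁ := fun n => scaledV₁ n ω₁ ω₂ μ (xiStar μ ξ)) (h.mono fun p hp => hp.1)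
        (by filter_upwards [hJ] with Y hY using H.tendsto_scaledV hY)
        (by filter_upwards [hJ] with Y hY using hU₁ Y hY)
    -- At ε = 0 the equation says (iXr)² equals the cubic, which is how r² was obtained.
    · have e : residueS (omega ω₁ ω₂) μ 0 X (U₁ X) r = I * X * r := by
        simp [residueS]
      rw [scaledSigma, e, mul_pow, hr]
      field_simp
      ring
  choose! U₂ hU₂ using key
  exact ⟨U₁, U₂, hU₂⟩

theorem solvesSigmaPV :
    SolvesSigmaPV (vV ω₁ ω₂ μ) (rotated J) (hV ω₁ ω₂ μ (scaledU ω₁ ω₂ μ ξ)) := by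
  obtain ⟨U₁, U₂, h⟩ := H.exists_derivs
  have h1 : ∀ X ∈ J, HasDerivAt (scaledU ω₁ ω₂ μ ξ) (U₁ X) X := fun X hX => (h X hX).1
  refine ⟨?_, fun t ht => ?_, fun t ht => ?_, fun t ht => ?_⟩
  · have hc : (starRingEnd ℂ) (omega ω₁ ω₂) = ω₁ - I * ω₂ := by
      simp [omega, sub_eq_add_neg]
    rw [Fin.sum_univ_four]
    simp only [vV, hc, Matrix.cons_val]
    rw [omega]
    ring
  all_goals obtain ⟨X, hX, rfl⟩ := mem_rotated.1 ht
  · exact (hasDerivWithinAt_hV ω₁ ω₂ μ hX (h1 X hX)).differentiableWithinAt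
  · exact (hasDerivWithinAt_derivWithin_hV H.isOpen ω₁ ω₂ μ h1 hX
      (h X hX).2.1).differentiableWithinAt
  · rw [sigmaPVAt_hV H.isOpen ω₁ ω₂ μ h1 hX (h X hX).2.1]
    exact (h X hX).2.2

end ScaledLimit

end Limit

end CircularJacobi

end

theorem mainTheorem4 (ω₁ ω₂ μ : ℝ) :
    -- the reduction of the equation in the limit
    (∀ (J : Set ℝ) (u : ℝ → ℂ), IsOpen J → J ⊆ Set.Ioi 0 →
      DifferentiableOn ℝ u J → DifferentiableOn ℝ (deriv u) J →
      ∀ X ∈ J,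
        Filter.Tendsto
          (fun N : ℕ =>
            CircularJacobi.sigmaPVIAt (CircularJacobi.bVI N ω₁ ω₂ μ) CircularJacobi.unitCircle
              (CircularJacobi.hVI N ω₁ ω₂ μ u) (CircularJacobi.cis (X / N))
            / derivWithin (CircularJacobi.hVI N ω₁ ω₂ μ u) CircularJacobi.unitCircle
                (CircularJacobi.cis (X / N))
            / (N : ℂ) ^ 2)
          Filter.atTop
          (nhds (CircularJacobi.sigmaPVAt (CircularJacobi.vV ω₁ ω₂ μ) (CircularJacobi.rotated J)
            (CircularJacobi.hV ω₁ ω₂ μ u) (-(Complex.I * X)))) ∧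
        Filter.Tendsto
          (fun N : ℕ =>
            derivWithin (CircularJacobi.hVI N ω₁ ω₂ μ u) CircularJacobi.unitCircle
              (CircularJacobi.cis (X / N)) / (N : ℂ) ^ 2)
          Filter.atTop (nhds (-(1 / 4)))) ∧
    -- the equation for the scaled average
    (-(1 / 2) < ω₁ → -(1 / 2) < μ →
      ∀ (ξ : ℂ) (J : Set ℝ), IsOpen J → J ⊆ Set.Ioi 0 →
        (∀ X ∈ J, ∀ᶠ N : ℕ in Filter.atTop,
          CircularJacobi.scaledAverage N ω₁ ω₂ μ ξ X ≠ 0) →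
        TendstoLocallyUniformlyOn
          (fun (N : ℕ) (X : ℝ) => CircularJacobi.scaledLogDeriv N ω₁ ω₂ μ ξ X)
          (CircularJacobi.scaledU ω₁ ω₂ μ ξ) Filter.atTop J →
        CircularJacobi.SolvesSigmaPV (CircularJacobi.vV ω₁ ω₂ μ) (CircularJacobi.rotated J)
          (CircularJacobi.hV ω₁ ω₂ μ (CircularJacobi.scaledU ω₁ ω₂ μ ξ))) := by
  refine ⟨fun J u hJ _ hu hu' X hX => ?_, fun hω hμ ξ J hJ hJ0 hne hlim => ?_⟩
  · exact CircularJacobi.tendsto_sigmaPVIAt ω₁ ω₂ μ hJ hu hu' hX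
  · exact CircularJacobi.ScaledLimit.solvesSigmaPV ⟨hω, hμ, hJ, hJ0, hne, hlim⟩
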